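/- A \emph{von Neumann probability space} is a pair $(M,\phi)$ of a von Neumann algebra $M$ and a normal state $\phi$ on $M$. Write $\lambda_M$ for the GNS representation of $M$ on $L^2(M,\phi)$, with cyclic vector $\hat 1_M$. The \emph{central support} of $\phi$ is the central projection $z_\phi\in M$ with $\ker\lambda_M=M(1-z_\phi)$. Let $(M_i,\phi_i)_{i\in\Lambda}$ be von Neumann probability spaces, for an arbitrary index set $\Lambda$. Their tensor product $\bigotimes_i M_i$ is the von Neumann algebra on the Hilbert space $\bigotimes_i(L^2(M_i,\phi_i),\hat 1_{M_i})$ generated by the operators $\otimes_i x_i$ (where $x_i\in M_i$ acts through $\lambda_{M_i}$ and $x_i=1$ for all but finitely many $i$), with the vector state $\otimes_i\phi_i$ of $\otimes_i\hat 1_{M_i}$. Their free product $\ast_iM_i$ is the von Neumann algebra on the free product Hilbert space $\ast_i(L^2(M_i,\phi_i),\hat 1_{M_i})$ generated by the images of the left representations $\lambda:M_j\to\mathcal L(\ast_iL^2(M_i,\phi_i))$, $j\in\Lambda$, with the vacuum vector state $\ast_i\phi_i$. For each $i\in\Lambda$ let $\theta_i:M_i\to M_i$ be a normal unital $*$-endomorphism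 with $\phi_i\circ\theta_i=\phi_i$. \textbf{(1a)} Let $N_\otimes\subseteq\bigotimes_iM_i$ be the von Neumann subalgebra generated by the elements $\otimes_i\theta_i(x_i)$, and let $z\in N_\otimes$ be the central support of the restriction of $\otimes_i\phi_i$ to $N_\otimes$. There is a unique normal, not necessarily unital, $*$-endomorphism $T=\otimes_i\theta_i$ of $\bigotimes_iM_i$ such that $T(1)=z$ and $$T(\otimes_ix_i)=z\,(\otimes_i\theta_i(x_i))$$ for all families of $x_i=x_i^*\in M_i$ with $x_i=1$ for all but finitely many $i$. \textbf{(1b)} Let $N_\ast\subseteq\ast_iM_i$ be the von Neumann subalgebra generated by the elements $\lambda(\theta_j(x_j))$, and let $z\in N_\ast$ be the central support of the restriction of $\ast_i\phi_i$ to $N_\ast$. There is a unique normal, not necessarily unital, $*$-endomorphism $T=\ast_i\theta_i$ of $\ast_iM_i$ such that $T(1)=z$ and $$T(\lambda(x_j))=z\,\lambda(\theta_j(x_j))\qquad\text{for all }j\in\Lambda,\ x_j\in M_j.$$ \textbf{(2)} If every $M_i$ is a factor, then $z=1$ in (1a) and in (1b), and the $\theta_i$, $\otimes_i\theta_i$ and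 $\ast_i\theta_i$ are injective unital $*$-endomorphisms; $\otimes_i\theta_i$ and $\ast_i\theta_i$ are the unique normal unital $*$-endomorphisms with $(\otimes_i\theta_i)(\otimes_ix_i)=\otimes_i\theta_i(x_i)$ (for $x_i$ as in (1a)) and $(\ast_i\theta_i)(\lambda(x_j))=\lambda(\theta_j(x_j))$, respectively. -/

import Mathlib

open scoped ComplexOrder InnerProductSpace
open UniformSpace

noncomputable section

/-! ## Von Neumann algebras -/

namespace VonNeumannAlgebra

variable {H : Type*} [NormedAddCommGroup H] [InnerProductSpace ℂ H] [CompleteSpace H]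

instance instSMulMemClassComplex : SMulMemClass (VonNeumannAlgebra H) ℂ (H →L[ℂ] H) where
  smul_mem {S} r _ hx := S.toStarSubalgebra.smul_mem hx r

instance instIsClosed (S : VonNeumannAlgebra H) : IsClosed (S : Set (H →L[ℂ] H)) := by
  rw [← S.centralizer_centralizer]
  exact Set.isClosed_centralizer _

/-- A von Neumann algebra is a C⋆-algebra, with the operations and the norm of `B(H)`. -/
instance instCStarAlgebra (S : VonNeumannAlgebra H) : CStarAlgebra S :=
  StarSubalgebra.cstarAlgebra S

/-- The order on a von Neumann algebra is the operator order inherited from `B(H)`; its positive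
elements are those of the form `star s * s` with `s` in the algebra. -/
instance instStarOrderedRing (S : VonNeumannAlgebra H) : StarOrderedRing S := by
  refine StarOrderedRing.of_nonneg_iff' ?_ ?_
  · intro x y hxy z
    have : (x : H →L[ℂ] H) ≤ y := hxy
    change (z : H →L[ℂ] H) + x ≤ z + y
    gcongr
  · intro x
    constructor
    · intro hx
      have hx' : (0 : H →L[ℂ] H) ≤ x := hx
      have hmem : CFC.sqrt (x : H →L[ℂ] H) ∈ S := by
        rw [← SetLike.mem_coe, ← S.centralizer_centralizer]
        intro y hy
        have hc : Commute (x : H →L[ℂ] H) y := (hy x x.2)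
        exact ((hc.cfcₙ_nnreal _).symm).eq
      refine ⟨⟨_, hmem⟩, Subtype.ext ?_⟩
      have hs : star (CFC.sqrt (x : H →L[ℂ] H)) = CFC.sqrt (x : H →L[ℂ] H) :=
        (IsSelfAdjoint.of_nonneg (CFC.sqrt_nonneg _)).star_eq
      change (x : H →L[ℂ] H) = star (CFC.sqrt (x : H →L[ℂ] H)) * CFC.sqrt (x : H →L[ℂ] H)
      rw [hs, CFC.sqrt_mul_sqrt_self _ hx']
    · rintro ⟨s, rfl⟩
      change (0 : H →L[ℂ] H) ≤ star (s : H →L[ℂ] H) * s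
      exact star_mul_self_nonneg _

/-- The von Neumann algebra `(X ∪ X*)''` generated by a set `X` of bounded operators. -/
def generatedBy (X : Set (H →L[ℂ] H)) : VonNeumannAlgebra H where
  toStarSubalgebra :=
    StarSubalgebra.centralizer ℂ (StarSubalgebra.centralizer ℂ X : Set (H →L[ℂ] H))
  centralizer_centralizer' := by
    change Set.centralizer (Set.centralizer (Set.centralizer _)) = Set.centralizer _
    exact Set.centralizer_centralizer_centralizer _

lemma subset_generatedBy (X : Set (H →L[ℂ] H)) : X ⊆ generatedBy X := by
  intro x hx
  change x ∈ Set.centralizer ((StarSubalgebra.centralizer ℂ X : Set (H →L[ℂ] H)) ∪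
    star (StarSubalgebra.centralizer ℂ X : Set (H →L[ℂ] H)))
  intro y hy
  have hy' : y ∈ StarSubalgebra.centralizer ℂ X := by
    rcases hy with hy | hy
    · exact hy
    · have := star_mem (s := StarSubalgebra.centralizer ℂ X) hy
      rwa [star_star] at this
  exact ((StarSubalgebra.mem_centralizer_iff ℂ).1 hy' x hx).1.symm

/-- A factor: a von Neumann algebra whose center consists of the scalars only. -/
def IsFactor (S : VonNeumannAlgebra H) : Prop :=
  ∀ x : S, (∀ y : S, x * y = y * x) → ∃ c : ℂ, x = c • (1 : S)

/-- Normal (that is, `σ`-weakly continuous linear) functionals on a von Neumann algebra: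
`f x = ∑ₙ ⟪ξₙ, x ηₙ⟫` with `∑ ‖ξₙ‖² < ∞` and `∑ ‖ηₙ‖² < ∞`. -/
def IsNormalFunctional (S : VonNeumannAlgebra H) (f : S → ℂ) : Prop :=
  ∃ ξ η : ℕ → H, Summable (fun n => ‖ξ n‖ ^ 2) ∧ Summable (fun n => ‖η n‖ ^ 2) ∧
    ∀ x : S, HasSum (fun n => ⟪ξ n, (x : H →L[ℂ] H) (η n)⟫_ℂ) (f x)

variable {K : Type*} [NormedAddCommGroup K] [InnerProductSpace ℂ K] [CompleteSpace K]

/-- Normal (that is, `σ`-weakly continuous) maps between von Neumann algebras, for linear maps: the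
`σ`-weak topology is the initial topology for the normal functionals, so that a linear map is normal
if and only if it pulls normal functionals back to normal functionals. -/
def IsNormalMap {S : VonNeumannAlgebra H} {R : VonNeumannAlgebra K} (T : S → R) : Prop :=
  ∀ f : R → ℂ, R.IsNormalFunctional f → S.IsNormalFunctional (f ∘ T)

/-- Normal states on a von Neumann algebra. -/
structure NormalState (S : VonNeumannAlgebra H) where
  toPositiveLinearMap : S →ₚ[ℂ] ℂ
  map_one : toPositiveLinearMap 1 = 1
  normal : S.IsNormalFunctional toPositiveLinearMap

namespace NormalState

variable {S : VonNeumannAlgebra H} (φ : NormalState S)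

/-- The GNS space `L²(S, φ)`. -/
abbrev L2 : Type _ := φ.toPositiveLinearMap.GNS

/-- The GNS representation of `S` on `L²(S, φ)`. -/
def rep : S →⋆ₐ[ℂ] (φ.L2 →L[ℂ] φ.L2) := φ.toPositiveLinearMap.gnsStarAlgHom

/-- The canonical cyclic vector of `L²(S, φ)`, the class of `1`. -/
def cyclic : φ.L2 := ((φ.toPositiveLinearMap.toPreGNS 1 : φ.toPositiveLinearMap.PreGNS) : φ.L2)

lemma norm_cyclic : ‖φ.cyclic‖ = 1 := by
  rw [cyclic, Completion.norm_coe, PositiveLinearMap.preGNS_norm_def]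
  simp [φ.map_one]

/-- `z` is the central support of the normal state `φ` of `S`: it is the central projection of `S`
for which the kernel of the GNS representation is `S (1 - z)`. -/
structure IsCentralSupport (z : S) : Prop where
  isStarProjection : IsStarProjection z
  central : ∀ x : S, z * x = x * z
  ker_rep : ∀ x : S, φ.rep x = 0 ↔ ∃ y : S, x = y * (1 - z)

end NormalState

/-- The vector state `x ↦ ⟪Ω, x Ω⟫` of a unit vector `Ω`. -/
def vectorState (S : VonNeumannAlgebra H) (Ω : H) (hΩ : ‖Ω‖ = 1) : NormalState S where
  toPositiveLinearMap := PositiveLinearMap.mk₀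
    { toFun := fun x => ⟪Ω, (x : H →L[ℂ] H) Ω⟫_ℂ
      map_add' := fun x y => by simp
      map_smul' := fun c x => by
        change ⟪Ω, c • ((x : H →L[ℂ] H) Ω)⟫_ℂ = _
        simp }
    (fun x hx => by
      have hx' : (0 : H →L[ℂ] H) ≤ x := hx
      exact ((ContinuousLinearMap.nonneg_iff_isPositive _).1 hx').inner_nonneg_right Ω)
  map_one := by
    change ⟪Ω, Ω⟫_ℂ = 1
    simp [inner_self_eq_norm_sq_to_K, hΩ]
  normal := by
    have hs : Summable (fun n : ℕ => ‖(if n = 0 then Ω else 0 : H)‖ ^ 2) :=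
      summable_of_ne_finset_zero (s := {0}) (fun n hn => by
        have : n ≠ 0 := by simpa using hn
        simp [this])
    refine ⟨fun n => if n = 0 then Ω else 0, fun n => if n = 0 then Ω else 0, hs, hs,
      fun x => ?_⟩
    have := hasSum_single (f := fun n : ℕ =>
      ⟪(if n = 0 then Ω else 0 : H), (x : H →L[ℂ] H) (if n = 0 then Ω else 0)⟫_ℂ) 0
      (fun n hn => by simp [hn])
    simp only [if_true] at this
    exact this

end VonNeumannAlgebra

/-! ## Hilbert spaces spanned by vectors with prescribed inner products -/

lemma Matrix.posSemidef_gram_all {X F : Type*} [NormedAddCommGroup F] [InnerProductSpace ℂ F]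
    (v : X → F) : (Matrix.gram ℂ v).PosSemidef := by
  refine ⟨Matrix.isHermitian_gram ℂ v, fun c => ?_⟩
  have : (c.sum fun i xi => c.sum fun j xj => star xi * Matrix.gram ℂ v i j * xj) =
      ⟪c.sum fun i xi => xi • v i, c.sum fun i xi => xi • v i⟫_ℂ := by
    simp only [Finsupp.sum, sum_inner]
    refine Finset.sum_congr rfl fun i _ => ?_
    rw [inner_sum]
    refine Finset.sum_congr rfl fun j _ => ?_
    rw [inner_smul_left, inner_smul_right, Matrix.gram_apply, RCLike.star_def]
    ring
  rw [this, inner_self_eq_norm_sq_to_K]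
  norm_cast
  positivity

lemma Matrix.posSemidef_of_local {X : Type*} {A : Matrix X X ℂ}
    (h : ∀ s : Finset X, ∃ B : Matrix X X ℂ, B.PosSemidef ∧ ∀ x ∈ s, ∀ y ∈ s, A x y = B x y) :
    A.PosSemidef := by
  classical
  constructor
  · ext x y
    obtain ⟨B, hB, hs⟩ := h {x, y}
    rw [Matrix.conjTranspose_apply, hs y (by simp) x (by simp), hs x (by simp) y (by simp)]
    exact hB.1.apply x y
  · intro c
    obtain ⟨B, hB, hs⟩ := h c.support
    convert hB.2 c using 1
    refine Finset.sum_congr rfl fun i hi => Finset.sum_congr rfl fun j hj => ?_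
    simp only [hs i hi j hj]

/-- A positive definite kernel on a set `X`. -/
structure PDKernel (X : Type*) where
  toMatrix : Matrix X X ℂ
  posSemidef : toMatrix.PosSemidef

namespace PDKernel

variable {X : Type*} (k : PDKernel X)

/-- The space of finitely supported functions on `X`, to be given the (possibly degenerate) inner
product in which the point masses at `x` and `y` have inner product `k x y`. -/
@[nolint unusedArguments]
def Pre (_ : PDKernel X) : Type _ := X →₀ ℂ

instance : AddCommGroup k.Pre := inferInstanceAs (AddCommGroup (X →₀ ℂ))
instance : Module ℂ k.Pre := inferInstanceAs (Module ℂ (X →₀ ℂ))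

/-- The space of finitely supported functions, without and with its inner product. -/
def toPre : (X →₀ ℂ) ≃ₗ[ℂ] k.Pre := LinearEquiv.refl ℂ _

/-- The inverse of `toPre`. -/
def ofPre : k.Pre ≃ₗ[ℂ] (X →₀ ℂ) := LinearEquiv.refl ℂ _

/-- The (possibly degenerate) inner product given by the kernel. -/
abbrev core : PreInnerProductSpace.Core ℂ k.Pre where
  inner c d := (k.ofPre c).sum fun x cx => (k.ofPre d).sum fun y dy =>
    star cx * k.toMatrix x y * dy
  conj_inner_symm c d := by
    simp only [Finsupp.sum, map_sum, map_mul]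
    rw [Finset.sum_comm]
    refine Finset.sum_congr rfl fun i _ => Finset.sum_congr rfl fun j _ => ?_
    rw [← k.posSemidef.1.apply i j]
    simp only [RCLike.star_def, RCLike.conj_conj]
    ring
  re_inner_nonneg c := (RCLike.nonneg_iff.1 (k.posSemidef.2 (k.ofPre c))).1
  add_left c d e := by
    classical
    rw [map_add, Finsupp.sum_add_index]
    · simp
    · intro x _ a b
      simp only [star_add, add_mul, Finsupp.sum, Finset.sum_add_distrib]
  smul_left c d r := by
    rw [map_smul, Finsupp.sum_smul_index (by simp)]
    simp only [Finsupp.sum, Finset.mul_sum, star_mul']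
    refine Finset.sum_congr rfl fun i _ => Finset.sum_congr rfl fun j _ => ?_
    simp only [RCLike.star_def]
    ring

instance : SeminormedAddCommGroup k.Pre :=
  InnerProductSpace.Core.toSeminormedAddCommGroup (c := k.core)
instance : InnerProductSpace ℂ k.Pre := InnerProductSpace.ofCore k.core

/-- The Hilbert space obtained by separation and completion. -/
abbrev Space : Type _ := Completion k.Pre

/-- The vector of the Hilbert space attached to a point of `X`. -/
def vec (x : X) : k.Space := ((k.toPre (Finsupp.single x 1) : k.Pre) : k.Space)

lemma inner_vec (x y : X) : ⟪k.vec x, k.vec y⟫_ℂ = k.toMatrix x y := by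
  rw [vec, vec, Completion.inner_coe]
  change (Finsupp.single x (1 : ℂ)).sum (fun x cx => (Finsupp.single y (1 : ℂ)).sum fun y dy =>
    star cx * k.toMatrix x y * dy) = _
  simp

variable {F : Type*} [NormedAddCommGroup F] [InnerProductSpace ℂ F] [CompleteSpace F]

/-- The bounded operator which sends the vector of `x` to `v x`, when the inner products of the
vectors `v x` are dominated by the kernel. -/
def extend (v : X → F) (C : ℝ) (hC : 0 ≤ C)
    (h : (((C : ℂ) ^ 2) • k.toMatrix - Matrix.gram ℂ v).PosSemidef) : k.Space →L[ℂ] F :=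
  (LinearMap.mkContinuous ((Finsupp.linearCombination ℂ v) ∘ₗ k.ofPre.toLinearMap) C (by
    intro c
    refine (sq_le_sq₀ (norm_nonneg _) (by positivity)).1 ?_
    have h1 := h.2 (k.ofPre c)
    have h2 : ((‖c‖ ^ 2 : ℝ) : ℂ) = (k.ofPre c).sum fun x cx => (k.ofPre c).sum fun y dy =>
        star cx * k.toMatrix x y * dy := by
      have := inner_self_eq_norm_sq_to_K (𝕜 := ℂ) c
      rw [← RCLike.ofReal_pow] at this
      exact this.symm
    have h3 : ((‖Finsupp.linearCombination ℂ v (k.ofPre c)‖ ^ 2 : ℝ) : ℂ) =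
        (k.ofPre c).sum fun x cx => (k.ofPre c).sum fun y dy =>
        star cx * Matrix.gram ℂ v x y * dy := by
      have := inner_self_eq_norm_sq_to_K (𝕜 := ℂ) (Finsupp.linearCombination ℂ v (k.ofPre c))
      rw [← RCLike.ofReal_pow] at this
      refine this.symm.trans ?_
      simp only [Finsupp.linearCombination_apply, Finsupp.sum, sum_inner]
      refine Finset.sum_congr rfl fun i _ => ?_
      rw [inner_sum]
      refine Finset.sum_congr rfl fun j _ => ?_
      rw [inner_smul_left, inner_smul_right, Matrix.gram_apply, RCLike.star_def]
      ring
    have h4 : ((k.ofPre c).sum fun x cx => (k.ofPre c).sum fun y dy =>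
        star cx * (((C : ℂ) ^ 2) • k.toMatrix - Matrix.gram ℂ v) x y * dy) =
        (((C * ‖c‖) ^ 2 - ‖Finsupp.linearCombination ℂ v (k.ofPre c)‖ ^ 2 : ℝ) : ℂ) := by
      rw [mul_pow, Complex.ofReal_sub, Complex.ofReal_mul, h2, h3]
      simp only [Finsupp.sum, Finset.mul_sum, ← Finset.sum_sub_distrib, Matrix.sub_apply,
        Matrix.smul_apply, smul_eq_mul, Complex.ofReal_pow]
      refine Finset.sum_congr rfl fun i _ => Finset.sum_congr rfl fun j _ => ?_
      ring
    rw [h4, Complex.zero_le_real] at h1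
    change ‖Finsupp.linearCombination ℂ v (k.ofPre c)‖ ^ 2 ≤ _
    linarith)).fromCompletion

lemma extend_vec (v : X → F) (C : ℝ) (hC : 0 ≤ C)
    (h : (((C : ℂ) ^ 2) • k.toMatrix - Matrix.gram ℂ v).PosSemidef) (x : X) :
    k.extend v C hC h (k.vec x) = v x := by
  rw [vec, extend, ContinuousLinearMap.fromCompletion_apply_coe]
  change Finsupp.linearCombination ℂ v (Finsupp.single x 1) = v x
  simp

end PDKernel

lemma Matrix.posSemidef_sq_smul_gram_sub_gram {X F : Type*} [NormedAddCommGroup F]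
    [InnerProductSpace ℂ F] (v : X → F) (A : F →L[ℂ] F) :
    ((((‖A‖ : ℝ) : ℂ) ^ 2) • Matrix.gram ℂ v - Matrix.gram ℂ fun x => A (v x)).PosSemidef := by
  have quad : ∀ (u : X → F) (c : X →₀ ℂ),
      (c.sum fun i xi => c.sum fun j xj => star xi * Matrix.gram ℂ u i j * xj) =
      ((‖c.sum fun i xi => xi • u i‖ ^ 2 : ℝ) : ℂ) := by
    intro u c
    have h := inner_self_eq_norm_sq_to_K (𝕜 := ℂ) (c.sum fun i xi => xi • u i)
    rw [← RCLike.ofReal_pow] at h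
    refine Eq.trans ?_ h
    simp only [Finsupp.sum, sum_inner]
    refine Finset.sum_congr rfl fun i _ => ?_
    rw [inner_sum]
    refine Finset.sum_congr rfl fun j _ => ?_
    rw [inner_smul_left, inner_smul_right, Matrix.gram_apply, RCLike.star_def]
    ring
  refine ⟨?_, fun c => ?_⟩
  · refine Matrix.IsHermitian.sub ?_ (Matrix.isHermitian_gram ℂ _)
    ext i j
    rw [Matrix.conjTranspose_apply, Matrix.smul_apply, Matrix.smul_apply,
      ← (Matrix.isHermitian_gram ℂ v).apply i j]
    simp
  · have h4 : (c.sum fun x cx => c.sum fun y dy =>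
        star cx * ((((‖A‖ : ℝ) : ℂ) ^ 2) • Matrix.gram ℂ v - Matrix.gram ℂ fun x => A (v x)) x y
          * dy) =
        (((‖A‖ * ‖c.sum fun i xi => xi • v i‖) ^ 2 -
          ‖c.sum fun i xi => xi • A (v i)‖ ^ 2 : ℝ) : ℂ) := by
      rw [mul_pow, Complex.ofReal_sub, Complex.ofReal_mul, ← quad v, ← quad fun x => A (v x)]
      simp only [Finsupp.sum, Finset.mul_sum, ← Finset.sum_sub_distrib, Matrix.sub_apply,
        Matrix.smul_apply, smul_eq_mul, Complex.ofReal_pow]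
      refine Finset.sum_congr rfl fun i _ => Finset.sum_congr rfl fun j _ => ?_
      ring
    rw [h4, Complex.zero_le_real, sub_nonneg]
    have : (c.sum fun i xi => xi • A (v i)) = A (c.sum fun i xi => xi • v i) := by
      simp [Finsupp.sum, map_sum]
    rw [this]
    gcongr
    exact A.le_opNorm _

lemma Matrix.posSemidef_prod {X ι : Type*} (F : Finset ι) (a : ι → Matrix X X ℂ)
    (ha : ∀ i ∈ F, (a i).PosSemidef) :
    (Matrix.of fun x y => ∏ i ∈ F, a i x y).PosSemidef := by
  classical
  induction F using Finset.induction_on with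
  | empty =>
    have h1 : (Matrix.of fun x y => ∏ i ∈ (∅ : Finset ι), a i x y) =
        Matrix.gram ℂ (fun _ : X => (1 : ℂ)) := by
      ext x y
      simp [Matrix.gram_apply]
    rw [h1]
    exact Matrix.posSemidef_gram_all _
  | insert i F hi ih =>
    have h1 := (ha i (by simp)).hadamard (ih fun j hj => ha j (by simp [hj]))
    have h2 : (Matrix.of fun x y => ∏ i ∈ insert i F, a i x y) =
        (a i).hadamard (Matrix.of fun x y => ∏ i ∈ F, a i x y) := by
      ext x y
      simp [Finset.prod_insert hi]
    rw [h2]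
    exact h1

lemma Matrix.posSemidef_prod_sub_prod {X ι : Type*} (F : Finset ι) (a b : ι → Matrix X X ℂ)
    (ha : ∀ i ∈ F, (a i).PosSemidef) (hb : ∀ i ∈ F, (b i).PosSemidef)
    (hab : ∀ i ∈ F, (b i - a i).PosSemidef) :
    ((Matrix.of fun x y => ∏ i ∈ F, b i x y) -
      Matrix.of fun x y => ∏ i ∈ F, a i x y).PosSemidef := by
  classical
  induction F using Finset.induction_on with
  | empty => simpa using Matrix.PosSemidef.zero
  | insert i F hi ih =>
    have h1 := (hab i (by simp)).hadamard
      (Matrix.posSemidef_prod F b fun j hj => hb j (by simp [hj]))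
    have h2 := (ha i (by simp)).hadamard (ih (fun j hj => ha j (by simp [hj]))
      (fun j hj => hb j (by simp [hj])) fun j hj => hab j (by simp [hj]))
    have h3 : ((Matrix.of fun x y => ∏ i ∈ insert i F, b i x y) -
        Matrix.of fun x y => ∏ i ∈ insert i F, a i x y) =
        (b i - a i).hadamard (Matrix.of fun x y => ∏ i ∈ F, b i x y) +
        (a i).hadamard ((Matrix.of fun x y => ∏ i ∈ F, b i x y) -
          Matrix.of fun x y => ∏ i ∈ F, a i x y) := by
      ext x y
      simp [Finset.prod_insert hi]
      ring
    rw [h3]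
    exact h1.add h2

/-! ## Infinite tensor products -/

section Tensor

variable {ι : Type*} {E : ι → Type*} [∀ i, NormedAddCommGroup (E i)]
  [∀ i, InnerProductSpace ℂ (E i)] (Ω : ∀ i, E i) (hΩ : ∀ i, ‖Ω i‖ = 1)

/-- The families `(ξ i)` with `ξ i = Ω i` for all but finitely many `i`, which index the elementary
tensors `⊗ ξ i`. -/
abbrev TensorIndex : Type _ := {ξ : ∀ i, E i // {i | ξ i ≠ Ω i}.Finite}

variable {Ω}

lemma finprod_inner_eq (hΩ : ∀ i, ‖Ω i‖ = 1) {F : Finset ι} {ξ η : TensorIndex Ω}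
    (hξ : ∀ i, ξ.1 i ≠ Ω i → i ∈ F) (hη : ∀ i, η.1 i ≠ Ω i → i ∈ F) :
    ∏ᶠ i, ⟪ξ.1 i, η.1 i⟫_ℂ = ∏ i ∈ F, ⟪ξ.1 i, η.1 i⟫_ℂ := by
  refine finprod_eq_prod_of_mulSupport_subset _ fun i hi => ?_
  by_contra hF
  have h1 : ξ.1 i = Ω i := by
    by_contra h
    exact hF (hξ i h)
  have h2 : η.1 i = Ω i := by
    by_contra h
    exact hF (hη i h)
  apply hi
  simp [h1, h2, inner_self_eq_norm_sq_to_K, hΩ]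

/-- The kernel `(⊗ ξ i, ⊗ η i) ↦ ∏ i, ⟪ξ i, η i⟫`; all but finitely many factors are `1`. -/
def tensorKernel : PDKernel (TensorIndex Ω) where
  toMatrix := Matrix.of fun ξ η => ∏ᶠ i, ⟪ξ.1 i, η.1 i⟫_ℂ
  posSemidef := by
    classical
    refine Matrix.posSemidef_of_local fun s => ?_
    let F : Finset ι := s.biUnion fun ξ => ξ.2.toFinset
    have hF : ∀ ξ ∈ s, ∀ i, ξ.1 i ≠ Ω i → i ∈ F := fun ξ hξ i hi =>
      Finset.mem_biUnion.2 ⟨ξ, hξ, by simpa using hi⟩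
    exact ⟨_, Matrix.posSemidef_prod F (fun i => Matrix.gram ℂ fun ξ : TensorIndex Ω => ξ.1 i)
      fun i _ => Matrix.posSemidef_gram_all _,
      fun ξ hξ η hη => finprod_inner_eq hΩ (hF ξ hξ) (hF η hη)⟩

/-- The tensor product `⊗ (E i, Ω i)` of Hilbert spaces with distinguished unit vectors: the Hilbert
space spanned by the elementary tensors `⊗ ξ i` with `ξ i = Ω i` for all but finitely many `i`,
where `⟪⊗ ξ i, ⊗ η i⟫ = ∏ i, ⟪ξ i, η i⟫`. -/
abbrev TensorSpace : Type _ := (tensorKernel hΩ).Space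

/-- The elementary tensor `⊗ ξ i`. -/
def tensorVec (ξ : TensorIndex Ω) : TensorSpace hΩ := (tensorKernel hΩ).vec ξ

lemma inner_tensorVec (ξ η : TensorIndex Ω) :
    ⟪tensorVec hΩ ξ, tensorVec hΩ η⟫_ℂ = ∏ᶠ i, ⟪ξ.1 i, η.1 i⟫_ℂ :=
  (tensorKernel hΩ).inner_vec ξ η

variable (Ω) in
/-- The distinguished family `(Ω i)`. -/
def tensorIndexUnit : TensorIndex Ω := ⟨Ω, by simp⟩

/-- The distinguished unit vector `⊗ Ω i`. -/
def tensorUnit : TensorSpace hΩ := tensorVec hΩ (tensorIndexUnit Ω)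

lemma norm_tensorUnit : ‖tensorUnit hΩ‖ = 1 := by
  have h := inner_tensorVec hΩ (tensorIndexUnit Ω) (tensorIndexUnit Ω)
  rw [inner_self_eq_norm_sq_to_K] at h
  have h2 : ∀ i, ⟪(tensorIndexUnit Ω).1 i, (tensorIndexUnit Ω).1 i⟫_ℂ = 1 := fun i => by
    change ⟪Ω i, Ω i⟫_ℂ = 1
    simp [inner_self_eq_norm_sq_to_K, hΩ]
  simp only [h2, finprod_one] at h
  have h3 : ‖tensorVec hΩ (tensorIndexUnit Ω)‖ ^ 2 = 1 := by
    apply Complex.ofReal_injective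
    simpa using h
  exact (pow_eq_one_iff_of_nonneg (norm_nonneg _) two_ne_zero).1 h3

/-- A family of operators, all but finitely many of them `1`, acts on the families of vectors. -/
def tensorIndexMap (A : ∀ i, E i →L[ℂ] E i) (hA : {i | A i ≠ 1}.Finite) (ξ : TensorIndex Ω) :
    TensorIndex Ω :=
  ⟨fun i => A i (ξ.1 i), (hA.union ξ.2).subset fun i hi => by
    by_contra h
    simp only [Set.mem_union, Set.mem_ofPred_eq, not_or, not_not] at h
    apply hi
    change A i (ξ.1 i) = Ω i
    rw [h.1, h.2]
    rfl⟩

/-- The operator `⊗ A i` on `⊗ (E i, Ω i)`, which sends `⊗ ξ i` to `⊗ A i (ξ i)`, where `A i = 1`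
for all but finitely many `i`. -/
def tensorOp (A : ∀ i, E i →L[ℂ] E i) (hA : {i | A i ≠ 1}.Finite) :
    TensorSpace hΩ →L[ℂ] TensorSpace hΩ :=
  (tensorKernel hΩ).extend (fun ξ => tensorVec hΩ (tensorIndexMap A hA ξ)) (∏ᶠ i, ‖A i‖)
    (finprod_nonneg fun i => norm_nonneg _) (by
    classical
    refine Matrix.posSemidef_of_local fun s => ?_
    let F : Finset ι := hA.toFinset ∪ s.biUnion fun ξ => ξ.2.toFinset
    have hF : ∀ ξ ∈ s, ∀ i, ξ.1 i ≠ Ω i → i ∈ F := fun ξ hξ i hi =>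
      Finset.mem_union_right _ (Finset.mem_biUnion.2 ⟨ξ, hξ, by simpa using hi⟩)
    have hFA : ∀ i, A i ≠ 1 → i ∈ F := fun i hi =>
      Finset.mem_union_left _ (by simpa using hi)
    have hF' : ∀ ξ ∈ s, ∀ i, (tensorIndexMap A hA ξ).1 i ≠ Ω i → i ∈ F := fun ξ hξ i hi => by
      by_contra h
      apply hi
      have h1 : A i = 1 := by
        by_contra h'
        exact h (hFA i h')
      have h2 : ξ.1 i = Ω i := by
        by_contra h'
        exact h (hF ξ hξ i h')
      change A i (ξ.1 i) = Ω i
      rw [h1, h2]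
      rfl
    have hC : ∏ᶠ i, ‖A i‖ = ∏ i ∈ F, ‖A i‖ := by
      refine finprod_eq_prod_of_mulSupport_subset _ fun i hi => ?_
      by_contra h
      have h1 : A i = 1 := by
        by_contra h'
        exact h (hFA i h')
      have : Nontrivial (E i) := ⟨⟨Ω i, 0, fun h0 => by simpa [h0] using hΩ i⟩⟩
      exact hi (by simp [h1])
    refine ⟨_, Matrix.posSemidef_prod_sub_prod F
      (fun i => Matrix.gram ℂ fun ξ : TensorIndex Ω => A i (ξ.1 i))
      (fun i => (((‖A i‖ : ℝ) : ℂ) ^ 2) • Matrix.gram ℂ fun ξ : TensorIndex Ω => ξ.1 i)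
      (fun i _ => Matrix.posSemidef_gram_all _)
      (fun i _ => (Matrix.posSemidef_gram_all _).smul (by positivity))
      (fun i _ => Matrix.posSemidef_sq_smul_gram_sub_gram _ _), fun ξ hξ η hη => ?_⟩
    rw [Matrix.sub_apply, Matrix.sub_apply, Matrix.smul_apply, Matrix.gram_apply,
      inner_tensorVec, finprod_inner_eq hΩ (hF' ξ hξ) (hF' η hη), hC]
    change _ * (∏ᶠ i, ⟪ξ.1 i, η.1 i⟫_ℂ) - _ = _
    rw [finprod_inner_eq hΩ (hF ξ hξ) (hF η hη)]
    simp only [Matrix.of_apply, Matrix.smul_apply, Matrix.gram_apply, smul_eq_mul,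
      Finset.prod_mul_distrib, Finset.prod_pow, Complex.ofReal_prod]
    rfl)

lemma tensorOp_tensorVec (A : ∀ i, E i →L[ℂ] E i) (hA : {i | A i ≠ 1}.Finite)
    (ξ : TensorIndex Ω) :
    tensorOp hΩ A hA (tensorVec hΩ ξ) = tensorVec hΩ (tensorIndexMap A hA ξ) :=
  (tensorKernel hΩ).extend_vec _ _ _ _ ξ

end Tensor

/-! ## Free products of Hilbert spaces -/

section Free

variable {ι : Type*} {E : ι → Type*} [∀ i, NormedAddCommGroup (E i)]
  [∀ i, InnerProductSpace ℂ (E i)] (Ω : ∀ i, E i) (hΩ : ∀ i, ‖Ω i‖ = 1)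

/-- A letter: an index `i` together with a vector of `E i` orthogonal to `Ω i`. -/
abbrev Letter : Type _ := Σ i, (ℂ ∙ Ω i)ᗮ

/-- The reduced words `ξ₁ ⊗ ⋯ ⊗ ξₙ` (`n ≥ 0`): lists of letters in which neighbours have distinct
indices. -/
abbrev RedWord : Type _ := {l : List (Letter Ω) // (l.map Sigma.fst).IsChain (· ≠ ·)}

variable {Ω}

open Classical in
/-- The inner product of two letters: letters with distinct indices are orthogonal. -/
def letterInner (p q : Letter Ω) : ℂ :=
  ⟪(p.2 : E p.1), (Pi.single q.1 (q.2 : E q.1) : ∀ i, E i) p.1⟫_ℂ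

lemma letterInner_same (i : ι) (ξ η : (ℂ ∙ Ω i)ᗮ) :
    letterInner (⟨i, ξ⟩ : Letter Ω) ⟨i, η⟩ = ⟪(ξ : E i), (η : E i)⟫_ℂ := by
  simp [letterInner]

lemma letterInner_of_ne {p q : Letter Ω} (h : p.1 ≠ q.1) : letterInner p q = 0 := by
  classical
  simp [letterInner, Pi.single_eq_of_ne h]

/-- The inner product of two words: words of different lengths are orthogonal, and
`⟪ξ₁ ⊗ ⋯ ⊗ ξₙ, η₁ ⊗ ⋯ ⊗ ηₙ⟫ = ∏ k, ⟪ξₖ, ηₖ⟫`. -/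
def wordInner : List (Letter Ω) → List (Letter Ω) → ℂ
  | [], [] => 1
  | p :: l, q :: m => letterInner p q * wordInner l m
  | _, _ => 0

lemma wordInner_of_length_ne : ∀ {l m : List (Letter Ω)}, l.length ≠ m.length → wordInner l m = 0
  | [], [], h => absurd rfl h
  | [], _ :: _, _ => rfl
  | _ :: _, [], _ => rfl
  | p :: l, q :: m, h => by
    rw [wordInner, wordInner_of_length_ne (fun h' => h (by simp [h'])), mul_zero]

lemma posSemidef_wordInner_length (n : ℕ) :
    (Matrix.of fun l m : List (Letter Ω) =>
      if l.length = n ∧ m.length = n then wordInner l m else 0).PosSemidef := by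
  classical
  induction n with
  | zero =>
    have h : (Matrix.of fun l m : List (Letter Ω) =>
        if l.length = 0 ∧ m.length = 0 then wordInner l m else 0) =
        Matrix.gram ℂ (fun l : List (Letter Ω) => if l.length = 0 then (1 : ℂ) else 0) := by
      ext l m
      rcases l with _ | ⟨p, l⟩ <;> rcases m with _ | ⟨q, m⟩ <;>
        simp [wordInner, Matrix.gram_apply]
    rw [h]
    exact Matrix.posSemidef_gram_all _
  | succ n ih =>
    let v : List (Letter Ω) → lp E 2 := fun l =>
      match l with
      | [] => 0
      | p :: _ => lp.single 2 p.1 (p.2 : E p.1)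
    have h : (Matrix.of fun l m : List (Letter Ω) =>
        if l.length = n + 1 ∧ m.length = n + 1 then wordInner l m else 0) =
        (Matrix.gram ℂ v).hadamard ((Matrix.of fun l m : List (Letter Ω) =>
          if l.length = n ∧ m.length = n then wordInner l m else 0).submatrix
            List.tail List.tail) := by
      ext l m
      rcases l with _ | ⟨p, l⟩ <;> rcases m with _ | ⟨q, m⟩
      · simp [v, Matrix.gram_apply]
      · simp [v, Matrix.gram_apply]
      · simp [v, Matrix.gram_apply]
      · have : ⟪v (p :: l), v (q :: m)⟫_ℂ = letterInner p q := by
          change ⟪lp.single 2 p.1 (p.2 : E p.1), lp.single 2 q.1 (q.2 : E q.1)⟫_ℂ = _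
          rw [lp.inner_single_left, lp.coeFn_single]
          rfl
        simp [Matrix.gram_apply, this, wordInner]
    rw [h]
    exact (Matrix.posSemidef_gram_all v).hadamard (ih.submatrix _)

lemma posSemidef_wordInner :
    (Matrix.of fun l m : List (Letter Ω) => wordInner l m).PosSemidef := by
  refine Matrix.posSemidef_of_local fun s => ?_
  refine ⟨∑ n ∈ s.image List.length, Matrix.of fun l m : List (Letter Ω) =>
    if l.length = n ∧ m.length = n then wordInner l m else 0,
    Matrix.posSemidef_sum _ fun n _ => posSemidef_wordInner_length n, fun l hl m hm => ?_⟩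
  rw [Matrix.sum_apply]
  simp only [Matrix.of_apply]
  rw [Finset.sum_eq_single l.length]
  · by_cases h : m.length = l.length
    · simp [h]
    · simp [h, wordInner_of_length_ne (Ne.symm h)]
  · intro n _ hn
    rw [if_neg fun h => hn h.1.symm]
  · intro h
    exact absurd (Finset.mem_image_of_mem _ hl) h

variable (Ω) in
/-- The kernel given by the inner products of the reduced words. -/
def freeKernel : PDKernel (RedWord Ω) where
  toMatrix := Matrix.of fun l m => wordInner l.1 m.1
  posSemidef := posSemidef_wordInner.submatrix Subtype.val

variable (Ω) in
/-- The free product `∗ (E i, Ω i)` of Hilbert spaces with distinguished unit vectors, that is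
`ℂ Ω ⊕ ⨁ E°(i₁) ⊗ ⋯ ⊗ E°(iₙ)` (sum over `n ≥ 1` and `i₁ ≠ i₂ ≠ ⋯ ≠ iₙ`) with `E°(i) = (Ω i)ᗮ`,
as the Hilbert space spanned by the reduced words. -/
abbrev FreeSpace : Type _ := (freeKernel Ω).Space

/-- The vector `ξ₁ ⊗ ⋯ ⊗ ξₙ` attached to a reduced word. -/
def wordVec (w : RedWord Ω) : FreeSpace Ω := (freeKernel Ω).vec w

lemma inner_wordVec (w w' : RedWord Ω) :
    ⟪wordVec w, wordVec w'⟫_ℂ = wordInner w.1 w'.1 :=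
  (freeKernel Ω).inner_vec w w'

variable (Ω) in
/-- The vacuum vector, attached to the empty word. -/
def vacuum : FreeSpace Ω := wordVec ⟨[], by simp⟩

lemma norm_vacuum : ‖vacuum Ω‖ = 1 := by
  have h : ⟪vacuum Ω, vacuum Ω⟫_ℂ = 1 := inner_wordVec _ _
  rw [inner_self_eq_norm_sq_to_K] at h
  have h3 : ‖vacuum Ω‖ ^ 2 = 1 := by
    apply Complex.ofReal_injective
    simpa using h
  exact (pow_eq_one_iff_of_nonneg (norm_nonneg _) two_ne_zero).1 h3

variable (Ω) in
/-- The reduced words which do not start with a letter of index `j`. -/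
abbrev RedWordNot (j : ι) : Type _ := {w : RedWord Ω // ∀ p ∈ w.1.head?, p.1 ≠ j}

/-- Put a letter of index `j` in front of a word which does not start with index `j`. -/
def consWord (j : ι) (ξ : (ℂ ∙ Ω j)ᗮ) (t : RedWordNot Ω j) : RedWord Ω :=
  ⟨⟨j, ξ⟩ :: t.1.1, by
    obtain ⟨⟨l, hl⟩, ht⟩ := t
    rcases l with _ | ⟨p, l⟩
    · simp
    · have hp : j ≠ p.1 := (ht p (by simp)).symm
      exact List.isChain_cons_cons.2 ⟨hp, hl⟩⟩

lemma tail_not {j : ι} {ξ : (ℂ ∙ Ω j)ᗮ} {l : List (Letter Ω)}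
    (h : (((⟨j, ξ⟩ : Letter Ω) :: l).map Sigma.fst).IsChain (· ≠ ·)) :
    ∀ p ∈ l.head?, p.1 ≠ j := by
  intro p hp
  rcases l with _ | ⟨q, l⟩
  · simp at hp
  · have : q = p := by simpa using hp
    subst this
    exact (List.isChain_cons_cons.1 h).1.symm

open Classical in
/-- The identification of `∗ E i` with `E j ⊗ (the words not starting with index j)`: the word
`ξ ⊗ t` with `ξ` of index `j` corresponds to `(ξ, t)`, and a word `w` that does not start with
index `j` corresponds to `(Ω j, w)`. -/
def peel (j : ι) : RedWord Ω → E j × RedWordNot Ω j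
  | ⟨[], h⟩ => (Ω j, ⟨⟨[], h⟩, by simp⟩)
  | ⟨⟨i, ξ⟩ :: l, h⟩ =>
    if e : i = j then
      ((Eq.rec (motive := fun k _ => (ℂ ∙ Ω k)ᗮ) ξ e : (ℂ ∙ Ω j)ᗮ),
        ⟨⟨l, by subst e; exact List.IsChain.tail h⟩, by subst e; exact tail_not h⟩)
    else (Ω j, ⟨⟨⟨i, ξ⟩ :: l, h⟩, by
      intro p hp
      have : (⟨i, ξ⟩ : Letter Ω) = p := by simpa using hp
      subst this
      exact e⟩)

lemma peel_consWord (j : ι) (ξ : (ℂ ∙ Ω j)ᗮ) (t : RedWordNot Ω j) :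
    peel j (consWord j ξ t) = ((ξ : E j), t) := by
  simp [consWord, peel]

lemma peel_not (j : ι) (t : RedWordNot Ω j) : peel j t.1 = (Ω j, t) := by
  obtain ⟨⟨l, hl⟩, ht⟩ := t
  rcases l with _ | ⟨⟨i, ξ⟩, l⟩
  · rfl
  · have : i ≠ j := ht ⟨i, ξ⟩ (by simp)
    simp [peel, this]

lemma exists_word (j : ι) (w : RedWord Ω) :
    (∃ ξ t, w = consWord j ξ t) ∨ ∃ t : RedWordNot Ω j, w = t.1 := by
  obtain ⟨l, hl⟩ := w
  rcases l with _ | ⟨⟨i, ξ⟩, l⟩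
  · exact Or.inr ⟨⟨⟨[], hl⟩, by simp⟩, rfl⟩
  · by_cases e : i = j
    · subst e
      exact Or.inl ⟨ξ, ⟨⟨l, List.IsChain.tail hl⟩, tail_not hl⟩, rfl⟩
    · refine Or.inr ⟨⟨⟨⟨i, ξ⟩ :: l, hl⟩, ?_⟩, rfl⟩
      intro p hp
      have : (⟨i, ξ⟩ : Letter Ω) = p := by simpa using hp
      subst this
      exact e

/-- The component of a vector of `E j` orthogonal to `Ω j`. -/
def orthPart (j : ι) (ξ : E j) : (ℂ ∙ Ω j)ᗮ :=
  (ℂ ∙ Ω j)ᗮ.orthogonalProjectionOnto ξ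

lemma coe_orthPart (hΩ : ∀ i, ‖Ω i‖ = 1) (j : ι) (ζ : E j) :
    (orthPart (Ω := Ω) j ζ : E j) = ζ - ⟪Ω j, ζ⟫_ℂ • Ω j := by
  rw [orthPart, ← Submodule.starProjection_apply, Submodule.starProjection_orthogonal_val]
  congr 1
  exact Submodule.starProjection_unit_singleton ℂ (hΩ j) ζ

/-- The vector `ξ ⊗ t` of the free product, for an arbitrary `ξ` in `E j` and a word `t` which does
not start with index `j`, where `Ω j ⊗ t` is identified with `t`: it is `ξ° ⊗ t + ⟪Ω j, ξ⟫ t`. -/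
def tensorWord (j : ι) (ξ : E j) (t : RedWordNot Ω j) : FreeSpace Ω :=
  wordVec (consWord j (orthPart j ξ) t) + ⟪Ω j, ξ⟫_ℂ • wordVec t.1

lemma wordInner_cons_not (j : ι) (ξ : (ℂ ∙ Ω j)ᗮ) (t t' : RedWordNot Ω j) :
    wordInner (consWord j ξ t).1 t'.1.1 = 0 := by
  obtain ⟨⟨l, hl⟩, ht⟩ := t'
  rcases l with _ | ⟨p, l⟩
  · rfl
  · have : j ≠ p.1 := (ht p (by simp)).symm
    change letterInner _ _ * _ = 0
    rw [letterInner_of_ne this, zero_mul]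

lemma inner_tensorWord (hΩ : ∀ i, ‖Ω i‖ = 1) (j : ι) (ξ η : E j) (t t' : RedWordNot Ω j) :
    ⟪tensorWord j ξ t, tensorWord j η t'⟫_ℂ = ⟪ξ, η⟫_ℂ * wordInner t.1.1 t'.1.1 := by
  have h1 : ⟪wordVec (consWord j (orthPart j ξ) t), wordVec (consWord j (orthPart j η) t')⟫_ℂ =
      ⟪(orthPart (Ω := Ω) j ξ : E j), (orthPart (Ω := Ω) j η : E j)⟫_ℂ * wordInner t.1.1 t'.1.1 := by
    rw [inner_wordVec]
    change letterInner _ _ * _ = _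
    rw [letterInner_same]
  have h2 : ⟪wordVec (consWord j (orthPart j ξ) t), wordVec t'.1⟫_ℂ = 0 := by
    rw [inner_wordVec, wordInner_cons_not]
  have h3 : ⟪wordVec t.1, wordVec (consWord j (orthPart j η) t')⟫_ℂ = 0 := by
    rw [← inner_conj_symm, inner_wordVec, wordInner_cons_not, map_zero]
  have h4 := coe_orthPart hΩ j
  have h5 : ⟪(orthPart (Ω := Ω) j ξ : E j), (orthPart (Ω := Ω) j η : E j)⟫_ℂ =
      ⟪ξ, η⟫_ℂ - (starRingEnd ℂ) ⟪Ω j, ξ⟫_ℂ * ⟪Ω j, η⟫_ℂ := by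
    have h6 : ⟪Ω j, Ω j⟫_ℂ = 1 := by simp [inner_self_eq_norm_sq_to_K, hΩ]
    rw [h4, h4]
    simp only [inner_sub_left, inner_sub_right, inner_smul_left, inner_smul_right, h6]
    rw [← inner_conj_symm ξ (Ω j)]
    ring
  simp only [tensorWord, inner_add_left, inner_add_right, inner_smul_left, inner_smul_right,
    h1, h2, h3, h5, inner_wordVec]
  ring

lemma tensorWord_peel (hΩ : ∀ i, ‖Ω i‖ = 1) (j : ι) (w : RedWord Ω) :
    tensorWord j (peel j w).1 (peel j w).2 = wordVec w := by
  rcases exists_word j w with ⟨ξ, t, rfl⟩ | ⟨t, rfl⟩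
  · have h1 : ⟪Ω j, (ξ : E j)⟫_ℂ = 0 := Submodule.mem_orthogonal_singleton_iff_inner_right.1 ξ.2
    have h2 : orthPart j (ξ : E j) = ξ := by
      apply Subtype.ext
      rw [coe_orthPart hΩ, h1, zero_smul, sub_zero]
    rw [peel_consWord, tensorWord, h1, h2, zero_smul, add_zero]
  · have h1 : ⟪Ω j, Ω j⟫_ℂ = 1 := by simp [inner_self_eq_norm_sq_to_K, hΩ]
    have h2 : orthPart (Ω := Ω) j (Ω j) = 0 := by
      apply Subtype.ext
      rw [coe_orthPart hΩ, h1, one_smul, sub_self]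
      rfl
    have h3 : wordVec (consWord j (0 : (ℂ ∙ Ω j)ᗮ) t) = 0 := by
      rw [← inner_self_eq_zero (𝕜 := ℂ), inner_wordVec]
      change letterInner _ _ * _ = 0
      rw [letterInner_same]
      simp
    rw [peel_not, tensorWord, h1, h2, h3, one_smul, zero_add]

/-- The operator `λ_j(A)` on the free product given by an operator `A` on `E j`: it is `A ⊗ 1` in
the identification of `∗ E i` with `E j ⊗ (the words not starting with index j)`. -/
def freeOp (j : ι) (A : E j →L[ℂ] E j) : FreeSpace Ω →L[ℂ] FreeSpace Ω :=
  (freeKernel Ω).extend (fun w => tensorWord j (A (peel j w).1) (peel j w).2) ‖A‖ (norm_nonneg _) (by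
    have h1 : ((((‖A‖ : ℝ) : ℂ) ^ 2) • (freeKernel Ω).toMatrix -
        Matrix.gram ℂ fun w => tensorWord j (A (peel j w).1) (peel j w).2) =
        ((((‖A‖ : ℝ) : ℂ) ^ 2) • (Matrix.gram ℂ fun w : RedWord Ω => (peel j w).1) -
          Matrix.gram ℂ fun w : RedWord Ω => A (peel j w).1).hadamard
        ((freeKernel Ω).toMatrix.submatrix (fun w => (peel j w).2.1) fun w => (peel j w).2.1) := by
      ext w w'
      have h2 : (freeKernel Ω).toMatrix w w' =
          ⟪(peel j w).1, (peel j w').1⟫_ℂ * wordInner (peel j w).2.1.1 (peel j w').2.1.1 := by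
        rw [← inner_tensorWord hΩ, tensorWord_peel hΩ, tensorWord_peel hΩ, inner_wordVec]
        rfl
      simp only [Matrix.sub_apply, Matrix.smul_apply, Matrix.gram_apply, Matrix.hadamard_apply,
        Matrix.submatrix_apply, smul_eq_mul, h2, inner_tensorWord hΩ]
      change _ = _ * wordInner (peel j w).2.1.1 (peel j w').2.1.1
      ring
    rw [h1]
    exact (Matrix.posSemidef_sq_smul_gram_sub_gram _ A).hadamard
      ((freeKernel Ω).posSemidef.submatrix _))

lemma freeOp_wordVec (j : ι) (A : E j →L[ℂ] E j) (w : RedWord Ω) :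
    freeOp hΩ j A (wordVec w) = tensorWord j (A (peel j w).1) (peel j w).2 :=
  (freeKernel Ω).extend_vec _ _ _ _ w

end Free

/-! ## Tensor products and free products of von Neumann probability spaces -/

namespace VonNeumannAlgebra

variable {ι : Type*} {H : ι → Type*} [∀ i, NormedAddCommGroup (H i)]
  [∀ i, InnerProductSpace ℂ (H i)] [∀ i, CompleteSpace (H i)]

/-- The families `(x i)` with `x i` in `M i`, all but finitely many of them equal to `1`. -/
abbrev FinFamily (M : ∀ i, VonNeumannAlgebra (H i)) : Type _ :=
  {x : ∀ i, M i // {i | x i ≠ 1}.Finite}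

variable {M : ∀ i, VonNeumannAlgebra (H i)}

/-- The family `(θ i (x i))`. -/
def FinFamily.map (θ : ∀ i, M i →⋆ₐ[ℂ] M i) (x : FinFamily M) : FinFamily M :=
  ⟨fun i => θ i (x.1 i), x.2.subset fun i hi h => hi (by simp [h])⟩

variable (φ : ∀ i, NormalState (M i))

/-- The Hilbert space `⊗ L²(M i, φ i)`, with respect to the cyclic vectors. -/
abbrev TensorL2 : Type _ := TensorSpace fun i => (φ i).norm_cyclic

/-- The operator `⊗ x i` on `⊗ L²(M i, φ i)`, where `x i` acts on `L²(M i, φ i)` by the GNS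
representation. -/
def tensorElem (x : FinFamily M) : TensorL2 φ →L[ℂ] TensorL2 φ :=
  tensorOp (fun i => (φ i).norm_cyclic) (fun i => (φ i).rep (x.1 i))
    (x.2.subset fun i hi h => hi (by simp [h]))

/-- The tensor product `⊗ (M i, φ i)`: the von Neumann algebra on `⊗ L²(M i, φ i)` generated by the
elementary tensors `⊗ x i`. -/
def tensorProduct : VonNeumannAlgebra (TensorL2 φ) := generatedBy (Set.range (tensorElem φ))

/-- The elementary tensor `⊗ x i` as an element of the tensor product. -/
def tensorMk (x : FinFamily M) : tensorProduct φ :=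
  ⟨tensorElem φ x, subset_generatedBy _ ⟨x, rfl⟩⟩

/-- The von Neumann subalgebra of the tensor product generated by the elementary tensors
`⊗ θ i (x i)`. -/
def tensorRange (θ : ∀ i, M i →⋆ₐ[ℂ] M i) : VonNeumannAlgebra (TensorL2 φ) :=
  generatedBy (Set.range fun x : FinFamily M => tensorElem φ (x.map θ))

/-- The product state `⊗ φ i` on a von Neumann algebra on `⊗ L²(M i, φ i)`, that is, the vector
state of the tensor product of the cyclic vectors. -/
def tensorState (N : VonNeumannAlgebra (TensorL2 φ)) : NormalState N :=
  N.vectorState (tensorUnit fun i => (φ i).norm_cyclic) (norm_tensorUnit _)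

/-- The free product Hilbert space `∗ L²(M i, φ i)`, with respect to the cyclic vectors. -/
abbrev FreeL2 : Type _ := FreeSpace fun i => (φ i).cyclic

/-- The left representation `λ` of `M j` on `∗ L²(M i, φ i)`. -/
def freeElem (j : ι) (x : M j) : FreeL2 φ →L[ℂ] FreeL2 φ :=
  freeOp (fun i => (φ i).norm_cyclic) j ((φ j).rep x)

/-- The free product `∗ (M i, φ i)`: the von Neumann algebra on `∗ L²(M i, φ i)` generated by the
operators `λ x`, for `x` in one of the `M j`. -/
def freeProduct : VonNeumannAlgebra (FreeL2 φ) :=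
  generatedBy (Set.range fun p : Σ j, M j => freeElem φ p.1 p.2)

/-- The operator `λ x` as an element of the free product. -/
def freeMk (j : ι) (x : M j) : freeProduct φ :=
  ⟨freeElem φ j x, subset_generatedBy _ ⟨⟨j, x⟩, rfl⟩⟩

/-- The von Neumann subalgebra of the free product generated by the operators `λ (θ j x)`. -/
def freeRange (θ : ∀ i, M i →⋆ₐ[ℂ] M i) : VonNeumannAlgebra (FreeL2 φ) :=
  generatedBy (Set.range fun p : Σ j, M j => freeElem φ p.1 (θ p.1 p.2))

/-- The free product state `∗ φ i` on a von Neumann algebra on `∗ L²(M i, φ i)`, that is, the vector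
state of the vacuum vector. -/
def freeState (N : VonNeumannAlgebra (FreeL2 φ)) : NormalState N :=
  N.vectorState (vacuum fun i => (φ i).cyclic) norm_vacuum

end VonNeumannAlgebra

end

/-! Let `g x` be the generators of a product algebra (tensor or free) and `h x` their prescribed
images before multiplication by `z`, all acting on one Hilbert space `L` with distinguished unit
vector Ω. Since the states are preserved, sending the class of `x` to the class of `θ i x` is an
isometry `V i` of `L²(M i, φ i)` that fixes the cyclic vector. These combine to an isometry `W` of
`L` with `W Ω = Ω` and `W (g x) = (h x) W`.

Consider all bounded `R` with `R (g x) = (h x) R`. Both families are closed under adjoints, so `R*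
S` commutes with every `g x`; hence the rule `T(a) (R ξ) = R (a ξ)` is consistent and bounded by the
norm of `a` (`exists_interOp`). Put `T(a) = 0` on the complement of the ranges. This gives a
`*`-homomorphism for which `T(1)` is the projection onto the closed span of the ranges. The
commutant of the `h x` permutes the intertwiners, so `T(a)` lies in the algebra `N` generated by the
`h x`.

For `n` in `N` one has `n R = R W* n W`, because `R W*` commutes with `N`. So `n` kills all ranges
iff `n W = 0`, and, as `T(a) Ω = W (a Ω)` and Ω is cyclic, iff `n` kills `N Ω`, which is the kernel
of the GNS representation. Thus `T(1)` is the central support (`isCentralSupport_interOp`).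

For normality, countably many vectors in the span of the ranges lie in the closed range of a single
operator that intertwines `a ⊗ 1` with `T(a)`; its polar decomposition turns functionals of `T(a)`
into functionals of `a ⊗ 1` (`isNormalFunctional_inner_interOp`). Uniqueness is the density part of
the double commutant theorem (`normal_ext`).

For factors it remains to see that the ranges are total. On one `L²` this is quasi-equivalence of
normal representations (`IsFactor.interSpan_eq_top`). In the tensor product an intertwiner `R` of
one slot enters as `(R V*) V`, where `R V*` commutes with the images of that slot. In the free
product such an operator has to act on last letters, from the right; the remaining letters of a word
are then created from the right as well, which commutes with the left action on words whose last
letter has another index. -/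

noncomputable section

/-! ## Extension of bounded maps from a subspace -/

section Extension

variable {L F X : Type*} [NormedAddCommGroup L] [InnerProductSpace ℂ L] [CompleteSpace L]
  [NormedAddCommGroup F] [NormedSpace ℂ F] [CompleteSpace F] [AddCommGroup X] [Module ℂ X]

/-- A linear map `f` bounded by `e` factors through `e`, by a bounded operator that vanishes on the
orthogonal complement of the range of `e`. -/
lemma exists_extension_of_bound (e : X →ₗ[ℂ] L) (f : X →ₗ[ℂ] F) (C : ℝ)
    (h : ∀ x, ‖f x‖ ≤ C * ‖e x‖) :
    ∃ G : L →L[ℂ] F, (∀ x, G (e x) = f x) ∧ ∀ v ∈ (LinearMap.range e)ᗮ, G v = 0 := by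
  set Q := (LinearMap.range e).topologicalClosure with hQ
  have hle : LinearMap.range e ≤ Q := Submodule.le_topologicalClosure _
  let e' : X →ₗ[ℂ] Q := e.codRestrict Q fun x => hle ⟨x, rfl⟩
  have hd : DenseRange e' := by
    intro ⟨q, hq⟩
    rw [Metric.mem_closure_iff]
    intro ε hε
    have hq' : q ∈ closure (LinearMap.range e : Set L) := hq
    obtain ⟨_, ⟨x, rfl⟩, hx⟩ := Metric.mem_closure_iff.1 hq' ε hε
    exact ⟨e' x, ⟨x, rfl⟩, hx⟩
  have : CompleteSpace Q := (Submodule.isClosed_topologicalClosure _).completeSpace_coe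
  refine ⟨(f.extendOfNorm e') ∘L Q.orthogonalProjectionOnto, fun x => ?_, fun v hv => ?_⟩
  · have h1 : Q.orthogonalProjectionOnto (e x) = e' x :=
      Submodule.orthogonalProjectionOnto_mem_subspace_eq_self (e' x)
    rw [ContinuousLinearMap.comp_apply, h1]
    exact LinearMap.extendOfNorm_eq hd ⟨C, h⟩ x
  · have h1 : Q.orthogonalProjectionOnto v = 0 := by
      rw [Submodule.orthogonalProjectionOnto_eq_zero_iff, hQ, Submodule.orthogonal_closure]
      exact hv
    rw [ContinuousLinearMap.comp_apply, h1, map_zero]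

/-- A closed subspace containing the image of a dense set under a continuous linear map contains
the range. -/
lemma Submodule.map_mem_of_dense {E : Type*} [NormedAddCommGroup E] [NormedSpace ℂ E]
    {Q : Submodule ℂ L} (hQ : IsClosed (Q : Set L)) (f : E →L[ℂ] L) {s : Set E}
    (hs : (Submodule.span ℂ s).topologicalClosure = ⊤) (h : ∀ x ∈ s, f x ∈ Q) (x : E) :
    f x ∈ Q := by
  have h1 : Submodule.span ℂ s ≤ Q.comap f.toLinearMap := Submodule.span_le.2 h
  have h2 := Submodule.topologicalClosure_minimal _ h1 (hQ.preimage f.continuous)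
  rw [hs] at h2
  exact h2 Submodule.mem_top

omit [CompleteSpace F] in
/-- Bounded operators that agree on a subspace and on its orthogonal complement. -/
lemma ContinuousLinearMap.ext_on_orthogonal {D : Submodule ℂ L} {a b : L →L[ℂ] F}
    (h1 : ∀ v ∈ D, a v = b v) (h2 : ∀ v ∈ Dᗮ, a v = b v) : a = b := by
  have : CompleteSpace D.topologicalClosure :=
    (Submodule.isClosed_topologicalClosure _).completeSpace_coe
  have h3 : D.topologicalClosure ≤ LinearMap.ker (a - b).toLinearMap :=
    Submodule.topologicalClosure_minimal _ (fun v hv => by simp [h1 v hv]) (a - b).isClosed_ker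
  ext v
  obtain ⟨y, hy, z, hz, rfl⟩ := D.topologicalClosure.exists_add_mem_mem_orthogonal v
  have h4 := h3 hy
  rw [LinearMap.mem_ker] at h4
  have h5 : a y = b y := sub_eq_zero.1 (by simpa using h4)
  rw [Submodule.orthogonal_closure] at hz
  rw [map_add, map_add, h5, h2 z hz]

/-- The projection onto a subspace that reduces `a` commutes with `a`. -/
lemma Submodule.starProjection_mul_comm {Q : Submodule ℂ L} [Q.HasOrthogonalProjection]
    {a : L →L[ℂ] L} (h1 : ∀ v ∈ Q, a v ∈ Q) (h2 : ∀ v ∈ Q, star a v ∈ Q) :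
    Q.starProjection * a = a * Q.starProjection := by
  have h3 : ∀ b : L →L[ℂ] L, (∀ v ∈ Q, b v ∈ Q) →
      Q.starProjection * b * Q.starProjection = b * Q.starProjection := by
    intro b hb
    ext1 v
    simp only [mul_apply_eq_comp]
    exact Submodule.starProjection_eq_self_iff.2 (hb _ (Submodule.starProjection_apply_mem _ _))
  have h4 := congrArg star (h3 _ h2)
  have h5 : star Q.starProjection = Q.starProjection := (isSelfAdjoint_starProjection Q).star_eq
  simp only [star_mul, star_star, h5] at h4
  rw [← mul_assoc, h3 a h1] at h4
  exact h4.symm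

end Extension

/-! ## Amplifications -/

section Amplification

variable {L : Type*} [NormedAddCommGroup L] [InnerProductSpace ℂ L] {κ : Type*}

variable (κ) in
/-- The operator `a ⊗ 1` on `L ⊗ ℓ²(κ)`. -/
def amp (a : L →L[ℂ] L) : lp (fun _ : κ => L) 2 →L[ℂ] lp (fun _ : κ => L) 2 :=
  lp.mapCLM 2 (fun _ => a) (norm_nonneg a) (fun _ => le_rfl)

@[simp] lemma amp_apply (a : L →L[ℂ] L) (g : lp (fun _ : κ => L) 2) (k : κ) :
    amp κ a g k = a (g k) := rfl

@[simp] lemma amp_one : amp κ (1 : L →L[ℂ] L) = 1 := by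
  ext g k
  rfl

lemma amp_mul (a b : L →L[ℂ] L) : amp κ (a * b) = amp κ a * amp κ b := by
  ext g k
  rfl

lemma amp_add (a b : L →L[ℂ] L) : amp κ (a + b) = amp κ a + amp κ b := by
  ext g k
  rfl

lemma amp_smul (c : ℂ) (a : L →L[ℂ] L) : amp κ (c • a) = c • amp κ a := by
  ext g k
  rfl

lemma amp_single [DecidableEq κ] (a : L →L[ℂ] L) (k : κ) (v : L) :
    amp κ a (lp.single 2 k v) = lp.single 2 k (a v) := by
  ext m
  rw [amp_apply]
  by_cases h : m = k
  · subst h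
    simp
  · rw [lp.single_apply_ne _ _ _ h, lp.single_apply_ne _ _ _ h, map_zero]

lemma summable_norm_sq_coe (g : lp (fun _ : κ => L) 2) : Summable fun k => ‖g k‖ ^ 2 := by
  have := (memℓp_gen_iff (p := 2) (by norm_num)).1 (lp.memℓp g)
  simpa using this

lemma exists_lp_of_summable (g : κ → L) (hg : Summable fun k => ‖g k‖ ^ 2) :
    ∃ g' : lp (fun _ : κ => L) 2, ∀ k, g' k = g k :=
  ⟨⟨g, (memℓp_gen_iff (p := 2) (by norm_num)).2 (by simpa using hg)⟩, fun _ => rfl⟩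

variable [CompleteSpace L]

lemma star_amp (a : L →L[ℂ] L) : star (amp κ a) = amp κ (star a) := by
  rw [ContinuousLinearMap.star_eq_adjoint, eq_comm, ContinuousLinearMap.eq_adjoint_iff]
  intro x y
  rw [lp.inner_eq_tsum, lp.inner_eq_tsum]
  refine tsum_congr fun k => ?_
  rw [amp_apply, amp_apply, ContinuousLinearMap.star_eq_adjoint,
    ContinuousLinearMap.adjoint_inner_left]

/-- An operator commuting with the amplifications of `S` commutes with those of `S''`. -/
lemma commute_amp_of_mem_centralizer_centralizer {S : Set (L →L[ℂ] L)}
    {p : lp (fun _ : κ => L) 2 →L[ℂ] lp (fun _ : κ => L) 2} (hp : ∀ e ∈ S, Commute p (amp κ e))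
    {x : L →L[ℂ] L} (hx : x ∈ Set.centralizer (Set.centralizer S)) : Commute p (amp κ x) := by
  classical
  -- The matrix entries of `p` lie in the commutant of `S`, so each of them commutes with `x`.
  have h1 : ∀ m n, ((lp.evalCLM ℂ (fun _ : κ => L) 2 m) ∘L p ∘L
      (lp.singleContinuousLinearMap ℂ (fun _ : κ => L) 2 n)) ∈ Set.centralizer S := by
    intro m n e he
    ext v
    have h2 := congrArg (fun q => q (lp.single 2 n v) m) (hp e he).eq
    simp only [mul_apply_eq_comp, amp_single] at h2
    exact h2.symm
  refine lp.ext_continuousLinearMap (by norm_num) fun n => ?_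
  ext v m
  have h3 := congrArg (fun q => q v) (hx _ (h1 m n))
  have h4 : (p * amp κ x) (lp.single 2 n v) m = (amp κ x * p) (lp.single 2 n v) m := by
    simp only [mul_apply_eq_comp, amp_single, amp_apply]
    exact h3
  exact h4

/-- The density half of the double commutant theorem. -/
lemma amp_mem_closure_of_mem_centralizer_centralizer (S : StarSubalgebra ℂ (L →L[ℂ] L))
    {x : L →L[ℂ] L} (hx : x ∈ Set.centralizer (Set.centralizer (S : Set (L →L[ℂ] L))))
    (g : lp (fun _ : κ => L) 2) :
    amp κ x g ∈ closure ((fun e => amp κ e g) '' (S : Set (L →L[ℂ] L))) := by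
  -- The closure of the orbit of `g` reduces the amplifications of `S`, so its projection commutes
  -- with them, and then with `amp κ x`. As `1` is in `S`, the orbit contains `g`, whence its
  -- closure contains `amp κ x g`.
  let D : Submodule ℂ (lp (fun _ : κ => L) 2) :=
    { carrier := (fun e => amp κ e g) '' (S : Set (L →L[ℂ] L))
      add_mem' := by
        rintro _ _ ⟨a, ha, rfl⟩ ⟨b, hb, rfl⟩
        exact ⟨a + b, add_mem ha hb, by simp [amp_add]⟩
      zero_mem' := ⟨0, zero_mem S, by ext k; simp⟩
      smul_mem' := by
        rintro c _ ⟨a, ha, rfl⟩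
        exact ⟨c • a, S.smul_mem ha c, by simp [amp_smul]⟩ }
  set Q := D.topologicalClosure with hQ
  have : CompleteSpace Q := (Submodule.isClosed_topologicalClosure _).completeSpace_coe
  have hinv : ∀ e ∈ S, ∀ v ∈ Q, amp κ e v ∈ Q := by
    intro e he v hv
    have h1 : D ≤ Q.comap (amp κ e).toLinearMap := by
      rintro _ ⟨a, ha, rfl⟩
      refine Submodule.le_topologicalClosure _ ⟨e * a, mul_mem he ha, ?_⟩
      simp [amp_mul]
    exact Submodule.topologicalClosure_minimal _ h1
      ((Submodule.isClosed_topologicalClosure _).preimage (amp κ e).continuous) hv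
  have hcomm : ∀ e ∈ S, Commute Q.starProjection (amp κ e) := by
    intro e he
    refine Submodule.starProjection_mul_comm (hinv e he) fun v hv => ?_
    rw [star_amp]
    exact hinv _ (star_mem he) v hv
  have h4 := commute_amp_of_mem_centralizer_centralizer hcomm hx
  have h5 : Q.starProjection g = g := Submodule.starProjection_eq_self_iff.2
    (Submodule.le_topologicalClosure _ ⟨1, one_mem S, by simp⟩)
  have h6 := congrArg (fun q => q g) h4.eq
  simp only [mul_apply_eq_comp, h5] at h6
  have h7 : amp κ x g ∈ Q := by
    rw [← h6]
    exact Submodule.starProjection_apply_mem _ _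
  exact h7

end Amplification

/-! ## Normal functionals -/

namespace VonNeumannAlgebra

section Normal

variable {H : Type*} [NormedAddCommGroup H] [InnerProductSpace ℂ H] [CompleteSpace H]
  {S : VonNeumannAlgebra H}

/-- The two square-summable sequences are vectors of `H ⊗ ℓ²`, so that a normal functional becomes a
single matrix coefficient of the amplification. -/
lemma isNormalFunctional_iff {f : S → ℂ} : S.IsNormalFunctional f ↔
    ∃ ξ η : lp (fun _ : ℕ => H) 2, ∀ x : S, f x = ⟪ξ, amp ℕ (x : H →L[ℂ] H) η⟫_ℂ := by
  constructor
  · rintro ⟨ξ, η, hξ, hη, h⟩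
    obtain ⟨ξ', hξ'⟩ := exists_lp_of_summable ξ hξ
    obtain ⟨η', hη'⟩ := exists_lp_of_summable η hη
    refine ⟨ξ', η', fun x => (h x).unique ?_⟩
    have h1 := lp.hasSum_inner (𝕜 := ℂ) ξ' (amp ℕ (x : H →L[ℂ] H) η')
    simpa only [amp_apply, hξ', hη'] using h1
  · rintro ⟨ξ, η, h⟩
    refine ⟨ξ, η, summable_norm_sq_coe ξ, summable_norm_sq_coe η, fun x => ?_⟩
    rw [h]
    exact lp.hasSum_inner (𝕜 := ℂ) ξ (amp ℕ (x : H →L[ℂ] H) η)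

/-- Serves for the double sequences that arise when an amplification is amplified again. -/
lemma isNormalFunctional_of_denumerable {κ : Type*} [Denumerable κ] {f : S → ℂ}
    (ξ η : κ → H) (hξ : Summable fun k => ‖ξ k‖ ^ 2) (hη : Summable fun k => ‖η k‖ ^ 2)
    (h : ∀ x : S, HasSum (fun k => ⟪ξ k, (x : H →L[ℂ] H) (η k)⟫_ℂ) (f x)) :
    S.IsNormalFunctional f := by
  let e := (Denumerable.eqv κ).symm
  exact ⟨fun n => ξ (e n), fun n => η (e n),
    (e.summable_iff (f := fun k => ‖ξ k‖ ^ 2)).2 hξ,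
    (e.summable_iff (f := fun k => ‖η k‖ ^ 2)).2 hη,
    fun x => (e.hasSum_iff (f := fun k => ⟪ξ k, (x : H →L[ℂ] H) (η k)⟫_ℂ)).2 (h x)⟩

lemma isNormalFunctional_inner (ξ η : H) :
    S.IsNormalFunctional fun x => ⟪ξ, (x : H →L[ℂ] H) η⟫_ℂ := by
  refine isNormalFunctional_iff.2 ⟨lp.single 2 0 ξ, lp.single 2 0 η, fun x => ?_⟩
  rw [amp_single, lp.inner_single_left, lp.single_apply_self]

/-- `x ↦ f (a x b)` is normal when `f` is. -/
lemma IsNormalFunctional.conj {f : S → ℂ} (hf : S.IsNormalFunctional f) (a b : S) :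
    S.IsNormalFunctional fun x => f (a * x * b) := by
  obtain ⟨ξ, η, h⟩ := isNormalFunctional_iff.1 hf
  refine isNormalFunctional_iff.2 ⟨amp ℕ (star (a : H →L[ℂ] H)) ξ, amp ℕ (b : H →L[ℂ] H) η,
    fun x => ?_⟩
  rw [h, ← star_amp, ContinuousLinearMap.star_eq_adjoint, ContinuousLinearMap.adjoint_inner_left]
  change ⟪ξ, amp ℕ ((a : H →L[ℂ] H) * (x : H →L[ℂ] H) * (b : H →L[ℂ] H)) η⟫_ℂ = _
  simp [amp_mul]

/-- The commutant of `X ∪ X*` is already closed under adjoints, so the union with its star in the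
outer centralizer is redundant. -/
lemma mem_generatedBy_iff {X : Set (H →L[ℂ] H)} {a : H →L[ℂ] H} :
    a ∈ generatedBy X ↔
      ∀ y, (∀ x ∈ X, y * x = x * y ∧ y * star x = star x * y) → a * y = y * a := by
  change a ∈ Set.centralizer ((StarSubalgebra.centralizer ℂ X : Set (H →L[ℂ] H)) ∪
    star (StarSubalgebra.centralizer ℂ X : Set (H →L[ℂ] H))) ↔ _
  have hstar : star (StarSubalgebra.centralizer ℂ X : Set (H →L[ℂ] H)) =
      (StarSubalgebra.centralizer ℂ X : Set (H →L[ℂ] H)) := by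
    ext y
    rw [Set.mem_star]
    constructor
    · intro h
      have h' : star (star y) ∈ StarSubalgebra.centralizer ℂ X := star_mem h
      rwa [star_star] at h'
    · intro h
      exact star_mem (s := StarSubalgebra.centralizer ℂ X) h
  rw [hstar, Set.union_self, Set.mem_centralizer_iff]
  refine forall_congr' fun y => ?_
  rw [SetLike.mem_coe, StarSubalgebra.mem_centralizer_iff]
  constructor
  · intro h1 h2
    exact (h1 fun x hx => ⟨((h2 x hx).1).symm, ((h2 x hx).2).symm⟩).symm
  · intro h1 h2
    exact (h1 fun x hx => ⟨((h2 x hx).1).symm, ((h2 x hx).2).symm⟩).symm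

lemma generatedBy_subset_centralizer_centralizer {X : Set (H →L[ℂ] H)}
    {S : StarSubalgebra ℂ (H →L[ℂ] H)} (h : X ⊆ S) {a : H →L[ℂ] H} (ha : a ∈ generatedBy X) :
    a ∈ Set.centralizer (Set.centralizer (S : Set (H →L[ℂ] H))) := by
  intro y hy
  exact (mem_generatedBy_iff.1 ha y fun x hx =>
    ⟨(hy x (h hx)).symm, (hy _ (star_mem (h hx))).symm⟩).symm

/-- Two normal functionals on the von Neumann algebra generated by `X` agree if they agree on a
`*`-subalgebra containing `X`. -/
lemma IsNormalFunctional.eq_of_eqOn {X : Set (H →L[ℂ] H)} {S : StarSubalgebra ℂ (H →L[ℂ] H)}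
    (hX : X ⊆ S) {f f' : generatedBy X → ℂ}
    (hf : (generatedBy X).IsNormalFunctional f) (hf' : (generatedBy X).IsNormalFunctional f')
    (hS : ∀ e ∈ S, e ∈ generatedBy X)
    (h : ∀ e (he : e ∈ S), f ⟨e, hS e he⟩ = f' ⟨e, hS e he⟩) : f = f' := by
  obtain ⟨ξ, η, hξ⟩ := isNormalFunctional_iff.1 hf
  obtain ⟨ξ', η', hξ'⟩ := isNormalFunctional_iff.1 hf'
  -- Laying the two pairs of sequences side by side, with a sign on one left vector, makes `f - f'`
  -- a single coefficient of the amplification; it then suffices to approximate at the one vector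
  -- `g`.
  obtain ⟨Ξ, hΞ⟩ := exists_lp_of_summable (κ := ℕ ⊕ ℕ) (Sum.elim ξ fun n => - ξ' n) 
    (Summable.sum _ ((summable_norm_sq_coe ξ).congr fun n => by simp)
      ((summable_norm_sq_coe ξ').congr fun n => by simp))
  obtain ⟨g, hg⟩ := exists_lp_of_summable (κ := ℕ ⊕ ℕ) (Sum.elim η η')
    (Summable.sum _ ((summable_norm_sq_coe η).congr fun n => by simp)
      ((summable_norm_sq_coe η').congr fun n => by simp))
  have key : ∀ a : generatedBy X, f a - f' a = ⟪Ξ, amp (ℕ ⊕ ℕ) (a : H →L[ℂ] H) g⟫_ℂ := by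
    intro a
    have h1 := lp.hasSum_inner (𝕜 := ℂ) ξ (amp ℕ (a : H →L[ℂ] H) η)
    have h2 := (lp.hasSum_inner (𝕜 := ℂ) ξ' (amp ℕ (a : H →L[ℂ] H) η')).neg
    have h3 := lp.hasSum_inner (𝕜 := ℂ) Ξ (amp (ℕ ⊕ ℕ) (a : H →L[ℂ] H) g)
    have h4 := HasSum.sum
      (f := fun k => ⟪Ξ k, amp (ℕ ⊕ ℕ) (a : H →L[ℂ] H) g k⟫_ℂ) (a := f a) (b := - f' a)
      (by
        rw [hξ]
        refine Eq.mp (congrArg (HasSum · _) (funext fun n => ?_)) h1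
        simp [hΞ, hg])
      (by
        rw [hξ']
        refine Eq.mp (congrArg (HasSum · _) (funext fun n => ?_)) h2
        simp [hΞ, hg])
    rw [sub_eq_add_neg]
    exact h4.unique h3
  ext a
  rw [← sub_eq_zero, key]
  have h1 := amp_mem_closure_of_mem_centralizer_centralizer S
    (generatedBy_subset_centralizer_centralizer hX a.2) g
  have h2 : IsClosed {v | ⟪Ξ, v⟫_ℂ = 0} := isClosed_eq (by fun_prop) (by fun_prop)
  refine h2.closure_subset_iff.2 ?_ h1
  rintro _ ⟨e, he, rfl⟩
  have := key ⟨e, hS e he⟩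
  rw [h e he, sub_self] at this
  exact this.symm

variable {K : Type*} [NormedAddCommGroup K] [InnerProductSpace ℂ K] [CompleteSpace K]

/-- Normal `*`-homomorphisms on `generatedBy X` with the same value at `1` agree if they agree on
a subset of `X` that generates a `*`-algebra containing `X`. -/
lemma normal_ext {X X₀ : Set (H →L[ℂ] H)} {R : VonNeumannAlgebra K}
    (h0 : X₀ ⊆ X) (h0' : X ⊆ StarAlgebra.adjoin ℂ X₀)
    {T T' : generatedBy X →⋆ₙₐ[ℂ] R} (hT : IsNormalMap T) (hT' : IsNormalMap T')
    (h1 : T 1 = T' 1) (hX : ∀ x : generatedBy X, (x : H →L[ℂ] H) ∈ X₀ → T x = T' x) : T = T' := by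
  -- The set of agreement. The maps need not be unital, so that it contains the scalars is exactly
  -- the hypothesis `h1`.
  let S : StarSubalgebra ℂ (H →L[ℂ] H) :=
    { carrier := {a | ∃ h : a ∈ generatedBy X, T ⟨a, h⟩ = T' ⟨a, h⟩}
      mul_mem' := by
        rintro a b ⟨ha, ha'⟩ ⟨hb, hb'⟩
        refine ⟨mul_mem ha hb, ?_⟩
        have := congrArg₂ (· * ·) ha' hb'
        simp only [← map_mul] at this
        exact this
      one_mem' := ⟨one_mem _, h1⟩
      add_mem' := by
        rintro a b ⟨ha, ha'⟩ ⟨hb, hb'⟩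
        refine ⟨add_mem ha hb, ?_⟩
        have := congrArg₂ (· + ·) ha' hb'
        simp only [← map_add] at this
        exact this
      zero_mem' := ⟨zero_mem _, (map_zero T).trans (map_zero T').symm⟩
      algebraMap_mem' := by
        intro c
        have hc : algebraMap ℂ (H →L[ℂ] H) c = c • 1 := Algebra.algebraMap_eq_smul_one c
        have hm : c • (1 : H →L[ℂ] H) ∈ generatedBy X := SMulMemClass.smul_mem c (one_mem _)
        rw [hc]
        refine ⟨hm, ?_⟩
        have := congrArg (c • ·) h1
        simp only [← map_smul] at this
        exact this
      star_mem' := by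
        rintro a ⟨ha, ha'⟩
        refine ⟨star_mem ha, ?_⟩
        have := congrArg star ha'
        simp only [← map_star] at this
        exact this }
  have hXS : X ⊆ S := h0'.trans (StarAlgebra.adjoin_le
    fun x hx => ⟨subset_generatedBy X (h0 hx), hX _ hx⟩)
  refine NonUnitalStarAlgHom.ext fun a => Subtype.ext ?_
  -- Matrix coefficients are normal functionals and separate operators.
  ext1 η
  refine ext_inner_left ℂ fun ξ => ?_
  have h2 : (R.IsNormalFunctional fun x => ⟪ξ, (x : K →L[ℂ] K) η⟫_ℂ) := isNormalFunctional_inner ξ η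
  have h3 := IsNormalFunctional.eq_of_eqOn hXS (hT _ h2) (hT' _ h2) (fun e he => he.1)
    (fun e he => by simp only [Function.comp_apply, he.2])
  exact congrFun h3 a

end Normal

end VonNeumannAlgebra

end

noncomputable section

/-! ## The homomorphism defined by intertwiners -/

namespace VonNeumannAlgebra

section Intertwiners

variable {L X : Type*} [NormedAddCommGroup L] [InnerProductSpace ℂ L]

/-- The bounded operators `R` with `R (g x) = (h x) R` for all `x`. -/
def intertwiners (g h : X → L →L[ℂ] L) : Set (L →L[ℂ] L) := {R | ∀ x, R * g x = h x * R}

/-- The closed span of the ranges of the intertwiners. -/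
def interSpan (g h : X → L →L[ℂ] L) : Submodule ℂ L :=
  (Submodule.span ℂ {v | ∃ R ∈ intertwiners g h, ∃ ξ, v = R ξ}).topologicalClosure

variable {g h : X → L →L[ℂ] L}

lemma isClosed_interSpan : IsClosed (interSpan g h : Set L) :=
  Submodule.isClosed_topologicalClosure _

lemma mem_interSpan {R : L →L[ℂ] L} (hR : R ∈ intertwiners g h) (ξ : L) : R ξ ∈ interSpan g h :=
  Submodule.le_topologicalClosure _ (Submodule.subset_span ⟨R, hR, ξ, rfl⟩)

lemma interSpan_le {Q : Submodule ℂ L} (hQ : IsClosed (Q : Set L))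
    (h1 : ∀ R ∈ intertwiners g h, ∀ ξ, R ξ ∈ Q) : interSpan g h ≤ Q := by
  refine Submodule.topologicalClosure_minimal _ (Submodule.span_le.2 ?_) hQ
  rintro _ ⟨R, hR, ξ, rfl⟩
  exact h1 R hR ξ

lemma map_interSpan {b : L →L[ℂ] L} (h1 : ∀ R ∈ intertwiners g h, ∀ ξ, b (R ξ) ∈ interSpan g h)
    {v : L} (hv : v ∈ interSpan g h) : b v ∈ interSpan g h := by
  have := interSpan_le (g := g) (h := h) (Q := (interSpan g h).comap b.toLinearMap)
    (isClosed_interSpan.preimage b.continuous) h1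
  exact this hv

variable [CompleteSpace L]

/-- Operators that agree on the ranges of the intertwiners and on the orthogonal complement. -/
lemma ext_interSpan {a b : L →L[ℂ] L} (h1 : ∀ R ∈ intertwiners g h, ∀ ξ, a (R ξ) = b (R ξ))
    (h2 : ∀ v ∈ (interSpan g h)ᗮ, a v = b v) : a = b := by
  refine ContinuousLinearMap.ext_on_orthogonal (D := interSpan g h) (fun v hv => ?_) h2
  have h3 : interSpan g h ≤ LinearMap.ker (a - b).toLinearMap :=
    interSpan_le (a - b).isClosed_ker fun R hR ξ => by simp [h1 R hR ξ]
  exact sub_eq_zero.1 (h3 hv)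

lemma mem_generatedBy_range_iff (hs : ∀ x, ∃ x', g x' = star (g x)) {a : L →L[ℂ] L} : a ∈ generatedBy (Set.range g) ↔
    ∀ y, (∀ x, y * g x = g x * y) → a * y = y * a := by
  rw [mem_generatedBy_iff]
  refine forall_congr' fun y => ?_
  constructor
  · intro h1 h2
    refine h1 ?_
    rintro _ ⟨x, rfl⟩
    obtain ⟨x', hg⟩ := hs x
    exact ⟨h2 x, hg ▸ h2 x'⟩
  · intro h1 h2
    exact h1 fun x => (h2 _ ⟨x, rfl⟩).1

/-! ### Boundedness of the map defined on the ranges of the intertwiners -/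

section Star

variable (hs : ∀ x, ∃ x', g x' = star (g x) ∧ h x' = star (h x))
include hs

lemma star_intertwiner {R : L →L[ℂ] L} (hR : R ∈ intertwiners g h) (x : X) :
    star R * h x = g x * star R := by
  obtain ⟨x', hg, hh⟩ := hs x
  have := congrArg star (hR x')
  rw [star_mul, star_mul, hg, hh, star_star, star_star] at this
  exact this.symm

/-- `R* S` passes from `g` to `h` and back, hence lies in the commutant of `g`. This is what makes
`R ξ ↦ R (a ξ)` consistent for different intertwiners. -/
lemma commute_star_mul {R S : L →L[ℂ] L} (hR : R ∈ intertwiners g h) (hS : S ∈ intertwiners g h)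
    {a : L →L[ℂ] L} (ha : a ∈ generatedBy (Set.range g)) :
    a * (star R * S) = star R * S * a := by
  refine (mem_generatedBy_range_iff fun x => (hs x).imp fun _ h => h.1).1 ha _ fun x => ?_
  rw [mul_assoc, hS x, ← mul_assoc, star_intertwiner hs hR, mul_assoc]

/-- The opposite product passes from `h` to `g` and back, and so provides elements of the commutant
of `h`. -/
lemma commute_mul_star {R S : L →L[ℂ] L} (hR : R ∈ intertwiners g h) (hS : S ∈ intertwiners g h)
    (x : X) : R * star S * h x = h x * (R * star S) := by
  rw [mul_assoc, star_intertwiner hs hS, ← mul_assoc, hR x, mul_assoc]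

omit [CompleteSpace L] hs in
lemma mul_mem_intertwiners {y R : L →L[ℂ] L} (hy : ∀ x, y * h x = h x * y)
    (hR : R ∈ intertwiners g h) : y * R ∈ intertwiners g h := by
  intro x
  rw [mul_assoc, hR x, ← mul_assoc, hy x, mul_assoc]

lemma inner_intertwiner {R S : L →L[ℂ] L} (hR : R ∈ intertwiners g h) (hS : S ∈ intertwiners g h)
    {a : L →L[ℂ] L} (ha : a ∈ generatedBy (Set.range g)) (ξ η : L) :
    ⟪R (a ξ), S η⟫_ℂ = ⟪R ξ, S (star a η)⟫_ℂ := by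
  have h1 := congrArg (fun q => ⟪ξ, q η⟫_ℂ) (commute_star_mul hs hR hS (star_mem ha))
  simp only [mul_apply_eq_comp, ContinuousLinearMap.star_eq_adjoint,
    ContinuousLinearMap.adjoint_inner_right] at h1
  exact h1

/-- On finite formal sums of pairs `(R, ξ)` let `Y a` add up the vectors `R (a ξ)`. The operator
exists once `Y a` is bounded by `Y 1`, and this is positivity of `‖a‖² - a* a`. -/
lemma exists_interOp {a : L →L[ℂ] L} (ha : a ∈ generatedBy (Set.range g)) :
    ∃ b : L →L[ℂ] L, (∀ R ∈ intertwiners g h, ∀ ξ, b (R ξ) = R (a ξ)) ∧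
      ∀ v ∈ (interSpan g h)ᗮ, b v = 0 := by
  classical
  let J := intertwiners g h
  let Y : (L →L[ℂ] L) → (J →₀ L) →ₗ[ℂ] L := fun a =>
    Finsupp.lsum ℂ fun R : J => ((R : L →L[ℂ] L) ∘L a).toLinearMap
  have hY : ∀ a x, Y a x = x.sum fun R ξ => (R : L →L[ℂ] L) (a ξ) := fun a x => rfl
  have hinner : ∀ a ∈ generatedBy (Set.range g), ∀ b x, ⟪Y a x, Y b x⟫_ℂ =
      ⟪Y 1 x, Y (star a * b) x⟫_ℂ := by
    intro a ha b x
    simp only [hY, Finsupp.sum, sum_inner, inner_sum]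
    refine Finset.sum_congr rfl fun S _ => Finset.sum_congr rfl fun R _ => ?_
    exact inner_intertwiner hs R.2 S.2 ha _ _
  have hadd : ∀ a b x, Y (a + b) x = Y a x + Y b x := by
    intro a b x
    simp [hY, Finsupp.sum, Finset.sum_add_distrib]
  have hsmul : ∀ (c : ℂ) a x, Y (c • a) x = c • Y a x := by
    intro c a x
    simp [hY, Finsupp.sum, Finset.smul_sum]
  let a' : generatedBy (Set.range g) := ⟨a, ha⟩
  -- The square root `c` of `‖a‖² - a* a` has to be found inside the generated algebra, since only
  -- elements of that algebra can be moved across the inner products of the ranges.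
  have hpos : 0 ≤ algebraMap ℝ (generatedBy (Set.range g)) (‖a'‖ ^ 2) - star a' * a' :=
    sub_nonneg.2 CStarAlgebra.star_mul_le_algebraMap_norm_sq
  obtain ⟨c, hc⟩ := CStarAlgebra.nonneg_iff_eq_star_mul_self.1 hpos
  have hc' : star a * a + star (c : L →L[ℂ] L) * c = ((‖a'‖ ^ 2 : ℝ) : ℂ) • 1 := by
    have h1 : star a' * a' + star c * c = algebraMap ℝ (generatedBy (Set.range g)) (‖a'‖ ^ 2) := by
      rw [← hc]
      abel
    have h2 := congrArg (Subtype.val : generatedBy (Set.range g) → L →L[ℂ] L) h1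
    rw [Algebra.algebraMap_eq_smul_one] at h2
    exact h2
  have hbound : ∀ x, ‖Y a x‖ ≤ ‖a'‖ * ‖Y 1 x‖ := by
    intro x
    refine (sq_le_sq₀ (norm_nonneg _) (by positivity)).1 ?_
    -- From `a* a + c* c = ‖a‖²`; dropping the second square gives the bound.
    have h1 : ((‖Y a x‖ ^ 2 + ‖Y c x‖ ^ 2 : ℝ) : ℂ) = ((‖a'‖ * ‖Y 1 x‖) ^ 2 : ℝ) := by
      have h2 := hinner a ha a x
      have h3 := hinner c c.2 c x
      have h4 : ⟪Y a x, Y a x⟫_ℂ + ⟪Y c x, Y c x⟫_ℂ =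
          ((‖a'‖ ^ 2 : ℝ) : ℂ) * ⟪Y 1 x, Y 1 x⟫_ℂ := by
        rw [h2, h3, ← inner_add_right, ← hadd, hc', hsmul, inner_smul_right]
      simp only [inner_self_eq_norm_sq_to_K] at h4
      rw [mul_pow]
      push_cast
      push_cast at h4
      exact h4
    have h2 := Complex.ofReal_injective h1
    nlinarith [sq_nonneg ‖Y (c : L →L[ℂ] L) x‖]
  obtain ⟨b, hb1, hb2⟩ := exists_extension_of_bound (Y 1) (Y a) _ hbound
  refine ⟨b, fun R hR ξ => ?_, fun v hv => hb2 v ?_⟩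
  · have := hb1 (Finsupp.single (⟨R, hR⟩ : J) ξ)
    rw [hY, hY, Finsupp.sum_single_index (by simp), Finsupp.sum_single_index (by simp)] at this
    exact this
  · refine Submodule.orthogonal_le ?_ hv
    rintro _ ⟨x, rfl⟩
    rw [hY]
    exact Submodule.sum_mem _ fun R _ => mem_interSpan R.2 _

end Star

/-- The operator `T(a)` with `T(a) (R ξ) = R (a ξ)` for the intertwiners `R`, which vanishes on the
orthogonal complement of their ranges. -/
def interOp (hs : ∀ x, ∃ x', g x' = star (g x) ∧ h x' = star (h x))
    (a : generatedBy (Set.range g)) : L →L[ℂ] L :=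
  (exists_interOp hs a.2).choose

/-! ### The homomorphism `T` and the central support -/

section Hom

variable (hs : ∀ x, ∃ x', g x' = star (g x) ∧ h x' = star (h x))

lemma interOp_apply (a : generatedBy (Set.range g)) {R : L →L[ℂ] L}
    (hR : R ∈ intertwiners g h) (ξ : L) :
    interOp hs a (R ξ) = R ((a : L →L[ℂ] L) ξ) :=
  (exists_interOp hs a.2).choose_spec.1 R hR ξ

lemma interOp_orthogonal (a : generatedBy (Set.range g)) {v : L} (hv : v ∈ (interSpan g h)ᗮ) :
    interOp hs a v = 0 :=
  (exists_interOp hs a.2).choose_spec.2 v hv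

lemma interOp_mem_interSpan (a : generatedBy (Set.range g)) (v : L) :
    interOp hs a v ∈ interSpan g h := by
  have : CompleteSpace (interSpan g h) := isClosed_interSpan.completeSpace_coe
  obtain ⟨y, hy, z, hz, rfl⟩ := (interSpan g h).exists_add_mem_mem_orthogonal v
  rw [map_add, interOp_orthogonal hs a hz, add_zero]
  refine map_interSpan (fun R hR ξ => ?_) hy
  rw [interOp_apply hs a hR]
  exact mem_interSpan hR _

lemma interOp_add (a b : generatedBy (Set.range g)) :
    interOp hs (a + b) = interOp hs a + interOp hs b := by
  refine ext_interSpan (g := g) (h := h) (fun R hR ξ => ?_) fun v hv => ?_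
  · simp [interOp_apply hs _ hR]
  · simp [interOp_orthogonal hs _ hv]

lemma interOp_smul (c : ℂ) (a : generatedBy (Set.range g)) :
    interOp hs (c • a) = c • interOp hs a := by
  refine ext_interSpan (g := g) (h := h) (fun R hR ξ => ?_) fun v hv => ?_
  · rw [interOp_apply hs _ hR, smul_apply, interOp_apply hs _ hR, ← map_smul]
    rfl
  · simp [interOp_orthogonal hs _ hv]

lemma interOp_mul (a b : generatedBy (Set.range g)) :
    interOp hs (a * b) = interOp hs a * interOp hs b := by
  refine ext_interSpan (g := g) (h := h) (fun R hR ξ => ?_) fun v hv => ?_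
  · simp [interOp_apply hs _ hR]
  · simp [interOp_orthogonal hs _ hv]

lemma interOp_star (a : generatedBy (Set.range g)) :
    interOp hs (star a) = star (interOp hs a) := by
  refine ext_interSpan (g := g) (h := h) (fun R hR ξ => ?_) fun v hv => ?_
  · refine ext_inner_right ℂ fun w => ?_
    rw [interOp_apply hs _ hR, ContinuousLinearMap.star_eq_adjoint,
      ContinuousLinearMap.adjoint_inner_left]
    have : CompleteSpace (interSpan g h) := isClosed_interSpan.completeSpace_coe
    -- The component `z` orthogonal to the ranges contributes to neither side, so only vectors `S η`
    -- need testing, and there `inner_intertwiner` moves `a` across.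
    obtain ⟨y, hy, z, hz, rfl⟩ := (interSpan g h).exists_add_mem_mem_orthogonal w
    have h1 : ∀ ζ, ⟪R ζ, z⟫_ℂ = 0 := fun ζ => hz _ (mem_interSpan hR ζ)
    rw [inner_add_right, h1, map_add, interOp_orthogonal hs a hz, add_zero, add_zero]
    have h2 : interSpan g h ≤ LinearMap.ker
        (innerSL ℂ (R ((star a : generatedBy (Set.range g)).1 ξ)) -
          innerSL ℂ (R ξ) ∘L interOp hs a).toLinearMap := by
      refine interSpan_le (ContinuousLinearMap.isClosed_ker _) fun S hS η => ?_
      rw [LinearMap.mem_ker]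
      change ⟪R ((star a : generatedBy (Set.range g)).1 ξ), S η⟫_ℂ -
        ⟪R ξ, interOp hs a (S η)⟫_ℂ = 0
      rw [interOp_apply hs _ hS, inner_intertwiner hs hR hS (star a).2, sub_eq_zero]
      change ⟪R ξ, S (star (star (a : L →L[ℂ] L)) η)⟫_ℂ = _
      rw [star_star]
    exact sub_eq_zero.1 (h2 hy)
  · rw [interOp_orthogonal hs _ hv]
    refine ext_inner_right ℂ fun w => ?_
    rw [ContinuousLinearMap.star_eq_adjoint, ContinuousLinearMap.adjoint_inner_left, inner_zero_left,
      ← inner_conj_symm, hv _ (interOp_mem_interSpan hs a w), map_zero]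

/-- If `y` commutes with all `h x`, then `y R` is again an intertwiner, so `T(a) y` and `y T(a)`
agree on ranges. The same for `star y` shows that `y` preserves the orthogonal complement, where
both products vanish. -/
lemma interOp_mem (a : generatedBy (Set.range g)) :
    interOp hs a ∈ generatedBy (Set.range h) := by
  refine (mem_generatedBy_range_iff fun x => (hs x).imp fun _ h => h.2).2 fun y hy => ?_
  have hy' : ∀ x, star y * h x = h x * star y := by
    intro x
    obtain ⟨x', -, hx'⟩ := hs x
    have := congrArg star (hy x')
    rw [star_mul, star_mul, hx', star_star] at this
    exact this.symm
  refine ext_interSpan (g := g) (h := h) (fun R hR ξ => ?_) fun v hv => ?_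
  · have := interOp_apply hs a (mul_mem_intertwiners hy hR) ξ
    simp only [mul_apply_eq_comp] at this ⊢
    rw [this, interOp_apply hs a hR]
  · have h1 : y v ∈ (interSpan g h)ᗮ := by
      intro w hw
      rw [← ContinuousLinearMap.adjoint_inner_left, ← ContinuousLinearMap.star_eq_adjoint]
      refine hv _ (map_interSpan (fun R hR ξ => ?_) hw)
      exact mem_interSpan (mul_mem_intertwiners hy' hR) ξ
    rw [mul_apply_eq_comp, mul_apply_eq_comp, interOp_orthogonal hs a h1,
      interOp_orthogonal hs a hv, map_zero]

lemma interOp_one_apply {v : L} (hv : v ∈ interSpan g h) : interOp hs 1 v = v := by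
  have h2 : interSpan g h ≤ LinearMap.ker (interOp hs 1 - 1).toLinearMap := by
    refine interSpan_le (ContinuousLinearMap.isClosed_ker _) fun S hS η => ?_
    rw [LinearMap.mem_ker]
    change interOp hs 1 (S η) - S η = 0
    rw [interOp_apply hs _ hS]
    exact sub_self _
  exact sub_eq_zero.1 (h2 hv)

/-- On a range, `T (g x) (R ξ) = R (g x ξ) = h x (R ξ)`. As `h` is closed under adjoints, `h x`
reduces the span of the ranges, so the projection `T(1)` may stand on either side of it. -/
lemma interOp_generator (x : X) :
    interOp hs ⟨g x, subset_generatedBy _ ⟨x, rfl⟩⟩ = interOp hs 1 * h x := by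
  have h1 : interOp hs ⟨g x, subset_generatedBy _ ⟨x, rfl⟩⟩ = h x * interOp hs 1 := by
    refine ext_interSpan (g := g) (h := h) (fun R hR ξ => ?_) fun v hv => ?_
    · rw [interOp_apply hs _ hR, mul_apply_eq_comp, interOp_one_apply hs (mem_interSpan hR ξ)]
      exact congrArg (fun q => q ξ) (hR x)
    · rw [interOp_orthogonal hs _ hv, mul_apply_eq_comp, interOp_orthogonal hs _ hv, map_zero]
  rw [h1]
  refine ext_interSpan (g := g) (h := h) (fun R hR ξ => ?_) fun v hv => ?_
  · have h2 : h x (R ξ) = R (g x ξ) := (congrArg (fun q => q ξ) (hR x)).symm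
    rw [mul_apply_eq_comp, mul_apply_eq_comp, interOp_one_apply hs (mem_interSpan hR ξ), h2,
      interOp_one_apply hs (mem_interSpan hR _)]
  · have h1 : h x v ∈ (interSpan g h)ᗮ := by
      intro w hw
      rw [← ContinuousLinearMap.adjoint_inner_left, ← ContinuousLinearMap.star_eq_adjoint]
      refine hv _ (map_interSpan (fun R hR ξ => ?_) hw)
      obtain ⟨x', -, hx'⟩ := hs x
      have h2 : h x' (R ξ) = R (g x' ξ) := (congrArg (fun q => q ξ) (hR x')).symm
      rw [← hx', h2]
      exact mem_interSpan hR _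
    rw [mul_apply_eq_comp, mul_apply_eq_comp, interOp_orthogonal hs _ hv,
      interOp_orthogonal hs _ h1, map_zero]

/-- The homomorphism `a ↦ T(a)`. -/
def interHom (hh : ∀ x, h x ∈ generatedBy (Set.range g)) :
    generatedBy (Set.range g) →⋆ₙₐ[ℂ] generatedBy (Set.range g) where
  toFun a := ⟨interOp hs a, by
    have h1 := interOp_mem hs a
    rw [mem_generatedBy_range_iff fun x => (hs x).imp fun _ h => h.2] at h1
    -- An operator commuting with all `g x` commutes with all `h x`, because these lie in the
    -- algebra generated by `g`; so `T(a)` stays in that algebra.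
    refine (mem_generatedBy_range_iff fun x => (hs x).imp fun _ h => h.1).2 fun y hy => ?_
    refine h1 y fun x => ?_
    exact ((mem_generatedBy_range_iff fun x => (hs x).imp fun _ h => h.1).1 (hh x) y hy).symm⟩
  map_smul' c a := Subtype.ext (interOp_smul hs c a)
  map_zero' := Subtype.ext (by
    have := interOp_smul hs 0 0
    rwa [zero_smul, zero_smul] at this)
  map_add' a b := Subtype.ext (interOp_add hs a b)
  map_mul' a b := Subtype.ext (interOp_mul hs a b)
  map_star' a := Subtype.ext (interOp_star hs a)

/-- The unit of the range of `T` is the central support of a vector state on `generatedBy h`, if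
its vector is fixed by an isometric intertwiner. -/
lemma isCentralSupport_interOp {V : L →L[ℂ] L} (hV : V ∈ intertwiners g h)
    (hV1 : star V * V = 1) {Ω : L} (hΩ : ‖Ω‖ = 1) (hVΩ : V Ω = Ω)
    (hc : Dense {v | ∃ a ∈ generatedBy (Set.range g), v = a Ω}) :
    ((generatedBy (Set.range h)).vectorState Ω hΩ).IsCentralSupport
      ⟨interOp hs 1, interOp_mem hs 1⟩ := by
  have hmem := @mem_generatedBy_range_iff L X _ _ h _ (fun x => (hs x).imp fun _ h => h.2)
  have hVV : ∀ ξ, star V (V ξ) = ξ := fun ξ => congrArg (fun q => q ξ) hV1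
  -- Insert `V* V = 1` after `R`: the operator `R V*` commutes with `n`. Thus `n` on any range is
  -- determined by `n V`.
  have hN : ∀ n ∈ generatedBy (Set.range h), ∀ R ∈ intertwiners g h, ∀ ξ,
      n (R ξ) = R (star V (n (V ξ))) := by
    intro n hn R hR ξ
    have h1 := congrArg (fun q => q (V ξ)) (hmem.1 hn _ (commute_mul_star hs hR hV))
    simp only [mul_apply_eq_comp, hVV] at h1
    exact h1
  have hinv : ∀ n ∈ generatedBy (Set.range h), ∀ v ∈ interSpan g h, n v ∈ interSpan g h := by
    intro n hn v hv
    refine map_interSpan (fun R hR ξ => ?_) hv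
    rw [hN n hn R hR]
    exact mem_interSpan hR _
  have hstar1 : star (interOp hs 1) = interOp hs 1 := by
    rw [← interOp_star, star_one]
  have hcomm : ∀ n ∈ generatedBy (Set.range h), interOp hs 1 * n = n * interOp hs 1 := by
    have h1 : ∀ n ∈ generatedBy (Set.range h),
        interOp hs 1 * (n * interOp hs 1) = n * interOp hs 1 := by
      intro n hn
      ext1 v
      exact interOp_one_apply hs (hinv n hn _ (interOp_mem_interSpan hs 1 v))
    intro n hn
    have h2 := congrArg star (h1 (star n) (star_mem hn))
    simp only [star_mul, star_star, hstar1] at h2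
    rw [← h2, mul_assoc, h1 n hn]
  have hidem : interOp hs 1 * interOp hs 1 = interOp hs 1 := by
    rw [← interOp_mul, one_mul]
  refine ⟨⟨Subtype.ext hidem, Subtype.ext hstar1⟩, fun n => Subtype.ext (hcomm n n.2), fun n => ?_⟩
  -- The GNS representation of a vector state is the action on the closure of `N Ω`, so its kernel
  -- consists of the `n` that kill `N Ω`.
  have hrep : ((generatedBy (Set.range h)).vectorState Ω hΩ).rep n = 0 ↔
      ∀ m ∈ generatedBy (Set.range h), (n : L →L[ℂ] L) (m Ω) = 0 := by
    set φ := (generatedBy (Set.range h)).vectorState Ω hΩ with hφ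
    have h1 : ∀ m : generatedBy (Set.range h),
        ‖φ.rep n (φ.toPositiveLinearMap.toPreGNS m : φ.toPositiveLinearMap.PreGNS)‖ =
          ‖(n : L →L[ℂ] L) ((m : L →L[ℂ] L) Ω)‖ := by
      intro m
      have h2 : φ.rep n (φ.toPositiveLinearMap.toPreGNS m : φ.toPositiveLinearMap.PreGNS) =
          ((φ.toPositiveLinearMap.toPreGNS (n * m) : φ.toPositiveLinearMap.PreGNS) : φ.L2) := by
        change φ.toPositiveLinearMap.gnsNonUnitalStarAlgHom n _ = _
        rw [PositiveLinearMap.gnsNonUnitalStarAlgHom_apply_coe]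
        rfl
      rw [h2, Completion.norm_coe]
      refine (sq_eq_sq₀ (norm_nonneg _) (norm_nonneg _)).1 (Complex.ofReal_injective ?_)
      have h3 := φ.toPositiveLinearMap.preGNS_norm_sq (φ.toPositiveLinearMap.toPreGNS (n * m))
      push_cast
      refine h3.trans ?_
      change ⟪Ω, (star ((n : L →L[ℂ] L) * m) * ((n : L →L[ℂ] L) * m)) Ω⟫_ℂ = _
      rw [mul_apply_eq_comp, ContinuousLinearMap.star_eq_adjoint,
        ContinuousLinearMap.adjoint_inner_right, inner_self_eq_norm_sq_to_K]
      rfl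
    constructor
    · intro h2 m hm
      have := h1 ⟨m, hm⟩
      rw [h2] at this
      exact norm_eq_zero.1 (this.symm.trans (by simp))
    · intro h2
      ext v
      induction v using Completion.induction_on with
      | hp => exact isClosed_eq (by fun_prop) (by fun_prop)
      | ih m =>
        have := h1 (φ.toPositiveLinearMap.ofPreGNS m)
        rw [h2 _ (φ.toPositiveLinearMap.ofPreGNS m).2, norm_zero] at this
        exact norm_eq_zero.1 this
  rw [hrep]
  constructor
  · intro h1
    -- The elements `T(a)` belong to `N`, and `T(a) Ω = T(a) (V Ω) = V (a Ω)`; by cyclicity of Ω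
    -- these vectors are dense in the range of `V`.
    have h2 : ∀ v, (n : L →L[ℂ] L) (V v) = 0 := by
      intro v
      have h3 : IsClosed {v | (n : L →L[ℂ] L) (V v) = 0} :=
        isClosed_eq (by fun_prop) (by fun_prop)
      have h4 : closure {v | ∃ a ∈ generatedBy (Set.range g), v = a Ω} ⊆
          {v | (n : L →L[ℂ] L) (V v) = 0} := by
        refine h3.closure_subset_iff.2 ?_
        rintro _ ⟨a, ha, rfl⟩
        have h5 := h1 _ (interOp_mem hs ⟨a, ha⟩)
        rw [← hVΩ, interOp_apply hs _ hV] at h5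
        exact h5
      exact h4 (hc v)
    have h3 : (n : L →L[ℂ] L) * interOp hs 1 = 0 := by
      refine ext_interSpan (g := g) (h := h) (fun R hR ξ => ?_) fun v hv => ?_
      · rw [mul_apply_eq_comp, interOp_one_apply hs (mem_interSpan hR ξ), hN n n.2 R hR, h2]
        simp
      · rw [mul_apply_eq_comp, interOp_orthogonal hs _ hv]
        simp
    refine ⟨n, Subtype.ext ?_⟩
    change (n : L →L[ℂ] L) = n * (1 - interOp hs 1)
    rw [mul_sub, h3, mul_one, sub_zero]
  · rintro ⟨y, hy⟩ m hm
    -- As Ω is in the range of `V`, the orbit `N Ω` lies in the span of the ranges, where `1 - T(1)`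
    -- vanishes.
    have h1 : m Ω ∈ interSpan g h := hinv m hm _ (hVΩ ▸ mem_interSpan hV Ω)
    rw [hy]
    change (y : L →L[ℂ] L) (m Ω - interOp hs 1 (m Ω)) = 0
    rw [interOp_one_apply hs h1, sub_self, map_zero]

end Hom

end Intertwiners

end VonNeumannAlgebra

end

noncomputable section

/-! ## Normality of the homomorphism defined by intertwiners -/

namespace VonNeumannAlgebra

section

variable {L X : Type*} [NormedAddCommGroup L] [InnerProductSpace ℂ L]

/-- Countably many vectors in the closed span of `s` lie in the closed span of a sequence in `s`. -/
lemma exists_seq_mem_closure_span {s : Set L} (h0 : (0 : L) ∈ s) (v : ℕ → L)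
    (hv : ∀ n, v n ∈ (Submodule.span ℂ s).topologicalClosure) :
    ∃ t : ℕ → L, (∀ k, t k ∈ s) ∧
      ∀ n, v n ∈ (Submodule.span ℂ (Set.range t)).topologicalClosure := by
  have h1 : ∀ n, ∃ u : ℕ → L, (∀ m, u m ∈ Submodule.span ℂ s) ∧
      Filter.Tendsto u Filter.atTop (nhds (v n)) := fun n => mem_closure_iff_seq_limit.1 (hv n)
  choose u hu hu' using h1
  have h2 : ∀ n m, ∃ t : Finset L, (t : Set L) ⊆ s ∧ u n m ∈ Submodule.span ℂ (t : Set L) :=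
    fun n m => Submodule.mem_span_finite_of_mem_span (hu n m)
  choose t ht ht' using h2
  have hc : (insert 0 (⋃ n, ⋃ m, (t n m : Set L))).Countable :=
    (Set.countable_iUnion fun n => Set.countable_iUnion fun m =>
      (t n m).countable_toSet).insert 0
  obtain ⟨f, hf⟩ := hc.exists_eq_range ⟨0, Set.mem_insert _ _⟩
  refine ⟨f, fun k => ?_, fun n => ?_⟩
  · have : f k ∈ insert 0 (⋃ n, ⋃ m, (t n m : Set L)) := hf ▸ Set.mem_range_self k
    rcases this with h | h
    · rwa [h]
    · obtain ⟨n, h⟩ := Set.mem_iUnion.1 h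
      obtain ⟨m, h⟩ := Set.mem_iUnion.1 h
      exact ht n m h
  · refine mem_closure_of_tendsto (hu' n) (Filter.Eventually.of_forall fun m => ?_)
    refine Submodule.span_mono ?_ (ht' n m)
    rw [← hf]
    exact fun x hx => Set.mem_insert_of_mem _ (Set.mem_iUnion₂.2 ⟨n, m, hx⟩)

lemma exists_hasSum_apply {G : Type*} [NormedAddCommGroup G] [NormedSpace ℂ G] [CompleteSpace L]
    (S : ℕ → G →L[ℂ] L) (hS : Summable fun k => ‖S k‖) :
    ∃ Y : G →L[ℂ] L, ∀ x, HasSum (fun k => S k x) (Y x) :=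
  ⟨∑' k, S k, fun x => hS.of_norm.hasSum.mapL (ContinuousLinearMap.apply ℂ L x)⟩

/-- The row operator of a summable sequence of operators. -/
lemma exists_row_operator [CompleteSpace L] (R : ℕ → L →L[ℂ] L) (hR : Summable fun k => ‖R k‖) :
    ∃ Y : lp (fun _ : ℕ => L) 2 →L[ℂ] L, ∀ k η, Y (lp.single 2 k η) = R k η := by
  let S : ℕ → lp (fun _ : ℕ => L) 2 →L[ℂ] L := fun k => R k ∘L lp.evalCLM ℂ (fun _ : ℕ => L) 2 k
  have hSapp : ∀ k g, S k g = R k (g k) := fun k g => rfl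
  have hSnorm : ∀ k, ‖S k‖ ≤ ‖R k‖ := by
    intro k
    refine ContinuousLinearMap.opNorm_le_bound _ (norm_nonneg _) fun g => ?_
    rw [hSapp]
    refine ((R k).le_opNorm _).trans ?_
    gcongr
    exact lp.norm_apply_le_norm (by norm_num) g k
  obtain ⟨Y, hY⟩ := exists_hasSum_apply S
    (Summable.of_nonneg_of_le (fun k => norm_nonneg _) hSnorm hR)
  refine ⟨Y, fun k η => (hY (lp.single 2 k η)).unique ?_⟩
  have h2 := hasSum_single (f := fun j => S j (lp.single 2 k η)) k fun j hj => by
    rw [hSapp, lp.single_apply_ne _ _ _ hj, map_zero]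
  rwa [hSapp, lp.single_apply_self] at h2

omit [InnerProductSpace ℂ L] in
lemma summable_norm_sq_prod (w : ℕ → lp (fun _ : ℕ => L) 2) (hw : Summable fun n => ‖w n‖ ^ 2) :
    Summable fun p : ℕ × ℕ => ‖w p.1 p.2‖ ^ 2 := by
  have hn : ∀ n, HasSum (fun m => ‖w n m‖ ^ 2) (‖w n‖ ^ 2) := by
    intro n
    have := lp.hasSum_norm (p := 2) (by norm_num) (w n)
    simpa using this
  refine (summable_prod_of_nonneg (f := fun p : ℕ × ℕ => ‖w p.1 p.2‖ ^ 2)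
    fun p => sq_nonneg _).2 ⟨fun n => (hn n).summable, ?_⟩
  refine hw.congr fun n => ?_
  exact (hn n).tsum_eq.symm

lemma summable_norm_sq_map {G : Type*} [NormedAddCommGroup G] [NormedSpace ℂ G] (U : L →L[ℂ] G)
    {v : ℕ → L} (hv : Summable fun n => ‖v n‖ ^ 2) : Summable fun n => ‖U (v n)‖ ^ 2 := by
  refine Summable.of_nonneg_of_le (fun n => sq_nonneg _) (fun n => ?_) (hv.mul_left (‖U‖ ^ 2))
  rw [← mul_pow]
  gcongr
  exact U.le_opNorm _

/-- For an operator `Y` that intertwines `B` and `T`, the vector functionals of `T` at vectors in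
the closed range of `Y` are vector functionals of `B`. -/
lemma exists_inner_eq_inner_of_intertwining {G L : Type*} [NormedAddCommGroup G]
    [InnerProductSpace ℂ G] [CompleteSpace G] [NormedAddCommGroup L] [InnerProductSpace ℂ L]
    [CompleteSpace L] (Y : G →L[ℂ] L) :
    ∃ W : L →L[ℂ] G, ∀ (B : G →L[ℂ] G) (T : L →L[ℂ] L), T ∘L Y = Y ∘L B →
      star T ∘L Y = Y ∘L star B → ∀ x ∈ closure (Set.range Y), ∀ y ∈ closure (Set.range Y),
        ⟪W x, B (W y)⟫_ℂ = ⟪x, T y⟫_ℂ := by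
  -- Polar decomposition: `Q` is the modulus of `Y`, and `W` maps `Y x` isometrically to `Q x`.
  -- Since `B` commutes with `Y* Y`, it commutes with `Q`, so `W` carries the coefficients of `T` to
  -- those of `B`.
  let P := ContinuousLinearMap.adjoint Y ∘L Y
  have hP0 : 0 ≤ P := by
    rw [ContinuousLinearMap.nonneg_iff_isPositive]
    exact ContinuousLinearMap.isPositive_adjoint_comp_self Y
  let Q := CFC.sqrt P
  have hQs : star Q = Q := (IsSelfAdjoint.of_nonneg (CFC.sqrt_nonneg _)).star_eq
  have hQQ : Q * Q = P := CFC.sqrt_mul_sqrt_self _ hP0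
  have hinner : ∀ x y, ⟪Q x, Q y⟫_ℂ = ⟪Y x, Y y⟫_ℂ := by
    intro x y
    rw [← ContinuousLinearMap.adjoint_inner_right, ← ContinuousLinearMap.star_eq_adjoint, hQs,
      ← mul_apply_eq_comp, hQQ]
    change ⟪x, ContinuousLinearMap.adjoint Y (Y y)⟫_ℂ = _
    rw [ContinuousLinearMap.adjoint_inner_right]
  obtain ⟨W, hW, -⟩ := exists_extension_of_bound Y.toLinearMap Q.toLinearMap 1 (fun x => by
    rw [one_mul]
    refine le_of_eq ?_
    change ‖Q x‖ = ‖Y x‖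
    refine (sq_eq_sq₀ (norm_nonneg _) (norm_nonneg _)).1 ?_
    rw [← @inner_self_eq_norm_sq ℂ, ← @inner_self_eq_norm_sq ℂ, hinner])
  have hW' : ∀ x, W (Y x) = Q x := hW
  refine ⟨W, fun B T hT hT' x hx y hy => ?_⟩
  have hPc : Commute P B := by
    have h1 := congrArg ContinuousLinearMap.adjoint hT'
    rw [ContinuousLinearMap.adjoint_comp, ContinuousLinearMap.adjoint_comp,
      ← ContinuousLinearMap.star_eq_adjoint (star T), star_star,
      ← ContinuousLinearMap.star_eq_adjoint (star B), star_star] at h1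
    change (ContinuousLinearMap.adjoint Y ∘L Y) ∘L B = B ∘L (ContinuousLinearMap.adjoint Y ∘L Y)
    rw [ContinuousLinearMap.comp_assoc, ← hT, ← ContinuousLinearMap.comp_assoc, h1,
      ContinuousLinearMap.comp_assoc]
  have hQc : Commute Q B := hPc.cfcₙ_nnreal _
  have h1 : ∀ u, ⟪W (Y u), B (W y)⟫_ℂ = ⟪Y u, T y⟫_ℂ := by
    intro u
    have hcl : IsClosed {y | ⟪W (Y u), B (W y)⟫_ℂ = ⟪Y u, T y⟫_ℂ} :=
      isClosed_eq (by fun_prop) (by fun_prop)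
    refine hcl.closure_subset_iff.2 ?_ hy
    rintro _ ⟨v, rfl⟩
    change ⟪W (Y u), B (W (Y v))⟫_ℂ = ⟪Y u, (T ∘L Y) v⟫_ℂ
    rw [hT, hW', hW', ContinuousLinearMap.comp_apply, ← hinner]
    exact congrArg (fun q => ⟪Q u, q v⟫_ℂ) hQc.eq.symm
  have hcl : IsClosed {x | ⟪W x, B (W y)⟫_ℂ = ⟪x, T y⟫_ℂ} :=
    isClosed_eq (by fun_prop) (by fun_prop)
  refine hcl.closure_subset_iff.2 ?_ hx
  rintro _ ⟨u, rfl⟩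
  exact h1 u

variable [CompleteSpace L] {g h : X → L →L[ℂ] L}
  (hs : ∀ x, ∃ x', g x' = star (g x) ∧ h x' = star (h x))

/-- Countably many vectors of `interSpan` lie in the closure of the range of a single bounded
operator that intertwines `a ⊗ 1` and `T(a)`. -/
lemma exists_amp_intertwiner (v : ℕ → L) (hv : ∀ n, v n ∈ interSpan g h) :
    ∃ Y : lp (fun _ : ℕ => L) 2 →L[ℂ] L, (∀ n, v n ∈ closure (Set.range Y)) ∧
      ∀ (a : generatedBy (Set.range g)), interOp hs a ∘L Y = Y ∘L amp ℕ (a : L →L[ℂ] L) := by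
  obtain ⟨t, ht, htv⟩ := exists_seq_mem_closure_span (s := {v | ∃ R ∈ intertwiners g h, ∃ ξ, v = R ξ})
    ⟨0, fun x => by simp, 0, by simp⟩ v hv
  choose R hR ξ hξ using ht
  -- Positive weights that make the norms of `c k • R k` summable; being non-zero they lose no
  -- vector of the ranges.
  let c : ℕ → ℂ := fun k => (((1 / 2 : ℝ) ^ k / (1 + ‖R k‖) : ℝ) : ℂ)
  have hc : ∀ k, c k ≠ 0 := fun k => by
    have : (0 : ℝ) < (1 / 2 : ℝ) ^ k / (1 + ‖R k‖) := by positivity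
    exact Complex.ofReal_ne_zero.2 this.ne'
  have hsum : Summable fun k => ‖c k • R k‖ := by
    refine Summable.of_nonneg_of_le (fun k => norm_nonneg _) (fun k => ?_)
      (summable_geometric_of_lt_one (r := (1 / 2 : ℝ)) (by norm_num) (by norm_num))
    have h1 : ‖c k‖ = (1 / 2 : ℝ) ^ k / (1 + ‖R k‖) := by
      rw [Complex.norm_real, Real.norm_of_nonneg (by positivity)]
    rw [norm_smul, h1, div_mul_eq_mul_div, div_le_iff₀ (by positivity)]
    gcongr
    linarith
  obtain ⟨Y, hY⟩ := exists_row_operator _ hsum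
  have hsingle : ∀ k η, Y (lp.single 2 k η) = c k • R k η := hY
  refine ⟨Y, fun n => ?_, fun a => ?_⟩
  · have h1 : Submodule.span ℂ (Set.range t) ≤ LinearMap.range (Y).toLinearMap := by
      refine Submodule.span_le.2 ?_
      rintro _ ⟨k, rfl⟩
      refine ⟨lp.single 2 k ((c k)⁻¹ • ξ k), ?_⟩
      refine (hsingle _ _).trans ?_
      rw [map_smul, smul_smul, mul_inv_cancel₀ (hc k), one_smul, hξ]
    exact closure_mono (fun x hx => h1 hx) (htv n)
  · refine lp.ext_continuousLinearMap (by norm_num) fun k => ?_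
    ext1 η
    simp only [ContinuousLinearMap.comp_apply, lp.singleContinuousLinearMap_apply, amp_single,
      hsingle, map_smul, interOp_apply hs a (hR k)]

/-- Since `T(a) = z T(a) z`, both sequences may be compressed into the span of the ranges. One
operator `Y` reaches all these vectors approximately, and its polar part `W` rewrites each
coefficient of `T(a)` as a coefficient of `a ⊗ 1`. The resulting double sequences are still
square-summable. -/
lemma isNormalFunctional_inner_interOp (ξ η : lp (fun _ : ℕ => L) 2) :
    (generatedBy (Set.range g)).IsNormalFunctional
      fun a => ⟪ξ, amp ℕ (interOp hs a) η⟫_ℂ := by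
  set z := interOp hs 1 with hz
  obtain ⟨Y, hY, hYT⟩ := exists_amp_intertwiner hs
    -- Interleaving: the vectors from `ξ` sit at even places, those from `η` at odd places, so that
    -- the same `Y` serves for both.
    (fun n => if Even n then z (ξ (n / 2)) else z (η (n / 2)))
    (fun n => by
      dsimp only
      split_ifs <;> exact interOp_mem_interSpan hs 1 _)
  have hξ : ∀ n, z (ξ n) ∈ closure (Set.range Y) := fun n => by
    simpa using hY (2 * n)
  have hη : ∀ n, z (η n) ∈ closure (Set.range Y) := fun n => by
    have := hY (2 * n + 1)
    have h2 : (2 * n + 1) / 2 = n := by omega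
    simpa [h2, Nat.even_add_one] using this
  obtain ⟨W, hW⟩ := exists_inner_eq_inner_of_intertwining Y
  have hWT : ∀ (a : generatedBy (Set.range g)) (x y : L), x ∈ closure (Set.range Y) →
      y ∈ closure (Set.range Y) →
      ⟪W x, amp ℕ (a : L →L[ℂ] L) (W y)⟫_ℂ = ⟪x, interOp hs a y⟫_ℂ := by
    intro a x y hx hy
    refine hW _ _ (hYT a) ?_ x hx y hy
    rw [← interOp_star, star_amp]
    exact hYT (star a)
  have hsum : ∀ ζ : lp (fun _ : ℕ => L) 2, Summable fun p : ℕ × ℕ => ‖W (z (ζ p.1)) p.2‖ ^ 2 := by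
    intro ζ
    exact summable_norm_sq_prod (fun n => W (z (ζ n)))
      (summable_norm_sq_map W (summable_norm_sq_map z (summable_norm_sq_coe ζ)))
  refine isNormalFunctional_of_denumerable (κ := ℕ × ℕ) (fun p => W (z (ξ p.1)) p.2)
    (fun p => W (z (η p.1)) p.2) (hsum ξ) (hsum η) fun a => ?_
  obtain ⟨ξ', hξ'⟩ := exists_lp_of_summable _ (hsum ξ)
  obtain ⟨η', hη'⟩ := exists_lp_of_summable _ (hsum η)
  have h1 := lp.summable_inner (𝕜 := ℂ) ξ' (amp _ (a : L →L[ℂ] L) η')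
  simp only [amp_apply, hξ', hη'] at h1
  have h2 := h1.hasSum.prod_fiberwise fun n =>
    lp.hasSum_inner (𝕜 := ℂ) (W (z (ξ n))) (amp ℕ (a : L →L[ℂ] L) (W (z (η n))))
  have h3 := lp.hasSum_inner (𝕜 := ℂ) ξ (amp ℕ (interOp hs a) η)
  have h4 : ∀ n, ⟪W (z (ξ n)), amp ℕ (a : L →L[ℂ] L) (W (z (η n)))⟫_ℂ =
      ⟪ξ n, amp ℕ (interOp hs a) η n⟫_ℂ := by
    intro n
    rw [hWT a _ _ (hξ n) (hη n), amp_apply]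
    have h5 : interOp hs a = star z * (interOp hs a * z) := by
      rw [hz, ← interOp_star, star_one, ← interOp_mul, ← interOp_mul, one_mul, mul_one]
    conv_rhs => rw [h5]
    rw [mul_apply_eq_comp, mul_apply_eq_comp, ContinuousLinearMap.star_eq_adjoint,
      ContinuousLinearMap.adjoint_inner_right]
  simp only [h4] at h2
  rw [← h2.unique h3]
  exact h1.hasSum

/-- The homomorphism `a ↦ T(a)` is normal. -/
lemma isNormalMap_interHom (hh : ∀ x, h x ∈ generatedBy (Set.range g)) :
    IsNormalMap (interHom hs hh) := by
  intro f hf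
  obtain ⟨ξ, η, hfξ⟩ := isNormalFunctional_iff.1 hf
  have : f ∘ interHom hs hh = fun a => ⟪ξ, amp ℕ (interOp hs a) η⟫_ℂ := by
    funext a
    exact hfξ _
  rw [this]
  exact isNormalFunctional_inner_interOp hs ξ η

include hs in
/-- Existence and uniqueness of the homomorphism with `T (g x) = z (h x)`, where `z` is the central
support of the vector state. -/
theorem existsUnique_normal_hom (hh : ∀ x, h x ∈ generatedBy (Set.range g))
    {V : L →L[ℂ] L} (hV : V ∈ intertwiners g h)
    (hV1 : star V * V = 1) {Ω : L} (hΩ : ‖Ω‖ = 1) (hVΩ : V Ω = Ω)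
    (hc : Dense {v | ∃ a ∈ generatedBy (Set.range g), v = a Ω})
    {p : X → Prop} (hp : ∀ x, g x ∈ StarAlgebra.adjoin ℂ (g '' {x | p x})) :
    ∃ z : generatedBy (Set.range h),
      ((generatedBy (Set.range h)).vectorState Ω hΩ).IsCentralSupport z ∧
      ∃! T : generatedBy (Set.range g) →⋆ₙₐ[ℂ] generatedBy (Set.range g),
        IsNormalMap T ∧ (T 1 : L →L[ℂ] L) = z ∧
        ∀ x, p x → (T ⟨g x, subset_generatedBy _ ⟨x, rfl⟩⟩ : L →L[ℂ] L) = z * h x := by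
  refine ⟨_, isCentralSupport_interOp hs hV hV1 hΩ hVΩ hc, interHom hs hh,
    ⟨isNormalMap_interHom hs hh, rfl, fun x _ => interOp_generator hs x⟩, ?_⟩
  rintro T ⟨hT, hT1, hTx⟩
  -- By `hp`, the generators singled out by `p` already generate all `g x` as a `*`-algebra.
  refine normal_ext (Set.image_subset_range _ _) (Set.range_subset_iff.2 hp) hT
    (isNormalMap_interHom hs hh) (Subtype.ext hT1) ?_
  rintro ⟨_, hx'⟩ ⟨x, hx, rfl⟩
  exact Subtype.ext ((hTx x hx).trans (interOp_generator hs x).symm)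

include hs in
/-- If the ranges of the intertwiners span, the central support is `1` and the homomorphism is
unital and injective. -/
theorem existsUnique_normal_hom_of_interSpan_eq_top
    (hh : ∀ x, h x ∈ generatedBy (Set.range g))
    {V : L →L[ℂ] L} (hV : V ∈ intertwiners g h)
    (hV1 : star V * V = 1) {Ω : L} (hΩ : ‖Ω‖ = 1) (hVΩ : V Ω = Ω)
    (hc : Dense {v | ∃ a ∈ generatedBy (Set.range g), v = a Ω})
    {p : X → Prop} (hp : ∀ x, g x ∈ StarAlgebra.adjoin ℂ (g '' {x | p x})) (htop : interSpan g h = ⊤) :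
    ((generatedBy (Set.range h)).vectorState Ω hΩ).IsCentralSupport 1 ∧
      ∃ T : generatedBy (Set.range g) →⋆ₐ[ℂ] generatedBy (Set.range g),
        Function.Injective T ∧
        (IsNormalMap T ∧ ∀ x, p x → T ⟨g x, subset_generatedBy _ ⟨x, rfl⟩⟩ = ⟨h x, hh x⟩) ∧
        ∀ T' : generatedBy (Set.range g) →⋆ₐ[ℂ] generatedBy (Set.range g),
          (IsNormalMap T' ∧ ∀ x, p x → T' ⟨g x, subset_generatedBy _ ⟨x, rfl⟩⟩ = ⟨h x, hh x⟩) →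
            T' = T := by
  have h1 : interOp hs 1 = 1 := by
    ext1 v
    exact interOp_one_apply hs (htop ▸ Submodule.mem_top)
  have h2 := isCentralSupport_interOp hs hV hV1 hΩ hVΩ hc
  have h3 : (⟨interOp hs 1, interOp_mem hs 1⟩ : generatedBy (Set.range h)) = 1 := Subtype.ext h1
  rw [h3] at h2
  have hT1 : interHom hs hh 1 = 1 := Subtype.ext h1
  let T : generatedBy (Set.range g) →⋆ₐ[ℂ] generatedBy (Set.range g) :=
    { interHom hs hh with
      map_one' := hT1
      commutes' := fun c => by
        rw [Algebra.algebraMap_eq_smul_one]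
        refine (map_smul (interHom hs hh) c 1).trans ?_
        rw [hT1] }
  have hTg : ∀ x, T ⟨g x, subset_generatedBy _ ⟨x, rfl⟩⟩ = ⟨h x, hh x⟩ := by
    intro x
    refine Subtype.ext ((interOp_generator hs x).trans ?_)
    rw [h1, one_mul]
  have hTn : IsNormalMap T := isNormalMap_interHom hs hh
  refine ⟨h2, T, ?_, ⟨hTn, fun x _ => hTg x⟩, ?_⟩
  -- The isometry recovers `a` from `T(a)`, as `V* T(a) V = a`.
  · intro a b hab
    have hab' : interOp hs a = interOp hs b := congrArg Subtype.val hab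
    refine Subtype.ext ?_
    ext1 v
    have h4 := congrArg (fun q => star V (q (V v))) hab'
    have hVV : ∀ ξ, star V (V ξ) = ξ := fun ξ => congrArg (fun q => q ξ) hV1
    simpa only [interOp_apply hs _ hV, hVV] using h4
  · rintro T' ⟨hT'n, hT'g⟩
    have h4 : (T' : generatedBy (Set.range g) →⋆ₙₐ[ℂ] generatedBy (Set.range g)) = T := by
      refine normal_ext (Set.image_subset_range _ _) (Set.range_subset_iff.2 hp) hT'n hTn ?_ ?_
      · exact (map_one T').trans (map_one T).symm
      · rintro ⟨_, hx'⟩ ⟨x, hx, rfl⟩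
        exact (hT'g x hx).trans (hTg x).symm
    exact StarAlgHom.ext fun a => congrArg (fun q => q a) h4

end

end VonNeumannAlgebra

end

noncomputable section

/-! ## Normal representations of factors -/

namespace VonNeumannAlgebra

section Factor

variable {H E F : Type*} [NormedAddCommGroup H] [InnerProductSpace ℂ H] [CompleteSpace H]
  [NormedAddCommGroup E] [InnerProductSpace ℂ E] [CompleteSpace E]
  [NormedAddCommGroup F] [InnerProductSpace ℂ F]

/-- The amplification as a representation. -/
def ampHom (κ : Type*) : (H →L[ℂ] H) →⋆ₐ[ℂ]
    (lp (fun _ : κ => H) 2 →L[ℂ] lp (fun _ : κ => H) 2) where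
  toFun := amp κ
  map_one' := amp_one
  map_mul' := amp_mul
  map_zero' := by
    ext g k
    rfl
  map_add' := amp_add
  commutes' c := by
    rw [Algebra.algebraMap_eq_smul_one, Algebra.algebraMap_eq_smul_one, amp_smul, amp_one]
  map_star' a := (star_amp a).symm

/-- If a cyclic representation is dominated by another one, it is a quotient of it. -/
lemma exists_intertwiner_of_dominated {A G : Type*} [Ring A] [StarRing A] [Algebra ℂ A]
    [NormedAddCommGroup G] [InnerProductSpace ℂ G] [CompleteSpace G]
    (α : A →⋆ₐ[ℂ] (G →L[ℂ] G)) (π : A →⋆ₐ[ℂ] (E →L[ℂ] E)) (ζ : G) (ξ : E) (C : ℝ)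
    (h : ∀ a, ‖π a ξ‖ ≤ C * ‖α a ζ‖) :
    ∃ U : G →L[ℂ] E, U ζ = ξ ∧ ∀ a, U ∘L α a = π a ∘L U := by
  let e : A →ₗ[ℂ] G :=
    { toFun := fun a => α a ζ
      map_add' := fun a b => by simp
      map_smul' := fun c a => by simp }
  let f : A →ₗ[ℂ] E :=
    { toFun := fun a => π a ξ
      map_add' := fun a b => by simp
      map_smul' := fun c a => by simp }
  obtain ⟨U, hU, hU'⟩ := exists_extension_of_bound e f C h
  have hU1 : ∀ a, U (α a ζ) = π a ξ := hU
  refine ⟨U, ?_, fun b => ?_⟩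
  · simpa using hU1 1
  · refine ContinuousLinearMap.ext_on_orthogonal (D := LinearMap.range e) ?_ fun v hv => ?_
    -- The cyclic subspace of `ζ` reduces `α`; the intertwining relation is checked there, while `U`
    -- vanishes on the complement.
    · rintro _ ⟨a, rfl⟩
      change U (α b (α a ζ)) = π b (U (α a ζ))
      rw [hU1, ← mul_apply_eq_comp, ← map_mul, hU1, map_mul, mul_apply_eq_comp]
    · have h1 : α b v ∈ (LinearMap.range e)ᗮ := by
        rintro _ ⟨a, rfl⟩
        change ⟪α a ζ, α b v⟫_ℂ = 0
        rw [← ContinuousLinearMap.adjoint_inner_left, ← ContinuousLinearMap.star_eq_adjoint,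
          ← map_star, ← mul_apply_eq_comp, ← map_mul]
        exact hv _ ⟨_, rfl⟩
      rw [ContinuousLinearMap.comp_apply, ContinuousLinearMap.comp_apply, hU' _ h1, hU' _ hv,
        map_zero]

variable {M : VonNeumannAlgebra H} (π : M →⋆ₐ[ℂ] (E →L[ℂ] E))

/-- Polarization: the square of `‖π a ξ‖` is the real part of the inner product of `α a η` and `α a
g`, hence at most a quarter of the square of `‖α a (η + g)‖`. So `ξ` is dominated by the vector `η +
g` of the amplification, with constant `1 / 2`. -/
lemma exists_amp_intertwiner_of_isNormalFunctional {ξ : E}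
    (hξ : M.IsNormalFunctional fun a => ⟪ξ, π a ξ⟫_ℂ) :
    ∃ (U : lp (fun _ : ℕ => H) 2 →L[ℂ] E) (ζ : lp (fun _ : ℕ => H) 2), U ζ = ξ ∧
      ∀ a : M, U ∘L amp ℕ (a : H →L[ℂ] H) = π a ∘L U := by
  obtain ⟨η, g, hg⟩ := isNormalFunctional_iff.1 hξ
  let α : M →⋆ₐ[ℂ] (lp (fun _ : ℕ => H) 2 →L[ℂ] lp (fun _ : ℕ => H) 2) :=
    (ampHom ℕ).comp M.toStarSubalgebra.subtype
  have hα : ∀ a : M, α a = amp ℕ (a : H →L[ℂ] H) := fun a => rfl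
  obtain ⟨U, hU, hU'⟩ := exists_intertwiner_of_dominated α π (η + g) ξ (1 / 2) fun a => by
    have h1 : ((‖π a ξ‖ ^ 2 : ℝ) : ℂ) = ⟪α a η, α a g⟫_ℂ := by
      have h2 := hg (star a * a)
      have h3 : amp ℕ ((star a * a : M) : H →L[ℂ] H) = star (α a) * α a := by
        rw [← hα, map_mul, map_star]
      rw [h3, map_mul, map_star, mul_apply_eq_comp, mul_apply_eq_comp,
        ContinuousLinearMap.star_eq_adjoint, ContinuousLinearMap.star_eq_adjoint,
        ContinuousLinearMap.adjoint_inner_right, ContinuousLinearMap.adjoint_inner_right,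
        inner_self_eq_norm_sq_to_K] at h2
      push_cast
      exact h2
    have h4 : ‖π a ξ‖ ^ 2 = RCLike.re ⟪α a η, α a g⟫_ℂ := by
      rw [← h1]
      rfl
    have h5 := @norm_add_sq ℂ _ _ _ _ (α a η) (α a g)
    have h6 := @norm_sub_sq ℂ _ _ _ _ (α a η) (α a g)
    rw [map_add]
    refine (sq_le_sq₀ (norm_nonneg _) (by positivity)).1 ?_
    have h7 := sq_nonneg ‖α a η - α a g‖
    rw [mul_pow]
    linarith
  exact ⟨U, _, hU, hU'⟩

/-- A normal vector functional of a representation gives bounded intertwiners with the identity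
representation. -/
lemma exists_intertwiner_of_isNormalFunctional {ξ : E}
    (hξ : M.IsNormalFunctional fun a => ⟪ξ, π a ξ⟫_ℂ) {q : E →L[ℂ] F} (hq : q ξ ≠ 0) :
    ∃ u : H →L[ℂ] E, (∀ a : M, u ∘L (a : H →L[ℂ] H) = π a ∘L u) ∧ q ∘L u ≠ 0 := by
  classical
  obtain ⟨U, ζ, hU, hU'⟩ := exists_amp_intertwiner_of_isNormalFunctional π hξ
  by_contra! hcon
  -- The restrictions of `U` to the summands of `H ⊗ ℓ²` are intertwiners on `H`. If `q` killed them
  -- all, it would kill `U`, hence `ξ`.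
  have h1 : ∀ n, q ∘L (U ∘L lp.singleContinuousLinearMap ℂ (fun _ : ℕ => H) 2 n) = 0 := by
    intro n
    refine hcon _ fun a => ?_
    ext1 v
    have := congrArg (fun r => r (lp.single 2 n v)) (hU' a)
    simpa only [ContinuousLinearMap.comp_apply, lp.singleContinuousLinearMap_apply,
      amp_single] using this
  have h2 : q ∘L U = 0 := lp.ext_continuousLinearMap (by norm_num) fun n => by
    rw [ContinuousLinearMap.comp_assoc, h1 n, ContinuousLinearMap.zero_comp]
  apply hq
  rw [← hU]
  exact congrArg (fun r => r ζ) h2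

/-- For a factor, `M' v* E` is total in `H` for each non-zero intertwiner `v : H → E`. -/
lemma IsFactor.eq_zero_of_comp_commutant (hM : M.IsFactor) {v : H →L[ℂ] E} (hv0 : v ≠ 0)
    (hv : ∀ a : M, v ∘L (a : H →L[ℂ] H) = π a ∘L v) {q : H →L[ℂ] F}
    (hq : ∀ y ∈ M.commutant, q ∘L y ∘L ContinuousLinearMap.adjoint v = 0) : q = 0 := by
  set v' := ContinuousLinearMap.adjoint v with hv'
  let D : Submodule ℂ H :=
    (Submodule.span ℂ {w | ∃ y ∈ M.commutant, ∃ e, w = y (v' e)}).topologicalClosure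
  have hDc : IsClosed (D : Set H) := Submodule.isClosed_topologicalClosure _
  have : CompleteSpace D := hDc.completeSpace_coe
  have hDmem : ∀ y ∈ M.commutant, ∀ e, y (v' e) ∈ D := fun y hy e =>
    Submodule.le_topologicalClosure _ (Submodule.subset_span ⟨y, hy, e, rfl⟩)
  have hDle : ∀ Q : Submodule ℂ H, IsClosed (Q : Set H) →
      (∀ y ∈ M.commutant, ∀ e, y (v' e) ∈ Q) → D ≤ Q := by
    intro Q hQ h1
    refine Submodule.topologicalClosure_minimal _ (Submodule.span_le.2 ?_) hQ
    rintro _ ⟨y, hy, e, rfl⟩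
    exact h1 y hy e
  have hinv' : ∀ x ∈ M.commutant, ∀ w ∈ D, x w ∈ D := fun x hx w hw =>
    hDle (D.comap x.toLinearMap) (hDc.preimage x.continuous)
      (fun y hy e => hDmem (x * y) (mul_mem hx hy) e) hw
  have hinv : ∀ x ∈ M, ∀ w ∈ D, x w ∈ D := by
    intro x hx w hw
    refine hDle (D.comap x.toLinearMap) (hDc.preimage x.continuous) (fun y hy e => ?_) hw
    change x (y (v' e)) ∈ D
    have h1 : x (y (v' e)) = y (x (v' e)) := congrArg (fun r => r (v' e)) (mem_commutant_iff.1 hy x hx)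
    have h2 : x (v' e) = v' (π ⟨x, hx⟩ e) := by
      have h3 := congrArg ContinuousLinearMap.adjoint (hv (star ⟨x, hx⟩))
      rw [ContinuousLinearMap.adjoint_comp, ContinuousLinearMap.adjoint_comp, map_star,
        ← ContinuousLinearMap.star_eq_adjoint (star (π _)), star_star,
        ← ContinuousLinearMap.star_eq_adjoint] at h3
      change star (star x) ∘L v' = _ at h3
      rw [star_star] at h3
      exact congrArg (fun r => r e) h3
    rw [h1, h2]
    exact hDmem y hy _
  -- The subspace `D` is invariant under `M'` by construction and under `M` because `x v* = v*
  -- π(x)`. So its projection is central, hence a scalar, and the scalar is `1` because `v* ≠ 0`.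
  have hP' : D.starProjection ∈ M.commutant := mem_commutant_iff.2 fun x hx =>
    (Submodule.starProjection_mul_comm (hinv x hx) (hinv _ (star_mem hx))).symm
  have hP : D.starProjection ∈ M := by
    rw [← M.commutant_commutant]
    exact mem_commutant_iff.2 fun x hx =>
      (Submodule.starProjection_mul_comm (hinv' x hx) (hinv' _ (star_mem hx))).symm
  obtain ⟨c, hc⟩ := hM ⟨_, hP⟩ fun y => Subtype.ext (mem_commutant_iff.1 hP' y y.2).symm
  have hc' : ∀ w ∈ D, w = c • w := by
    intro w hw
    have h1 := congrArg (fun r : M => (r : H →L[ℂ] H) w) hc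
    change D.starProjection w = c • w at h1
    rwa [Submodule.starProjection_eq_self_iff.2 hw] at h1
  have hqD : ∀ w ∈ D, q w = 0 := fun w hw =>
    hDle (LinearMap.ker q.toLinearMap) q.isClosed_ker
      (fun y hy e => congrArg (fun r : E →L[ℂ] F => r e) (hq y hy)) hw
  obtain ⟨e, he⟩ : ∃ e, v' e ≠ 0 := by
    by_contra! hcon
    apply hv0
    have : v' = 0 := ContinuousLinearMap.ext hcon
    rw [← ContinuousLinearMap.adjoint_adjoint v, ← hv', this, map_zero]
  have hc1 : c = 1 := by
    have h1 := hc' _ (hDmem 1 (one_mem _) e)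
    have h2 : (1 - c) • v' e = 0 := by
      rw [sub_smul, one_smul, sub_eq_zero]
      exact h1
    rcases smul_eq_zero.1 h2 with h3 | h3
    · exact (sub_eq_zero.1 h3).symm
    · exact absurd h3 he
  ext w
  have h1 := congrArg (fun r : M => (r : H →L[ℂ] H) w) hc
  change D.starProjection w = c • w at h1
  rw [hc1, one_smul] at h1
  exact hqD w (Submodule.starProjection_eq_self_iff.1 h1)

/-- Normal unital endomorphisms of factors are injective. -/
lemma IsFactor.injective (hM : M.IsFactor) [Nontrivial H] {θ : M →⋆ₐ[ℂ] M} (hθ : IsNormalMap θ) :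
    Function.Injective θ := by
  obtain ⟨ξ, hξ⟩ := exists_ne (0 : H)
  let ρ : M →⋆ₐ[ℂ] (H →L[ℂ] H) := M.toStarSubalgebra.subtype.comp θ
  have hρ : ∀ a, ρ a = (θ a : H →L[ℂ] H) := fun a => rfl
  obtain ⟨u, hu, hu0⟩ := exists_intertwiner_of_isNormalFunctional ρ (ξ := ξ)
    (hθ _ (isNormalFunctional_inner ξ ξ)) (q := 1) hξ
  have hu0' : u ≠ 0 := fun h => hu0 (by rw [h, ContinuousLinearMap.comp_zero])
  rw [injective_iff_map_eq_zero]
  intro x hx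
  -- From `u x = θ(x) u = 0` follows `u y* x = 0` for `y` in the commutant. The adjoint relation
  -- says that `x*` kills the vectors `y u* ξ`, which are total.
  have h1 : star (x : H →L[ℂ] H) = 0 := by
    refine hM.eq_zero_of_comp_commutant ρ hu0' hu fun y hy => ?_
    have h2 : u ∘L (star y ∘L (x : H →L[ℂ] H)) = 0 := by
      have h3 : star y ∘L (x : H →L[ℂ] H) = (x : H →L[ℂ] H) ∘L star y :=
        (mem_commutant_iff.1 (star_mem hy) x x.2).symm
      rw [h3, ← ContinuousLinearMap.comp_assoc, hu, hρ, hx]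
      ext v
      rfl
    have h4 := congrArg ContinuousLinearMap.adjoint h2
    rw [ContinuousLinearMap.adjoint_comp, ContinuousLinearMap.adjoint_comp, map_zero,
      ← ContinuousLinearMap.star_eq_adjoint (star y), star_star,
      ← ContinuousLinearMap.star_eq_adjoint] at h4
    exact h4
  exact Subtype.ext (star_eq_zero.1 h1)

/-- Normal representations of a factor are quasi-equivalent: the ranges of the intertwiners from one
to the other are total. -/
lemma IsFactor.interSpan_eq_top (hM : M.IsFactor) (α π : M →⋆ₐ[ℂ] (E →L[ℂ] E)) {ζ : E} (hζ : ζ ≠ 0)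
    (hζn : M.IsNormalFunctional fun a => ⟪ζ, α a ζ⟫_ℂ) {κ : Type*} {ξ : κ → E}
    (hd : DenseRange ξ) (hξ : ∀ k, M.IsNormalFunctional fun a => ⟪ξ k, π a (ξ k)⟫_ℂ) :
    interSpan (fun a => α a) (fun a => π a) = ⊤ := by
  set D := interSpan (fun a => α a) (fun a => π a) with hD
  have : CompleteSpace D := isClosed_interSpan.completeSpace_coe
  set q := Dᗮ.starProjection with hq
  have hqD : ∀ v ∈ D, q v = 0 := fun v hv => by
    rw [hq, Submodule.starProjection_orthogonal_val,
      Submodule.starProjection_eq_self_iff.2 hv, sub_self]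
  have hDinv : ∀ a, ∀ v ∈ D, π a v ∈ D := fun a v hv =>
    map_interSpan (fun R hR ξ => by
      have h1 : π a (R ξ) = R (α a ξ) := (congrArg (fun r => r ξ) (hR a)).symm
      rw [h1]
      exact mem_interSpan hR _) hv
  have hDinv' : ∀ a, ∀ v ∈ Dᗮ, π a v ∈ Dᗮ := by
    intro a v hv w hw
    rw [← ContinuousLinearMap.adjoint_inner_left, ← ContinuousLinearMap.star_eq_adjoint,
      ← map_star]
    exact hv _ (hDinv _ w hw)
  have hqc : ∀ a, q * π a = π a * q := fun a =>
    Submodule.starProjection_mul_comm (hDinv' a) fun v hv => by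
      rw [← map_star]
      exact hDinv' _ v hv
  have hqq : ∀ v, q (q v) = q v := fun v =>
    Submodule.starProjection_eq_self_iff.2 (Submodule.starProjection_apply_mem _ _)
  -- If some `q (ξ x)` were non-zero, normality would give an intertwiner `u` from the identity
  -- representation to `π` with `q u ≠ 0`, and a non-zero `v` from it to `α`. Every `q u y v*` with
  -- `y` in `M'` intertwines `α` and `π`, so its range lies in `D`, where `q` vanishes. Totality of
  -- the vectors `y v* ξ` then forces `q u = 0`.
  have hq0 : q = 0 := by
    by_contra hne
    obtain ⟨x, hx⟩ : ∃ x, q (ξ x) ≠ 0 := by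
      by_contra! hcon
      apply hne
      ext1 η
      exact isClosed_property hd (isClosed_eq (by fun_prop) (by fun_prop)) hcon η
    obtain ⟨u, hu, hqu⟩ := exists_intertwiner_of_isNormalFunctional π (hξ x) hx
    obtain ⟨v, hv, hv0⟩ := exists_intertwiner_of_isNormalFunctional α hζn (q := 1) hζ
    have hv0' : v ≠ 0 := fun h => hv0 (by rw [h, ContinuousLinearMap.comp_zero])
    apply hqu
    refine hM.eq_zero_of_comp_commutant α hv0' hv fun y hy => ?_
    have hvs : ∀ (a : M) ξ, ContinuousLinearMap.adjoint v (α a ξ) =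
        (a : H →L[ℂ] H) (ContinuousLinearMap.adjoint v ξ) := by
      intro a ξ
      have h3 := congrArg ContinuousLinearMap.adjoint (hv (star a))
      rw [ContinuousLinearMap.adjoint_comp, ContinuousLinearMap.adjoint_comp, map_star,
        ← ContinuousLinearMap.star_eq_adjoint (star (α _)), star_star,
        ← ContinuousLinearMap.star_eq_adjoint] at h3
      change star (star (a : H →L[ℂ] H)) ∘L _ = _ at h3
      rw [star_star] at h3
      exact (congrArg (fun r => r ξ) h3).symm
    have hwJ : (q ∘L u) ∘L y ∘L ContinuousLinearMap.adjoint v ∈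
        intertwiners (fun a => α a) (fun a => π a) := by
      intro a
      ext1 ξ
      change q (u (y (ContinuousLinearMap.adjoint v (α a ξ)))) =
        π a (q (u (y (ContinuousLinearMap.adjoint v ξ))))
      have h4 : ∀ η, y ((a : H →L[ℂ] H) η) = (a : H →L[ℂ] H) (y η) := fun η =>
        congrArg (fun r => r η) (mem_commutant_iff.1 hy a a.2).symm
      have h5 : ∀ η, u ((a : H →L[ℂ] H) η) = π a (u η) := fun η =>
        congrArg (fun r => r η) (hu a)
      have h6 : ∀ η, q (π a η) = π a (q η) := fun η =>
        congrArg (fun r => r η) (hqc a)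
      rw [hvs, h4, h5, h6]
    ext1 ξ
    have h7 : q (q (u (y (ContinuousLinearMap.adjoint v ξ)))) = 0 := hqD _ (mem_interSpan hwJ ξ)
    rw [hqq] at h7
    exact h7
  rw [eq_top_iff]
  intro v _
  have h1 : q v = v - D.starProjection v := Submodule.starProjection_orthogonal_val _
  rw [hq0] at h1
  have h2 : D.starProjection v = v := (sub_eq_zero.1 h1.symm).symm
  exact Submodule.starProjection_eq_self_iff.1 h2

end Factor

/-! ## The isometry of the GNS space given by a state-preserving endomorphism -/

namespace NormalState

variable {H : Type*} [NormedAddCommGroup H] [InnerProductSpace ℂ H] [CompleteSpace H]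
  {M : VonNeumannAlgebra H} (φ : M.NormalState)

/-- The class of `x` in `L²`. -/
def hat (x : M) : φ.L2 := ((φ.toPositiveLinearMap.toPreGNS x : φ.toPositiveLinearMap.PreGNS) : φ.L2)

lemma rep_hat (a x : M) : φ.rep a (φ.hat x) = φ.hat (a * x) := by
  change φ.toPositiveLinearMap.gnsNonUnitalStarAlgHom a _ = _
  rw [hat, PositiveLinearMap.gnsNonUnitalStarAlgHom_apply_coe]
  rfl

lemma rep_cyclic (x : M) : φ.rep x φ.cyclic = φ.hat x := by
  change φ.rep x (φ.hat 1) = _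
  rw [rep_hat, mul_one]

lemma inner_hat (x y : M) : ⟪φ.hat x, φ.hat y⟫_ℂ = φ.toPositiveLinearMap (star x * y) := by
  rw [hat, hat, Completion.inner_coe]
  rfl

lemma denseRange_hat : DenseRange φ.hat :=
  Completion.denseRange_coe.comp φ.toPositiveLinearMap.toPreGNS.surjective.denseRange
    (Completion.continuous_coe _)

lemma span_hat : (Submodule.span ℂ (Set.range φ.hat)).topologicalClosure = ⊤ :=
  Submodule.dense_iff_topologicalClosure_eq_top.1
    (φ.denseRange_hat.mono (Submodule.subset_span))

variable {θ : M →⋆ₐ[ℂ] M} (hφ : ∀ x, φ.toPositiveLinearMap (θ x) = φ.toPositiveLinearMap x)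

include hφ in
lemma norm_hat_map (x : M) : ‖φ.hat (θ x)‖ = ‖φ.hat x‖ := by
  refine (sq_eq_sq₀ (norm_nonneg _) (norm_nonneg _)).1 ?_
  rw [← @inner_self_eq_norm_sq ℂ, ← @inner_self_eq_norm_sq ℂ, inner_hat, inner_hat, ← map_star,
    ← map_mul, hφ]

/-- The isometry `x̂ ↦ θ(x)^` of `L²`. -/
def isom : φ.L2 →L[ℂ] φ.L2 :=
  (LinearMap.mkContinuous (φ.toPositiveLinearMap.toPreGNS.toLinearMap ∘ₗ
    (θ : M →ₗ[ℂ] M) ∘ₗ φ.toPositiveLinearMap.ofPreGNS.toLinearMap) 1 (fun x => by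
      rw [one_mul]
      have := φ.norm_hat_map hφ (φ.toPositiveLinearMap.ofPreGNS x)
      rw [hat, hat, Completion.norm_coe, Completion.norm_coe] at this
      exact this.le)).completion

lemma isom_hat (x : M) : φ.isom hφ (φ.hat x) = φ.hat (θ x) := by
  rw [isom, hat, ContinuousLinearMap.completion_apply_coe]
  rfl

lemma isom_cyclic : φ.isom hφ φ.cyclic = φ.cyclic := by
  change φ.isom hφ (φ.hat 1) = φ.hat 1
  rw [isom_hat, _root_.map_one]

lemma inner_isom (ξ η : φ.L2) : ⟪φ.isom hφ ξ, φ.isom hφ η⟫_ℂ = ⟪ξ, η⟫_ℂ := by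
  refine isClosed_property2 φ.denseRange_hat
    (p := fun ξ η => ⟪φ.isom hφ ξ, φ.isom hφ η⟫_ℂ = ⟪ξ, η⟫_ℂ)
    (isClosed_eq (by fun_prop) (by fun_prop)) (fun x y => ?_) ξ η
  rw [isom_hat, isom_hat, inner_hat, inner_hat, ← map_star, ← map_mul, hφ]

lemma isom_mem_intertwiners :
    φ.isom hφ ∈ intertwiners (fun a => φ.rep a) (fun a => φ.rep (θ a)) := by
  intro a
  ext1 ξ
  refine isClosed_property φ.denseRange_hat (isClosed_eq (by fun_prop) (by fun_prop))
    (fun x => ?_) ξ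
  simp only [mul_apply_eq_comp, rep_hat, isom_hat, map_mul]

include φ in
lemma nontrivial : Nontrivial H := by
  by_contra hcon
  rw [not_nontrivial_iff_subsingleton] at hcon
  have h1 : (1 : M) = 0 := Subtype.ext (ContinuousLinearMap.ext fun v => Subsingleton.elim _ _)
  have := φ.map_one
  rw [h1, map_zero] at this
  exact zero_ne_one this

/-- For a normal state-preserving endomorphism of a factor, the ranges of the intertwiners
`u (λ x) = λ (θ x) u` span `L²`. -/
lemma interSpan_eq_top (hM : M.IsFactor) (hθ : IsNormalMap θ) :
    interSpan (fun a => φ.rep a) (fun a => φ.rep (θ a)) = ⊤ := by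
  have h10 : φ.hat 1 ≠ 0 := fun h => by
    have h1 : ‖φ.hat 1‖ = 1 := φ.norm_cyclic
    rw [h, norm_zero] at h1
    exact zero_ne_one h1
  refine hM.interSpan_eq_top φ.rep (φ.rep.comp θ) h10 ?_ φ.denseRange_hat fun x => ?_
  · refine Eq.mp (congrArg _ (funext fun a => ?_)) φ.normal
    rw [rep_hat, inner_hat, star_one, one_mul, mul_one]
  -- The vector functional of the class of `x` is `a ↦ φ (x* θ(a) x)`; normality of `θ` is used
  -- here.
  · refine Eq.mp (congrArg _ (funext fun a => ?_)) (hθ _ (φ.normal.conj (star x) x))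
    rw [StarAlgHom.comp_apply, rep_hat, inner_hat, Function.comp_apply, mul_assoc]

end NormalState

end VonNeumannAlgebra

end

noncomputable section

/-! ## Operators on spaces spanned by vectors with prescribed inner products -/

namespace PDKernel

variable {X F : Type*} (k : PDKernel X) [NormedAddCommGroup F] [InnerProductSpace ℂ F]

lemma span_vec : (Submodule.span ℂ (Set.range k.vec)).topologicalClosure = ⊤ := by
  rw [← Submodule.dense_iff_topologicalClosure_eq_top]
  refine Completion.denseRange_coe.mono ?_
  rintro _ ⟨c, rfl⟩
  have h1 : ∀ c : X →₀ ℂ, ((k.toPre c : k.Pre) : k.Space) ∈ Submodule.span ℂ (Set.range k.vec) := by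
    intro c
    induction c using Finsupp.induction_linear with
    | zero =>
      rw [map_zero, Completion.coe_zero]
      exact zero_mem _
    | add a b ha hb =>
      rw [map_add, Completion.coe_add]
      exact add_mem ha hb
    | single x r =>
      have : (Finsupp.single x r : X →₀ ℂ) = r • Finsupp.single x 1 := by simp
      rw [this, map_smul, Completion.coe_smul]
      exact Submodule.smul_mem _ _ (Submodule.subset_span ⟨x, rfl⟩)
  exact h1 (k.ofPre c)

variable {k}

lemma clm_ext {f g : k.Space →L[ℂ] F} (h : ∀ x, f (k.vec x) = g (k.vec x)) : f = g := by
  refine ContinuousLinearMap.ext_on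
    (Submodule.dense_iff_topologicalClosure_eq_top.2 k.span_vec) ?_
  rintro _ ⟨x, rfl⟩
  exact h x

lemma ext_inner_vec {v w : k.Space} (h : ∀ x, ⟪k.vec x, v⟫_ℂ = ⟪k.vec x, w⟫_ℂ) : v = w := by
  have h1 : innerSL ℂ v = innerSL ℂ w := clm_ext fun x => by
    change ⟪v, k.vec x⟫_ℂ = ⟪w, k.vec x⟫_ℂ
    rw [← inner_conj_symm, h, inner_conj_symm]
  refine ext_inner_right ℂ fun u => congrArg (fun f => f u) h1

lemma star_eq_of_inner_vec {f g : k.Space →L[ℂ] k.Space}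
    (h : ∀ x y, ⟪f (k.vec x), k.vec y⟫_ℂ = ⟪k.vec x, g (k.vec y)⟫_ℂ) : star f = g := by
  refine clm_ext fun y => ext_inner_vec fun x => ?_
  rw [← h, ContinuousLinearMap.star_eq_adjoint, ContinuousLinearMap.adjoint_inner_right]

lemma exists_isometry (v : X → k.Space) (h : ∀ x y, ⟪v x, v y⟫_ℂ = k.toMatrix x y) :
    ∃ V : k.Space →L[ℂ] k.Space, (∀ x, V (k.vec x) = v x) ∧ star V * V = 1 := by
  have h1 : (((1 : ℝ) : ℂ) ^ 2 • k.toMatrix - Matrix.gram ℂ v) = 0 := by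
    ext x y
    simp [Matrix.gram_apply, h]
  have h2 := k.extend_vec v 1 zero_le_one (h1 ▸ Matrix.PosSemidef.zero)
  refine ⟨_, h2, clm_ext fun y => ext_inner_vec fun x => ?_⟩
  rw [mul_apply_eq_comp, ContinuousLinearMap.star_eq_adjoint,
    ContinuousLinearMap.adjoint_inner_right, h2, h2, h, one_apply_eq_self, inner_vec]

end PDKernel

/-! ## Operators on tensor products -/

section Tensor

variable {ι : Type*} {E : ι → Type*} [∀ i, NormedAddCommGroup (E i)]
  [∀ i, InnerProductSpace ℂ (E i)] {Ω : ∀ i, E i} (hΩ : ∀ i, ‖Ω i‖ = 1)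

open Classical in
/-- Change one of the vectors of a family. -/
def TensorIndex.update (ξ : TensorIndex Ω) (j : ι) (a : E j) : TensorIndex Ω :=
  ⟨Function.update ξ.1 j a, (ξ.2.union (Set.finite_singleton j)).subset fun i hi => by
    by_cases h : i = j
    · exact Or.inr h
    · exact Or.inl (by simpa [Function.update_of_ne h] using hi)⟩

lemma TensorIndex.update_self (ξ : TensorIndex Ω) (j : ι) : ξ.update j (ξ.1 j) = ξ :=
  Subtype.ext (by simp [TensorIndex.update])

lemma TensorIndex.update_apply (ξ : TensorIndex Ω) (j : ι) (a : E j) : (ξ.update j a).1 j = a := by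
  simp [TensorIndex.update]

lemma TensorIndex.update_update (ξ : TensorIndex Ω) (j : ι) (a b : E j) :
    (ξ.update j a).update j b = ξ.update j b :=
  Subtype.ext (by simp [TensorIndex.update])

/-- The inner product factors into that of slot `j` and a constant from the other slots. Linearity
and continuity of elementary tensors in each vector follow from this. -/
lemma exists_inner_tensorVec_update (ξ η : TensorIndex Ω) (j : ι) : ∃ c : ℂ, ∀ a b : E j,
    ⟪tensorVec hΩ (ξ.update j a), tensorVec hΩ (η.update j b)⟫_ℂ = ⟪a, b⟫_ℂ * c := by
  classical
  let F : Finset ι := insert j (ξ.2.toFinset ∪ η.2.toFinset)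
  have hF : ∀ ζ : TensorIndex Ω, (ζ = ξ ∨ ζ = η) → ∀ a i, (ζ.update j a).1 i ≠ Ω i → i ∈ F := by
    intro ζ hζ a i hi
    by_cases h : i = j
    · simp [F, h]
    · have h1 : ζ.1 i ≠ Ω i := by
        simpa [TensorIndex.update, Function.update_of_ne h] using hi
      rcases hζ with rfl | rfl <;> simp [F, h1]
  refine ⟨∏ i ∈ F.erase j, ⟪ξ.1 i, η.1 i⟫_ℂ, fun a b => ?_⟩
  rw [inner_tensorVec, finprod_inner_eq hΩ (hF ξ (Or.inl rfl) a) (hF η (Or.inr rfl) b),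
    ← Finset.mul_prod_erase F _ (Finset.mem_insert_self _ _), TensorIndex.update_apply,
    TensorIndex.update_apply]
  congr 1
  refine Finset.prod_congr rfl fun i hi => ?_
  have h := Finset.ne_of_mem_erase hi
  simp [TensorIndex.update, Function.update_of_ne h]

/-- The elementary tensor as a function of one of its vectors. -/
def tensorLin (ξ : TensorIndex Ω) (j : ι) : E j →L[ℂ] TensorSpace hΩ :=
  LinearMap.mkContinuousOfExistsBound
    { toFun := fun a => tensorVec hΩ (ξ.update j a)
      map_add' := fun a b => PDKernel.ext_inner_vec fun η => by
        obtain ⟨c, hc⟩ := exists_inner_tensorVec_update hΩ η ξ j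
        have h1 := hc (η.1 j)
        rw [η.update_self] at h1
        rw [inner_add_right]
        refine (h1 _).trans ?_
        rw [inner_add_right, add_mul, ← h1, ← h1]
        rfl
      map_smul' := fun r a => PDKernel.ext_inner_vec fun η => by
        obtain ⟨c, hc⟩ := exists_inner_tensorVec_update hΩ η ξ j
        have h1 := hc (η.1 j)
        rw [η.update_self] at h1
        rw [inner_smul_right]
        refine (h1 _).trans ?_
        rw [inner_smul_right, mul_assoc, ← h1]
        rfl }
    (by
      obtain ⟨c, hc⟩ := exists_inner_tensorVec_update hΩ ξ ξ j
      refine ⟨√‖c‖, fun a => ?_⟩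
      refine (sq_le_sq₀ (norm_nonneg _) (by positivity)).1 ?_
      have h1 := congrArg norm (hc a a)
      rw [norm_mul, inner_self_eq_norm_sq_to_K, inner_self_eq_norm_sq_to_K] at h1
      simp only [norm_pow, RCLike.norm_ofReal, abs_norm] at h1
      rw [mul_pow, Real.sq_sqrt (norm_nonneg _), mul_comm]
      exact h1.le)

lemma tensorLin_apply (ξ : TensorIndex Ω) (j : ι) (a : E j) :
    tensorLin hΩ ξ j a = tensorVec hΩ (ξ.update j a) := rfl

/-- Induction on the number of vectors that differ from the distinguished ones. -/
lemma tensorSpace_induction {Q : Submodule ℂ (TensorSpace hΩ)}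
    (hQ : IsClosed (Q : Set (TensorSpace hΩ))) (h0 : tensorUnit hΩ ∈ Q)
    (hstep : ∀ (ξ : TensorIndex Ω) (j : ι), tensorVec hΩ (ξ.update j (Ω j)) ∈ Q →
      ∀ a, tensorVec hΩ (ξ.update j a) ∈ Q) : Q = ⊤ := by
  classical
  have h1 : ∀ (F : Finset ι) (ξ : TensorIndex Ω), (∀ i, ξ.1 i ≠ Ω i → i ∈ F) →
      tensorVec hΩ ξ ∈ Q := by
    intro F
    induction F using Finset.induction_on with
    | empty =>
      intro ξ hξ
      have : ξ = tensorIndexUnit Ω := Subtype.ext (funext fun i => by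
        by_contra h
        simpa using hξ i h)
      rw [this]
      exact h0
    | insert j F hj ih =>
      intro ξ hξ
      rw [← ξ.update_self j]
      refine hstep ξ j (ih _ fun i hi => ?_) _
      by_cases h : i = j
      · subst h
        exact absurd (ξ.update_apply i (Ω i)) hi
      · have h1 : ξ.1 i ≠ Ω i := by
          simpa [TensorIndex.update, Function.update_of_ne h] using hi
        exact Finset.mem_of_mem_insert_of_ne (hξ i h1) h
  rw [eq_top_iff, ← PDKernel.span_vec]
  refine Submodule.topologicalClosure_minimal _ (Submodule.span_le.2 ?_) hQ
  rintro _ ⟨ξ, rfl⟩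
  exact h1 ξ.2.toFinset ξ fun i hi => by simpa using hi

lemma tensorOp_congr {A B : ∀ i, E i →L[ℂ] E i} (h : A = B) (hA : {i | A i ≠ 1}.Finite)
    (hB : {i | B i ≠ 1}.Finite) : tensorOp hΩ A hA = tensorOp hΩ B hB := by
  subst h
  rfl

lemma tensorOp_mul (A B : ∀ i, E i →L[ℂ] E i) (hA : {i | A i ≠ 1}.Finite)
    (hB : {i | B i ≠ 1}.Finite) (hAB : {i | A i * B i ≠ 1}.Finite) :
    tensorOp hΩ A hA * tensorOp hΩ B hB = tensorOp hΩ (fun i => A i * B i) hAB := by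
  refine PDKernel.clm_ext fun ξ => ?_
  change tensorOp hΩ A hA (tensorOp hΩ B hB (tensorVec hΩ ξ)) = tensorOp hΩ _ hAB (tensorVec hΩ ξ)
  rw [tensorOp_tensorVec, tensorOp_tensorVec, tensorOp_tensorVec]
  rfl

lemma star_tensorOp [∀ i, CompleteSpace (E i)] (A : ∀ i, E i →L[ℂ] E i)
    (hA : {i | A i ≠ 1}.Finite) (hA' : {i | star (A i) ≠ 1}.Finite) :
    star (tensorOp hΩ A hA) = tensorOp hΩ (fun i => star (A i)) hA' := by
  refine PDKernel.star_eq_of_inner_vec fun ξ η => ?_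
  change ⟪tensorOp hΩ A hA (tensorVec hΩ ξ), tensorVec hΩ η⟫_ℂ =
    ⟪tensorVec hΩ ξ, tensorOp hΩ _ hA' (tensorVec hΩ η)⟫_ℂ
  rw [tensorOp_tensorVec, tensorOp_tensorVec, inner_tensorVec, inner_tensorVec]
  refine finprod_congr fun i => ?_
  change ⟪A i (ξ.1 i), η.1 i⟫_ℂ = ⟪ξ.1 i, star (A i) (η.1 i)⟫_ℂ
  rw [ContinuousLinearMap.star_eq_adjoint, ContinuousLinearMap.adjoint_inner_right]

open Classical in
lemma finite_update_one (j : ι) (y : E j →L[ℂ] E j) :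
    {i | Function.update (1 : ∀ i, E i →L[ℂ] E i) j y i ≠ 1}.Finite :=
  (Set.finite_singleton j).subset fun i hi => by
    by_contra h
    exact hi (Function.update_of_ne h _ _)

open Classical in
/-- The operator on the tensor product given by an operator on one of the factors. -/
def slotOp (j : ι) (y : E j →L[ℂ] E j) : TensorSpace hΩ →L[ℂ] TensorSpace hΩ :=
  tensorOp hΩ (Function.update (1 : ∀ i, E i →L[ℂ] E i) j y) (finite_update_one j y)

lemma slotOp_tensorVec (j : ι) (y : E j →L[ℂ] E j) (ξ : TensorIndex Ω) :
    slotOp hΩ j y (tensorVec hΩ ξ) = tensorVec hΩ (ξ.update j (y (ξ.1 j))) := by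
  classical
  rw [slotOp, tensorOp_tensorVec]
  congr 1
  refine Subtype.ext (funext fun i => ?_)
  change (Function.update (1 : ∀ i, E i →L[ℂ] E i) j y i) (ξ.1 i) = Function.update ξ.1 j (y (ξ.1 j)) i
  by_cases h : i = j
  · subst h
    simp
  · simp [Function.update_of_ne h]

lemma slotOp_tensorVec_update (j : ι) (y : E j →L[ℂ] E j) (ξ : TensorIndex Ω) (a : E j) :
    slotOp hΩ j y (tensorVec hΩ (ξ.update j a)) = tensorVec hΩ (ξ.update j (y a)) := by
  rw [slotOp_tensorVec, TensorIndex.update_apply, TensorIndex.update_update]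

lemma slotOp_add (j : ι) (y y' : E j →L[ℂ] E j) :
    slotOp hΩ j (y + y') = slotOp hΩ j y + slotOp hΩ j y' := by
  refine PDKernel.clm_ext fun ξ => ?_
  change slotOp hΩ j (y + y') (tensorVec hΩ ξ) =
    slotOp hΩ j y (tensorVec hΩ ξ) + slotOp hΩ j y' (tensorVec hΩ ξ)
  simp only [slotOp_tensorVec, ← tensorLin_apply, ← map_add]
  rfl

lemma slotOp_smul (j : ι) (c : ℂ) (y : E j →L[ℂ] E j) :
    slotOp hΩ j (c • y) = c • slotOp hΩ j y := by
  refine PDKernel.clm_ext fun ξ => ?_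
  change slotOp hΩ j (c • y) (tensorVec hΩ ξ) = c • slotOp hΩ j y (tensorVec hΩ ξ)
  simp only [slotOp_tensorVec, ← tensorLin_apply]
  exact map_smul (tensorLin hΩ ξ j) c (y (ξ.1 j))

lemma slotOp_mul_tensorOp_comm (j : ι) (y : E j →L[ℂ] E j) (A : ∀ i, E i →L[ℂ] E i)
    (hA : {i | A i ≠ 1}.Finite) (h : y * A j = A j * y) :
    slotOp hΩ j y * tensorOp hΩ A hA = tensorOp hΩ A hA * slotOp hΩ j y := by
  classical
  refine PDKernel.clm_ext fun ξ => ?_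
  change slotOp hΩ j y (tensorOp hΩ A hA (tensorVec hΩ ξ)) =
    tensorOp hΩ A hA (slotOp hΩ j y (tensorVec hΩ ξ))
  rw [tensorOp_tensorVec, slotOp_tensorVec, slotOp_tensorVec, tensorOp_tensorVec]
  congr 1
  refine Subtype.ext (funext fun i => ?_)
  change Function.update (fun i => A i (ξ.1 i)) j (y (A j (ξ.1 j))) i =
    A i (Function.update ξ.1 j (y (ξ.1 j)) i)
  by_cases hi : i = j
  · subst hi
    rw [Function.update_self, Function.update_self]
    exact congrArg (fun r => r (ξ.1 i)) h
  · rw [Function.update_of_ne hi, Function.update_of_ne hi]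

/-- The tensor product of isometries that fix the distinguished vectors. -/
lemma exists_tensorIsometry (V : ∀ i, E i →L[ℂ] E i) (hV : ∀ i, V i (Ω i) = Ω i)
    (hVi : ∀ i ξ η, ⟪V i ξ, V i η⟫_ℂ = ⟪ξ, η⟫_ℂ) :
    ∃ W : TensorSpace hΩ →L[ℂ] TensorSpace hΩ, star W * W = 1 ∧
      W (tensorUnit hΩ) = tensorUnit hΩ ∧
      ∀ (A B : ∀ i, E i →L[ℂ] E i) (hA : {i | A i ≠ 1}.Finite) (hB : {i | B i ≠ 1}.Finite),
        (∀ i ξ, V i (A i ξ) = B i (V i ξ)) → W * tensorOp hΩ A hA = tensorOp hΩ B hB * W := by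
  let m : TensorIndex Ω → TensorIndex Ω := fun ξ =>
    ⟨fun i => V i (ξ.1 i), ξ.2.subset fun i hi h => hi (by
      change V i (ξ.1 i) = _
      rw [h, hV])⟩
  obtain ⟨W, hW, hW1⟩ := PDKernel.exists_isometry (k := tensorKernel hΩ)
    (fun ξ => tensorVec hΩ (m ξ)) (fun ξ η => by
      rw [inner_tensorVec]
      exact finprod_congr fun i => hVi i _ _)
  refine ⟨W, hW1, (hW _).trans ?_, fun A B hA hB h => PDKernel.clm_ext fun ξ => ?_⟩
  · exact congrArg (tensorVec hΩ) (Subtype.ext (funext hV))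
  · change W (tensorOp hΩ A hA (tensorVec hΩ ξ)) = tensorOp hΩ B hB (W (tensorVec hΩ ξ))
    rw [tensorOp_tensorVec]
    refine (hW _).trans ?_
    refine Eq.trans ?_ (congrArg (tensorOp hΩ B hB) (hW ξ)).symm
    rw [tensorOp_tensorVec]
    exact congrArg (tensorVec hΩ) (Subtype.ext (funext fun i => h i _))

end Tensor

end

noncomputable section

/-! ## Cyclic subspaces -/

namespace VonNeumannAlgebra

section Cyclic

variable {L X : Type*} [NormedAddCommGroup L] [InnerProductSpace ℂ L] [CompleteSpace L]

/-- The subspace `S Ω`. -/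
def cyclicSubspace (S : VonNeumannAlgebra L) (Ω : L) : Submodule ℂ L where
  carrier := {v | ∃ a ∈ S, v = a Ω}
  add_mem' := by
    rintro _ _ ⟨a, ha, rfl⟩ ⟨b, hb, rfl⟩
    exact ⟨a + b, add_mem ha hb, rfl⟩
  zero_mem' := ⟨0, zero_mem _, rfl⟩
  smul_mem' := by
    rintro c _ ⟨a, ha, rfl⟩
    exact ⟨c • a, SMulMemClass.smul_mem c ha, rfl⟩

lemma self_mem_cyclicSubspace (S : VonNeumannAlgebra L) (Ω : L) : Ω ∈ cyclicSubspace S Ω :=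
  ⟨1, one_mem _, rfl⟩

lemma map_mem_closure_cyclicSubspace {S : VonNeumannAlgebra L} {Ω : L} {a : L →L[ℂ] L}
    (ha : a ∈ S) {v : L} (hv : v ∈ (cyclicSubspace S Ω).topologicalClosure) :
    a v ∈ (cyclicSubspace S Ω).topologicalClosure := by
  have h1 : cyclicSubspace S Ω ≤ (cyclicSubspace S Ω).topologicalClosure.comap a.toLinearMap := by
    rintro _ ⟨b, hb, rfl⟩
    exact Submodule.le_topologicalClosure _ ⟨a * b, mul_mem ha hb, rfl⟩
  exact Submodule.topologicalClosure_minimal _ h1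
    ((Submodule.isClosed_topologicalClosure _).preimage a.continuous) hv

omit [CompleteSpace L] in
lemma apply_mem_interSpan {g h : X → L →L[ℂ] L} (x : X) {v : L} (hv : v ∈ interSpan g h) :
    h x v ∈ interSpan g h :=
  map_interSpan (fun R hR ξ => by
    have h2 : h x (R ξ) = R (g x ξ) := (congrArg (fun r => r ξ) (hR x)).symm
    rw [h2]
    exact mem_interSpan hR _) hv

lemma exists_star_pair {A : Type*} [Semiring A] [Star A] [Algebra ℂ A]
    (π : A →⋆ₐ[ℂ] (L →L[ℂ] L)) (θ : A →⋆ₐ[ℂ] A) (a : A) :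
    ∃ a', π a' = star (π a) ∧ π (θ a') = star (π (θ a)) :=
  ⟨star a, map_star _ a, by rw [map_star, map_star]⟩

lemma star_apply_of_inner {V : L →L[ℂ] L} (hV : ∀ ξ η, ⟪V ξ, V η⟫_ℂ = ⟪ξ, η⟫_ℂ) (ξ : L) :
    star V (V ξ) = ξ := by
  refine ext_inner_left ℂ fun ζ => ?_
  rw [ContinuousLinearMap.star_eq_adjoint, ContinuousLinearMap.adjoint_inner_right, hV]

end Cyclic

end VonNeumannAlgebra

end

noncomputable section

/-! ## Tensor products of representations -/

section TensorRep

variable {ι : Type*} {A : ι → Type*} [∀ i, Ring (A i)]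

open Classical in
/-- Change one of the elements of a family. -/
def updateFamily (x : {x : ∀ i, A i // {i | x i ≠ 1}.Finite}) (j : ι) (a : A j) :
    {x : ∀ i, A i // {i | x i ≠ 1}.Finite} :=
  ⟨Function.update x.1 j a, (x.2.union (Set.finite_singleton j)).subset fun i hi => by
    by_cases h : i = j
    · exact Or.inr h
    · exact Or.inl (by simpa [Function.update_of_ne h] using hi)⟩

lemma updateFamily_self (x : {x : ∀ i, A i // {i | x i ≠ 1}.Finite}) (j : ι) (a : A j) :
    (updateFamily x j a).1 j = a := by
  simp [updateFamily]

lemma updateFamily_of_ne (x : {x : ∀ i, A i // {i | x i ≠ 1}.Finite}) {i j : ι} (h : i ≠ j)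
    (a : A j) : (updateFamily x j a).1 i = x.1 i := by
  classical exact Function.update_of_ne h _ _

/-- The family whose only nontrivial element is `a`. -/
def singleFamily (j : ι) (a : A j) : {x : ∀ i, A i // {i | x i ≠ 1}.Finite} :=
  updateFamily ⟨fun _ => 1, by simp⟩ j a

lemma singleFamily_self (j : ι) (a : A j) : (singleFamily j a).1 j = a := updateFamily_self _ _ _

lemma singleFamily_of_ne {i j : ι} (h : i ≠ j) (a : A j) : (singleFamily j a).1 i = 1 :=
  updateFamily_of_ne _ h _

variable [∀ i, StarRing (A i)] [∀ i, Algebra ℂ (A i)]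
  {E : ι → Type*} [∀ i, NormedAddCommGroup (E i)] [∀ i, InnerProductSpace ℂ (E i)]
  [∀ i, CompleteSpace (E i)] {Ω : ∀ i, E i} (hΩ : ∀ i, ‖Ω i‖ = 1)
  (π : ∀ i, A i →⋆ₐ[ℂ] (E i →L[ℂ] E i))

/-- The operator `⊗ π i (x i)`. -/
def tensorRep (x : {x : ∀ i, A i // {i | x i ≠ 1}.Finite}) :
    TensorSpace hΩ →L[ℂ] TensorSpace hΩ :=
  tensorOp hΩ (fun i => π i (x.1 i)) (x.2.subset fun i hi h => hi (by simp [h]))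

lemma tensorRep_single (j : ι) (a : A j) :
    tensorRep hΩ π (singleFamily j a) = slotOp hΩ j (π j a) := by
  classical
  refine tensorOp_congr _ (funext fun i => ?_) _ _
  by_cases h : i = j
  · subst h
    rw [singleFamily_self, Function.update_self]
  · rw [singleFamily_of_ne h, Function.update_of_ne h, map_one]
    rfl

/-- Splits off one slot, for inductions over the finite set of nontrivial slots. -/
lemma tensorRep_eq_mul (x : {x : ∀ i, A i // {i | x i ≠ 1}.Finite}) (j : ι) :
    tensorRep hΩ π x = tensorRep hΩ π (singleFamily j (x.1 j)) *
      tensorRep hΩ π (updateFamily x j 1) := by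
  have h1 : (fun i => π i ((singleFamily j (x.1 j)).1 i) * π i ((updateFamily x j 1).1 i)) =
      fun i => π i (x.1 i) := by
    funext i
    by_cases h : i = j
    · subst h
      rw [singleFamily_self, updateFamily_self, map_one, mul_one]
    · rw [singleFamily_of_ne h, updateFamily_of_ne _ h, map_one, one_mul]
  rw [tensorRep, tensorRep, tensorRep, tensorOp_mul _ _ _ _ _ (x.2.subset fun i hi h => hi
    ((congrFun h1 i).trans (by rw [h, map_one])))]
  exact tensorOp_congr _ h1.symm _ _

variable {θ : ∀ i, A i →⋆ₐ[ℂ] A i}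

variable (θ) in
/-- The family `(θ i (x i))`. -/
def mapFamily (x : {x : ∀ i, A i // {i | x i ≠ 1}.Finite}) :
    {x : ∀ i, A i // {i | x i ≠ 1}.Finite} :=
  ⟨fun i => θ i (x.1 i), x.2.subset fun i hi h => hi (by simp [h])⟩

lemma mapFamily_single (j : ι) (a : A j) :
    mapFamily θ (singleFamily j a) = singleFamily j (θ j a) := by
  refine Subtype.ext (funext fun i => ?_)
  change θ i ((singleFamily j a).1 i) = _
  by_cases h : i = j
  · subst h
    rw [singleFamily_self, singleFamily_self]
  · rw [singleFamily_of_ne h, singleFamily_of_ne h, map_one]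

lemma exists_star_tensorRep (x : {x : ∀ i, A i // {i | x i ≠ 1}.Finite}) :
    ∃ x', tensorRep hΩ π x' = star (tensorRep hΩ π x) ∧
      tensorRep hΩ π (mapFamily θ x') = star (tensorRep hΩ π (mapFamily θ x)) := by
  have h1 : {i | star (x.1 i) ≠ 1}.Finite := x.2.subset fun i hi h => hi (by simp [h])
  have h2 : ∀ {y : ∀ i, A i} (hy : {i | y i ≠ 1}.Finite) (hy' : {i | star (y i) ≠ 1}.Finite),
      tensorRep hΩ π ⟨fun i => star (y i), hy'⟩ = star (tensorRep hΩ π ⟨y, hy⟩) := by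
    intro y hy hy'
    rw [tensorRep, tensorRep, star_tensorOp _ _ _ (hy'.subset fun i hi h => hi (by
      rw [← map_star]
      exact (congrArg (π i) h).trans (map_one _)))]
    exact tensorOp_congr _ (funext fun i => map_star (π i) (y i)) _ _
  refine ⟨⟨fun i => star (x.1 i), h1⟩, h2 _ _, ?_⟩
  rw [← h2 _ ((mapFamily θ x).2.subset fun i hi h => hi (by simp [h]))]
  congr 1
  exact Subtype.ext (funext fun i => map_star (θ i) (x.1 i))

/-- The elementary tensors of self-adjoint elements generate all elementary tensors. -/
lemma tensorRep_mem_adjoin [∀ i, StarModule ℂ (A i)]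
    (x : {x : ∀ i, A i // {i | x i ≠ 1}.Finite}) : tensorRep hΩ π x ∈
    StarAlgebra.adjoin ℂ (tensorRep hΩ π '' {x | ∀ i, IsSelfAdjoint (x.1 i)}) := by
  classical
  generalize hS : StarAlgebra.adjoin ℂ (tensorRep hΩ π '' {x | ∀ i, IsSelfAdjoint (x.1 i)}) = S
  have h1 : ∀ x : {x : ∀ i, A i // {i | x i ≠ 1}.Finite}, (∀ i, IsSelfAdjoint (x.1 i)) →
      tensorRep hΩ π x ∈ S := fun x hx => hS ▸ StarAlgebra.subset_adjoin ℂ _ ⟨x, hx, rfl⟩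
  have h2 : ∀ j (a : A j), IsSelfAdjoint a → slotOp hΩ j (π j a) ∈ S := by
    intro j a ha
    rw [← tensorRep_single]
    refine h1 _ fun i => ?_
    by_cases h : i = j
    · subst h
      rwa [singleFamily_self]
    · rw [singleFamily_of_ne h]
      exact .one _
  have h3 : ∀ j (a : A j), slotOp hΩ j (π j a) ∈ S := by
    intro j a
    -- Linearity in a single slot allows the passage from self-adjoint elements to arbitrary ones;
    -- products over the slots then give all elementary tensors.
    rw [← realPart_add_I_smul_imaginaryPart a, map_add, map_smul, slotOp_add, slotOp_smul]
    exact add_mem (h2 j _ (realPart a).2) (S.smul_mem (h2 j _ (imaginaryPart a).2) Complex.I)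
  have h5 : ∀ (F : Finset ι) (x : {x : ∀ i, A i // {i | x i ≠ 1}.Finite}),
      (∀ i, x.1 i ≠ 1 → i ∈ F) → tensorRep hΩ π x ∈ S := by
    intro F
    induction F using Finset.induction_on with
    | empty =>
      intro x hx
      refine h1 x fun i => ?_
      have : x.1 i = 1 := by
        by_contra h
        simpa using hx i h
      rw [this]
      exact .one _
    | insert j F hj ih =>
      intro x hx
      rw [tensorRep_eq_mul hΩ π x j, tensorRep_single]
      refine mul_mem (h3 j _) (ih _ fun i hi => ?_)
      by_cases h : i = j
      · subst h
        exact absurd (updateFamily_self _ _ _) hi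
      · rw [updateFamily_of_ne _ h] at hi
        exact Finset.mem_of_mem_insert_of_ne (hx i hi) h
  exact h5 x.2.toFinset x fun i hi => by simpa using hi

open VonNeumannAlgebra

variable (hc : ∀ i, (Submodule.span ℂ (Set.range fun a => π i a (Ω i))).topologicalClosure = ⊤)
include hc

/-- Cyclicity slot by slot: an element of `A j` turns `Ω j` in slot `j` into `π j x (Ω j)`, and
these vectors are total. -/
lemma dense_tensorRep_unit : Dense {v | ∃ a ∈ generatedBy (Set.range (tensorRep hΩ π)),
    v = a (tensorUnit hΩ)} := by
  let D := cyclicSubspace (generatedBy (Set.range (tensorRep hΩ π))) (tensorUnit hΩ)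
  have htop : D.topologicalClosure = ⊤ := by
    refine tensorSpace_induction _ D.isClosed_topologicalClosure
      (D.le_topologicalClosure (self_mem_cyclicSubspace _ _)) ?_
    intro ξ j hξ a
    refine Submodule.map_mem_of_dense D.isClosed_topologicalClosure (tensorLin hΩ ξ j) (hc j) ?_ a
    rintro _ ⟨x, rfl⟩
    rw [tensorLin_apply, ← slotOp_tensorVec_update, ← tensorRep_single]
    exact map_mem_closure_cyclicSubspace
      (subset_generatedBy _ (Set.mem_range_self (singleFamily j x))) hξ
  exact Submodule.dense_iff_topologicalClosure_eq_top.2 htop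

omit hc in
lemma exists_tensorRep_intertwiner {V : ∀ i, E i →L[ℂ] E i} (hV : ∀ i, V i (Ω i) = Ω i)
    (hVi : ∀ i ξ η, ⟪V i ξ, V i η⟫_ℂ = ⟪ξ, η⟫_ℂ)
    (hVθ : ∀ i, V i ∈ intertwiners (fun a => π i a) (fun a => π i (θ i a))) :
    ∃ W ∈ intertwiners (tensorRep hΩ π) (fun x => tensorRep hΩ π (mapFamily θ x)),
      star W * W = 1 ∧ W (tensorUnit hΩ) = tensorUnit hΩ := by
  obtain ⟨W, hW1, hWΩ, hW⟩ := exists_tensorIsometry hΩ V hV hVi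
  exact ⟨W, fun x => hW _ _ _ _ fun i ξ => congrArg (fun r => r ξ) (hVθ i (x.1 i)), hW1, hWΩ⟩

/-- If the ranges of the intertwiners span each of the spaces, then the ranges of the intertwiners
span the tensor product. -/
lemma tensorRep_interSpan_eq_top {V : ∀ i, E i →L[ℂ] E i} (hV : ∀ i, V i (Ω i) = Ω i)
    (hVi : ∀ i ξ η, ⟪V i ξ, V i η⟫_ℂ = ⟪ξ, η⟫_ℂ)
    (hVθ : ∀ i, V i ∈ intertwiners (fun a => π i a) (fun a => π i (θ i a)))
    (htop : ∀ i, interSpan (fun a => π i a) (fun a => π i (θ i a)) = ⊤) :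
    interSpan (tensorRep hΩ π) (fun x => tensorRep hΩ π (mapFamily θ x)) = ⊤ := by
  obtain ⟨W, hWJ, -, hWΩ⟩ := exists_tensorRep_intertwiner hΩ π hV hVi hVθ
  set Q := interSpan (tensorRep hΩ π) (fun x => tensorRep hΩ π (mapFamily θ x)) with hQ
  have hQc : IsClosed (Q : Set (TensorSpace hΩ)) := isClosed_interSpan
  have hunit : tensorUnit hΩ ∈ Q := by
    have h2 := mem_interSpan hWJ (tensorUnit hΩ)
    rwa [hWΩ] at h2
  -- `Q` is stable under the images themselves and under everything that commutes with them. The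
  -- images turn `Ω j` into a total set of vectors in the range of `V j`; the operators `R V*` of
  -- the commutant then move `V j η` to `R η`, and such vectors are total by `htop`.
  have hcomm : ∀ j (y : E j →L[ℂ] E j), (∀ a, y * π j (θ j a) = π j (θ j a) * y) →
      ∀ v ∈ Q, slotOp hΩ j y v ∈ Q := fun j y hy v hv =>
    map_interSpan (fun R hR ξ => mem_interSpan (mul_mem_intertwiners
      (fun x => slotOp_mul_tensorOp_comm hΩ j y _ _ (hy _)) hR) ξ) hv
  have hrep : ∀ j (a : A j), ∀ v ∈ Q, slotOp hΩ j (π j (θ j a)) v ∈ Q := by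
    intro j a v hv
    rw [← tensorRep_single, ← mapFamily_single]
    exact apply_mem_interSpan _ hv
  refine tensorSpace_induction _ hQc hunit fun ξ j hξ a => ?_
  have hisom : ∀ a, tensorLin hΩ ξ j (V j a) ∈ Q := by
    intro a
    refine Submodule.map_mem_of_dense hQc ((tensorLin hΩ ξ j) ∘L V j) (hc j) ?_ a
    rintro _ ⟨x, rfl⟩
    have h1 : V j (π j x (Ω j)) = π j (θ j x) (Ω j) :=
      (congrArg (fun r => r (Ω j)) (hVθ j x)).trans (congrArg (π j (θ j x)) (hV j))
    rw [ContinuousLinearMap.comp_apply, h1, tensorLin_apply, ← slotOp_tensorVec_update]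
    exact hrep j x _ hξ
  refine Submodule.map_mem_of_dense hQc (tensorLin hΩ ξ j) (htop j) ?_ a
  rintro _ ⟨R, hR, η, rfl⟩
  have h1 := hcomm j _ (commute_mul_star (exists_star_pair (π j) (θ j)) hR (hVθ j)) _ (hisom η)
  rw [tensorLin_apply, slotOp_tensorVec_update, mul_apply_eq_comp,
    star_apply_of_inner (hVi j)] at h1
  exact h1

/-- The tensor product of endomorphisms on the tensor product of representations, and its properties
if the ranges of the intertwiners span. -/
theorem existsUnique_tensorRep_hom [∀ i, StarModule ℂ (A i)]
    {S N : VonNeumannAlgebra (TensorSpace hΩ)} (hS : S = generatedBy (Set.range (tensorRep hΩ π)))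
    (hN : N = generatedBy (Set.range fun x => tensorRep hΩ π (mapFamily θ x)))
    {mk : {x : ∀ i, A i // {i | x i ≠ 1}.Finite} → S}
    (hmk : ∀ x, (mk x : TensorSpace hΩ →L[ℂ] TensorSpace hΩ) = tensorRep hΩ π x)
    {V : ∀ i, E i →L[ℂ] E i} (hV : ∀ i, V i (Ω i) = Ω i)
    (hVi : ∀ i ξ η, ⟪V i ξ, V i η⟫_ℂ = ⟪ξ, η⟫_ℂ)
    (hVθ : ∀ i, V i ∈ intertwiners (fun a => π i a) (fun a => π i (θ i a))) :
    (∃ z : N, (N.vectorState (tensorUnit hΩ) (norm_tensorUnit hΩ)).IsCentralSupport z ∧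
      ∃! T : S →⋆ₙₐ[ℂ] S, IsNormalMap T ∧ (T 1 : TensorSpace hΩ →L[ℂ] TensorSpace hΩ) = z ∧
        ∀ x : {x : ∀ i, A i // {i | x i ≠ 1}.Finite}, (∀ i, IsSelfAdjoint (x.1 i)) →
          (T (mk x) : TensorSpace hΩ →L[ℂ] TensorSpace hΩ) = z * mk (mapFamily θ x)) ∧
    ((∀ i, interSpan (fun a => π i a) (fun a => π i (θ i a)) = ⊤) →
      (N.vectorState (tensorUnit hΩ) (norm_tensorUnit hΩ)).IsCentralSupport 1 ∧
      ∃ T : S →⋆ₐ[ℂ] S, Function.Injective T ∧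
        (IsNormalMap T ∧ ∀ x : {x : ∀ i, A i // {i | x i ≠ 1}.Finite},
          (∀ i, IsSelfAdjoint (x.1 i)) → T (mk x) = mk (mapFamily θ x)) ∧
        ∀ T' : S →⋆ₐ[ℂ] S,
          (IsNormalMap T' ∧ ∀ x : {x : ∀ i, A i // {i | x i ≠ 1}.Finite},
            (∀ i, IsSelfAdjoint (x.1 i)) → T' (mk x) = mk (mapFamily θ x)) → T' = T) := by
  subst hS hN
  have hmk' : ∀ x, mk x = ⟨tensorRep hΩ π x, subset_generatedBy _ ⟨x, rfl⟩⟩ :=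
    fun x => Subtype.ext (hmk x)
  simp only [hmk']
  obtain ⟨W, hWJ, hW1, hWΩ⟩ := exists_tensorRep_intertwiner hΩ π hV hVi hVθ
  exact ⟨existsUnique_normal_hom (exists_star_tensorRep hΩ π)
    (fun x => subset_generatedBy _ (Set.mem_range_self (mapFamily θ x)))
    hWJ hW1 (norm_tensorUnit hΩ) hWΩ
    (dense_tensorRep_unit hΩ π hc) (tensorRep_mem_adjoin hΩ π),
    fun htop => existsUnique_normal_hom_of_interSpan_eq_top (exists_star_tensorRep hΩ π)
    (fun x => subset_generatedBy _ (Set.mem_range_self (mapFamily θ x)))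
    hWJ hW1 (norm_tensorUnit hΩ) hWΩ
    (dense_tensorRep_unit hΩ π hc) (tensorRep_mem_adjoin hΩ π)
    (tensorRep_interSpan_eq_top hΩ π hc hV hVi hVθ htop)⟩

end TensorRep

end

noncomputable section

/-! ## Operators on free products -/

section Free

variable {ι : Type*} {E : ι → Type*} [∀ i, NormedAddCommGroup (E i)]
  [∀ i, InnerProductSpace ℂ (E i)] {Ω : ∀ i, E i}

open Classical in
/-- The vector attached to a list of letters: zero if the list is not a reduced word. -/
def listVec (l : List (Letter Ω)) : FreeSpace Ω :=
  if h : (l.map Sigma.fst).IsChain (· ≠ ·) then wordVec ⟨l, h⟩ else 0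

lemma listVec_of_isChain {l : List (Letter Ω)} (h : (l.map Sigma.fst).IsChain (· ≠ ·)) :
    listVec l = wordVec ⟨l, h⟩ := dif_pos h

lemma listVec_val (w : RedWord Ω) : listVec w.1 = wordVec w := listVec_of_isChain w.2

lemma inner_wordVec_listVec (w : RedWord Ω) {l : List (Letter Ω)}
    (h : (l.map Sigma.fst).IsChain (· ≠ ·)) : ⟪wordVec w, listVec l⟫_ℂ = wordInner w.1 l := by
  rw [listVec_of_isChain h, inner_wordVec]

lemma letterInner_add (p : Letter Ω) (j : ι) (ξ η : (ℂ ∙ Ω j)ᗮ) :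
    letterInner p ⟨j, ξ + η⟩ = letterInner p ⟨j, ξ⟩ + letterInner p ⟨j, η⟩ := by
  obtain ⟨i, ζ⟩ := p
  by_cases h : i = j
  · subst h
    rw [letterInner_same, letterInner_same, letterInner_same, Submodule.coe_add, inner_add_right]
  · rw [letterInner_of_ne h, letterInner_of_ne h, letterInner_of_ne h, add_zero]

lemma letterInner_smul (p : Letter Ω) (j : ι) (c : ℂ) (ξ : (ℂ ∙ Ω j)ᗮ) :
    letterInner p ⟨j, c • ξ⟩ = c * letterInner p ⟨j, ξ⟩ := by
  obtain ⟨i, ζ⟩ := p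
  by_cases h : i = j
  · subst h
    rw [letterInner_same, letterInner_same, Submodule.coe_smul, inner_smul_right]
  · rw [letterInner_of_ne h, letterInner_of_ne h, mul_zero]

lemma listVec_cons_of_not_isChain {j : ι} {l : List (Letter Ω)}
    (h : ¬(j :: l.map Sigma.fst).IsChain (· ≠ ·)) (ξ : (ℂ ∙ Ω j)ᗮ) :
    listVec (⟨j, ξ⟩ :: l) = 0 := dif_neg h

lemma inner_wordVec_listVec_cons {j : ι} {l : List (Letter Ω)}
    (h : (j :: l.map Sigma.fst).IsChain (· ≠ ·)) (w : RedWord Ω) (ξ : (ℂ ∙ Ω j)ᗮ) :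
    ⟪wordVec w, listVec (⟨j, ξ⟩ :: l)⟫_ℂ = wordInner w.1 (⟨j, ξ⟩ :: l) :=
  inner_wordVec_listVec w h

/-- The vector `ξ ⊗ l` as a function of `ξ`. -/
def listCons (j : ι) (l : List (Letter Ω)) : (ℂ ∙ Ω j)ᗮ →L[ℂ] FreeSpace Ω :=
  LinearMap.mkContinuousOfExistsBound
    { toFun := fun ξ => listVec (⟨j, ξ⟩ :: l)
      map_add' := fun ξ η => PDKernel.ext_inner_vec fun w => by
        change ⟪wordVec w, _⟫_ℂ = ⟪wordVec w, _⟫_ℂ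
        by_cases h : (j :: l.map Sigma.fst).IsChain (· ≠ ·)
        · rw [inner_add_right, inner_wordVec_listVec_cons h, inner_wordVec_listVec_cons h,
            inner_wordVec_listVec_cons h]
          rcases w with ⟨_ | ⟨p, m⟩, hw⟩
          · simp [wordInner]
          · rw [wordInner, wordInner, wordInner, letterInner_add, add_mul]
        · rw [listVec_cons_of_not_isChain h, listVec_cons_of_not_isChain h,
            listVec_cons_of_not_isChain h, add_zero]
      map_smul' := fun c ξ => PDKernel.ext_inner_vec fun w => by
        change ⟪wordVec w, _⟫_ℂ = ⟪wordVec w, _⟫_ℂ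
        by_cases h : (j :: l.map Sigma.fst).IsChain (· ≠ ·)
        · rw [inner_smul_right, inner_wordVec_listVec_cons h, inner_wordVec_listVec_cons h]
          rcases w with ⟨_ | ⟨p, m⟩, hw⟩
          · simp [wordInner]
          · rw [wordInner, wordInner, letterInner_smul, mul_assoc]
            rfl
        · rw [listVec_cons_of_not_isChain h, listVec_cons_of_not_isChain h, smul_zero] }
    (by
      refine ⟨√‖wordInner l l‖, fun ξ => ?_⟩
      change ‖listVec (⟨j, ξ⟩ :: l)‖ ≤ _
      by_cases h : (j :: l.map Sigma.fst).IsChain (· ≠ ·)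
      · refine (sq_le_sq₀ (norm_nonneg _) (by positivity)).1 ?_
        have h1 : ⟪listVec (⟨j, ξ⟩ :: l), listVec (⟨j, ξ⟩ :: l)⟫_ℂ =
            ⟪(ξ : E j), (ξ : E j)⟫_ℂ * wordInner l l := by
          rw [listVec_of_isChain h, inner_wordVec, wordInner, letterInner_same]
        have h2 := congrArg norm h1
        rw [norm_mul, inner_self_eq_norm_sq_to_K, inner_self_eq_norm_sq_to_K] at h2
        simp only [norm_pow, RCLike.norm_ofReal, abs_norm] at h2
        rw [mul_pow, Real.sq_sqrt (norm_nonneg _), mul_comm]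
        exact h2.le
      · rw [listVec_cons_of_not_isChain h, norm_zero]
        positivity)

lemma listCons_apply (j : ι) (l : List (Letter Ω)) (ξ : (ℂ ∙ Ω j)ᗮ) :
    listCons j l ξ = listVec (⟨j, ξ⟩ :: l) := rfl

/-- The vector `ξ ⊗ l`, for an arbitrary `ξ`, as a function of `ξ`. -/
def listTensor (j : ι) (l : List (Letter Ω)) : E j →L[ℂ] FreeSpace Ω :=
  listCons j l ∘L (ℂ ∙ Ω j)ᗮ.orthogonalProjectionOnto +
    (innerSL ℂ (Ω j)).smulRight (listVec l)

lemma listTensor_apply (j : ι) (l : List (Letter Ω)) (ξ : E j) :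
    listTensor j l ξ = listVec (⟨j, orthPart j ξ⟩ :: l) + ⟪Ω j, ξ⟫_ℂ • listVec l := rfl

lemma listTensor_val (j : ι) (t : RedWordNot Ω j) (ξ : E j) :
    listTensor j t.1.1 ξ = tensorWord j ξ t := by
  rw [listTensor_apply, tensorWord, listVec_val, ← listVec_val (consWord _ _ _)]
  rfl

lemma listTensor_orth (j : ι) (l : List (Letter Ω)) (ξ : (ℂ ∙ Ω j)ᗮ) :
    listTensor j l (ξ : E j) = listVec (⟨j, ξ⟩ :: l) := by
  have h1 : orthPart (Ω := Ω) j (ξ : E j) = ξ :=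
    Submodule.orthogonalProjectionOnto_mem_subspace_eq_self ξ
  rw [listTensor_apply, h1, Submodule.mem_orthogonal_singleton_iff_inner_right.1 ξ.2, zero_smul,
    add_zero]

/-- A reduced word which does not start with index `j`. -/
lemma exists_redWordNot {j : ι} {l : List (Letter Ω)}
    (h : (j :: l.map Sigma.fst).IsChain (· ≠ ·)) : ∃ t : RedWordNot Ω j, t.1.1 = l := by
  refine ⟨⟨⟨l, h.tail⟩, fun p hp => ?_⟩, rfl⟩
  rcases l with _ | ⟨q, l⟩
  · simp at hp
  · have : q = p := by simpa using hp
    subst this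
    exact (List.isChain_cons_cons.1 h).1.symm

lemma isChain_redWordNot {j : ι} (t : RedWordNot Ω j) :
    (j :: t.1.1.map Sigma.fst).IsChain (· ≠ ·) := (consWord j 0 t).2

variable (hΩ : ∀ i, ‖Ω i‖ = 1)
include hΩ

lemma listTensor_self (j : ι) (l : List (Letter Ω)) : listTensor j l (Ω j) = listVec l := by
  have h1 : orthPart (Ω := Ω) j (Ω j) = 0 := by
    rw [← Submodule.coe_eq_zero, coe_orthPart hΩ]
    simp [inner_self_eq_norm_sq_to_K, hΩ]
  have h2 : (⟪Ω j, Ω j⟫_ℂ) = 1 := by simp [inner_self_eq_norm_sq_to_K, hΩ]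
  rw [listTensor_apply, h1, h2, one_smul, ← listCons_apply, map_zero, zero_add]

lemma inner_listTensor {j : ι} {l m : List (Letter Ω)}
    (hl : (j :: l.map Sigma.fst).IsChain (· ≠ ·)) (hm : (j :: m.map Sigma.fst).IsChain (· ≠ ·))
    (ξ η : E j) : ⟪listTensor j l ξ, listTensor j m η⟫_ℂ = ⟪ξ, η⟫_ℂ * wordInner l m := by
  obtain ⟨t, rfl⟩ := exists_redWordNot hl
  obtain ⟨t', rfl⟩ := exists_redWordNot hm
  rw [listTensor_val, listTensor_val, inner_tensorWord hΩ]

/-- Every reduced word is of the form `ξ ⊗ l` with `ξ` in `E j`. -/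
lemma exists_listTensor (j : ι) (w : RedWord Ω) : ∃ (ξ : E j) (l : List (Letter Ω)),
    (j :: l.map Sigma.fst).IsChain (· ≠ ·) ∧ wordVec w = listTensor j l ξ ∧
      ((∃ h, w.1 = ⟨j, ⟨ξ, h⟩⟩ :: l) ∨ (w.1 = l ∧ ξ = Ω j)) := by
  rcases exists_word j w with ⟨ξ, t, rfl⟩ | ⟨t, rfl⟩
  · refine ⟨ξ, t.1.1, isChain_redWordNot t, ?_, Or.inl ⟨ξ.2, rfl⟩⟩
    rw [listTensor_orth, ← listVec_val]
    rfl
  · refine ⟨Ω j, t.1.1, isChain_redWordNot t, ?_, Or.inr ⟨rfl, rfl⟩⟩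
    rw [listTensor_self hΩ, listVec_val]

/-- On words the operator is defined by peeling off a possible first letter of index `j`. Splitting
`ξ` along `Ω j` reduces an arbitrary vector to the two kinds of words, and shows that `A` acts on
the first factor only. -/
lemma freeOp_listTensor {j : ι} {l : List (Letter Ω)}
    (hl : (j :: l.map Sigma.fst).IsChain (· ≠ ·)) (A : E j →L[ℂ] E j) (ξ : E j) :
    freeOp hΩ j A (listTensor j l ξ) = listTensor j l (A ξ) := by
  obtain ⟨t, rfl⟩ := exists_redWordNot hl
  have h1 : freeOp hΩ j A (wordVec t.1) = listTensor j t.1.1 (A (Ω j)) := by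
    rw [freeOp_wordVec, peel_not, listTensor_val]
  have h2 : ∀ ζ : (ℂ ∙ Ω j)ᗮ, freeOp hΩ j A (listVec (⟨j, ζ⟩ :: t.1.1)) =
      listTensor j t.1.1 (A ζ) := by
    intro ζ
    have h3 : listVec (⟨j, ζ⟩ :: t.1.1) = wordVec (consWord j ζ t) := listVec_val (consWord j ζ t)
    rw [h3, freeOp_wordVec, peel_consWord, listTensor_val]
  rw [listTensor_apply, map_add, map_smul, h2, listVec_val, h1, ← map_smul, ← map_add, ← map_smul,
    ← map_add, coe_orthPart hΩ, sub_add_cancel]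

lemma star_freeOp [∀ i, CompleteSpace (E i)] (j : ι) (A : E j →L[ℂ] E j) :
    star (freeOp hΩ j A) = freeOp hΩ j (star A) := by
  refine PDKernel.star_eq_of_inner_vec fun w w' => ?_
  change ⟪freeOp hΩ j A (wordVec w), wordVec w'⟫_ℂ = ⟪wordVec w, freeOp hΩ j _ (wordVec w')⟫_ℂ
  obtain ⟨ξ, l, hl, hw, -⟩ := exists_listTensor hΩ j w
  obtain ⟨ξ', l', hl', hw', -⟩ := exists_listTensor hΩ j w'
  rw [hw, hw', freeOp_listTensor hΩ hl, freeOp_listTensor hΩ hl', inner_listTensor hΩ hl hl',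
    inner_listTensor hΩ hl hl', ContinuousLinearMap.star_eq_adjoint,
    ContinuousLinearMap.adjoint_inner_right]

omit hΩ in
lemma freeSpace_induction {Q : Submodule ℂ (FreeSpace Ω)} (hQ : IsClosed (Q : Set (FreeSpace Ω)))
    (h0 : vacuum Ω ∈ Q)
    (hstep : ∀ (j : ι) (l : List (Letter Ω)), (j :: l.map Sigma.fst).IsChain (· ≠ ·) →
      listVec l ∈ Q → ∀ ξ, listTensor j l ξ ∈ Q) : Q = ⊤ := by
  have h1 : ∀ l : List (Letter Ω), (l.map Sigma.fst).IsChain (· ≠ ·) → listVec l ∈ Q := by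
    intro l
    induction l with
    | nil =>
      intro h
      rw [listVec_of_isChain h]
      exact h0
    | cons p l ih =>
      intro h
      have := hstep p.1 l h (ih h.tail) p.2
      rwa [listTensor_orth] at this
  rw [eq_top_iff, ← PDKernel.span_vec]
  refine Submodule.topologicalClosure_minimal _ (Submodule.span_le.2 ?_) hQ
  rintro _ ⟨w, rfl⟩
  have := h1 w.1 w.2
  rwa [listVec_val] at this

end Free

end

noncomputable section

section Free

variable {ι : Type*} {E : ι → Type*} [∀ i, NormedAddCommGroup (E i)]
  [∀ i, InnerProductSpace ℂ (E i)] {Ω : ∀ i, E i}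

/-! ### Isometries of the free product -/

/-- Apply `V` to every letter. As `V i` is isometric and fixes `Ω i`, it preserves the orthogonal
complement of `Ω i`, so letters go to letters of the same index and reduced words to reduced words.
-/
lemma exists_freeIsometry (hΩ : ∀ i, ‖Ω i‖ = 1) (V : ∀ i, E i →L[ℂ] E i)
    (hV : ∀ i, V i (Ω i) = Ω i) (hVi : ∀ i ξ η, ⟪V i ξ, V i η⟫_ℂ = ⟪ξ, η⟫_ℂ) :
    ∃ W : FreeSpace Ω →L[ℂ] FreeSpace Ω, star W * W = 1 ∧ W (vacuum Ω) = vacuum Ω ∧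
      (∀ j ξ, W (listTensor j [] ξ) = listTensor j [] (V j ξ)) ∧
      ∀ (j : ι) (A B : E j →L[ℂ] E j), V j * A = B * V j →
        W * freeOp hΩ j A = freeOp hΩ j B * W := by
  have hVΩ : ∀ i ξ, ⟪Ω i, V i ξ⟫_ℂ = ⟪Ω i, ξ⟫_ℂ := fun i ξ => by
    rw [← hVi i (Ω i) ξ, hV]
  have horth : ∀ (i : ι) (ξ : (ℂ ∙ Ω i)ᗮ), V i ξ ∈ (ℂ ∙ Ω i)ᗮ := fun i ξ =>
    Submodule.mem_orthogonal_singleton_iff_inner_right.2 ((hVΩ i ξ).trans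
      (Submodule.mem_orthogonal_singleton_iff_inner_right.1 ξ.2))
  let f : Letter Ω → Letter Ω := fun p => ⟨p.1, ⟨V p.1 p.2, horth p.1 p.2⟩⟩
  have hf1 : ∀ l : List (Letter Ω), (l.map f).map Sigma.fst = l.map Sigma.fst := fun l => by
    rw [List.map_map]
    rfl
  have hf2 : ∀ p q, letterInner (f p) (f q) = letterInner p q := by
    rintro ⟨i, ξ⟩ ⟨j, η⟩
    by_cases h : i = j
    · subst h
      exact (letterInner_same _ _ _).trans ((hVi i _ _).trans (letterInner_same _ _ _).symm)
    · exact (letterInner_of_ne (p := f ⟨i, ξ⟩) (q := f ⟨j, η⟩) h).trans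
        (letterInner_of_ne (p := ⟨i, ξ⟩) (q := ⟨j, η⟩) h).symm
  have hf3 : ∀ l m : List (Letter Ω), wordInner (l.map f) (m.map f) = wordInner l m := by
    intro l
    induction l with
    | nil => rintro (_ | ⟨q, m⟩) <;> rfl
    | cons p l ih =>
      rintro (_ | ⟨q, m⟩)
      · rfl
      · rw [List.map_cons, List.map_cons, wordInner, wordInner, hf2, ih]
  obtain ⟨W, hW, hW1⟩ := PDKernel.exists_isometry (k := freeKernel Ω)
    (fun w => wordVec ⟨w.1.map f, by rw [hf1]; exact w.2⟩) (fun w w' => by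
      rw [inner_wordVec, hf3]
      rfl)
  have hWl : ∀ l : List (Letter Ω), W (listVec l) = listVec (l.map f) := by
    intro l
    by_cases h : (l.map Sigma.fst).IsChain (· ≠ ·)
    · rw [listVec_of_isChain h, listVec_of_isChain (l := l.map f) (by rwa [hf1])]
      exact hW _
    · rw [listVec, listVec, dif_neg h, dif_neg (by rwa [hf1]), map_zero]
  have hWt : ∀ j l ξ, W (listTensor j l ξ) = listTensor j (l.map f) (V j ξ) := by
    intro j l ξ
    have h1 : (⟨V j (orthPart (Ω := Ω) j ξ), horth j _⟩ : (ℂ ∙ Ω j)ᗮ) = orthPart j (V j ξ) := by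
      refine Subtype.ext ?_
      change V j (orthPart (Ω := Ω) j ξ : E j) = _
      rw [coe_orthPart hΩ, coe_orthPart hΩ, map_sub, map_smul, hV, hVΩ]
    rw [listTensor_apply, listTensor_apply, map_add, map_smul, hWl, hWl, hVΩ, ← h1]
    rfl
  refine ⟨W, hW1, hW _, fun j ξ => hWt j [] ξ, fun j A B hAB => PDKernel.clm_ext fun w => ?_⟩
  change W (freeOp hΩ j A (wordVec w)) = freeOp hΩ j B (W (wordVec w))
  obtain ⟨ξ, l, hl, hw, -⟩ := exists_listTensor hΩ j w
  have h1 : V j (A ξ) = B (V j ξ) := congrArg (fun r => r ξ) hAB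
  rw [hw, freeOp_listTensor hΩ hl, hWt, hWt,
    freeOp_listTensor hΩ (l := l.map f) (by rwa [hf1]), h1]

/-! ### Reversal of words -/

lemma wordInner_concat (l m : List (Letter Ω)) (p q : Letter Ω) :
    wordInner (l ++ [p]) (m ++ [q]) = wordInner l m * letterInner p q := by
  induction l generalizing m with
  | nil =>
    rcases m with _ | ⟨r, m⟩
    · simp [wordInner]
    · rw [wordInner_of_length_ne (by simp), wordInner_of_length_ne (by simp), zero_mul]
  | cons r l ih =>
    rcases m with _ | ⟨s, m⟩
    · rw [wordInner_of_length_ne (by simp), wordInner_of_length_ne (by simp), zero_mul]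
    · rw [List.cons_append, List.cons_append, wordInner, wordInner, ih, mul_assoc]

lemma wordInner_reverse (l m : List (Letter Ω)) :
    wordInner l.reverse m.reverse = wordInner l m := by
  induction l generalizing m with
  | nil =>
    rcases m with _ | ⟨r, m⟩
    · rfl
    · rw [wordInner_of_length_ne (by simp), wordInner_of_length_ne (by simp)]
  | cons r l ih =>
    rcases m with _ | ⟨s, m⟩
    · rw [wordInner_of_length_ne (by simp), wordInner_of_length_ne (by simp)]
    · rw [List.reverse_cons, List.reverse_cons, wordInner_concat, wordInner, ih, mul_comm]

lemma isChain_ne_reverse {l : List ι} : l.reverse.IsChain (· ≠ ·) ↔ l.IsChain (· ≠ ·) := by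
  rw [List.isChain_reverse]
  simp only [ne_comm]

/-- Reversal preserves the inner products and reducedness of words. Conjugation by it turns the left
actions into right actions. -/
lemma exists_flip : ∃ U : FreeSpace Ω →L[ℂ] FreeSpace Ω,
    ∀ l : List (Letter Ω), U (listVec l) = listVec l.reverse := by
  obtain ⟨U, hU, -⟩ := PDKernel.exists_isometry (k := freeKernel Ω)
    (fun w => wordVec ⟨w.1.reverse, by
      rw [List.map_reverse]
      exact isChain_ne_reverse.2 w.2⟩) (fun w w' => by
      rw [inner_wordVec, wordInner_reverse]
      rfl)
  refine ⟨U, fun l => ?_⟩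
  by_cases h : (l.map Sigma.fst).IsChain (· ≠ ·)
  · rw [listVec_of_isChain h, listVec_of_isChain (l := l.reverse) (by
      rw [List.map_reverse]
      exact isChain_ne_reverse.2 h)]
    exact hU _
  · rw [listVec, listVec, dif_neg h, dif_neg (by
      rw [List.map_reverse]
      exact fun h1 => h (isChain_ne_reverse.1 h1)), map_zero]

variable (Ω) in
/-- The reversal of words. -/
def flipOp : FreeSpace Ω →L[ℂ] FreeSpace Ω := exists_flip.choose

lemma flipOp_listVec (l : List (Letter Ω)) : flipOp Ω (listVec l) = listVec l.reverse :=
  exists_flip.choose_spec l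

/-! ### Right operators -/

/-- The vector `ξ ⊗ m ⊗ ζ`, with the distinguished vectors as units. -/
def biTensor (i k : ι) (m : List (Letter Ω)) (ξ : E i) (ζ : E k) : FreeSpace Ω :=
  listTensor i (m ++ [⟨k, orthPart k ζ⟩]) ξ + ⟪Ω k, ζ⟫_ℂ • listTensor i m ξ

lemma flipOp_biTensor (i k : ι) (m : List (Letter Ω)) (ξ : E i) (ζ : E k) :
    flipOp Ω (biTensor i k m ξ ζ) = biTensor k i m.reverse ζ ξ := by
  simp only [biTensor, listTensor_apply, map_add, map_smul, flipOp_listVec, List.reverse_cons,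
    List.reverse_append, List.reverse_nil, List.nil_append, List.cons_append, smul_add, smul_smul]
  rw [mul_comm]
  abel

lemma flipOp_listTensor_nil (i : ι) (ξ : E i) :
    flipOp Ω (listTensor i [] ξ) = listTensor i [] ξ := by
  simp [listTensor_apply, flipOp_listVec]

variable (hΩ : ∀ i, ‖Ω i‖ = 1)

/-- The operator on the free product which acts on the last letters of the words. -/
def rightOp (k : ι) (y : E k →L[ℂ] E k) : FreeSpace Ω →L[ℂ] FreeSpace Ω :=
  flipOp Ω * freeOp hΩ k y * flipOp Ω

lemma rightOp_apply (k : ι) (y : E k →L[ℂ] E k) (v : FreeSpace Ω) :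
    rightOp hΩ k y v = flipOp Ω (freeOp hΩ k y (flipOp Ω v)) := rfl

lemma freeOp_biTensor {i k : ι} {m : List (Letter Ω)}
    (h : (i :: (m.map Sigma.fst ++ [k])).IsChain (· ≠ ·)) (b : E i →L[ℂ] E i) (ξ : E i) (ζ : E k) :
    freeOp hΩ i b (biTensor i k m ξ ζ) = biTensor i k m (b ξ) ζ := by
  have h1 : (i :: (m ++ [(⟨k, orthPart k ζ⟩ : Letter Ω)]).map Sigma.fst).IsChain (· ≠ ·) := by
    rwa [List.map_append]
  have h2 : (i :: m.map Sigma.fst).IsChain (· ≠ ·) :=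
    (List.isChain_append (l₁ := i :: m.map Sigma.fst)).1 h |>.1
  rw [biTensor, map_add, map_smul, freeOp_listTensor hΩ h1, freeOp_listTensor hΩ h2, biTensor]

lemma rightOp_biTensor {i k : ι} {m : List (Letter Ω)}
    (h : (i :: (m.map Sigma.fst ++ [k])).IsChain (· ≠ ·)) (y : E k →L[ℂ] E k) (ξ : E i) (ζ : E k) :
    rightOp hΩ k y (biTensor i k m ξ ζ) = biTensor i k m ξ (y ζ) := by
  rw [rightOp_apply, flipOp_biTensor, freeOp_biTensor, flipOp_biTensor, List.reverse_reverse]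
  rw [← isChain_ne_reverse]
  simpa using h

lemma rightOp_listTensor_nil (i : ι) (y : E i →L[ℂ] E i) (ξ : E i) :
    rightOp hΩ i y (listTensor i [] ξ) = listTensor i [] (y ξ) := by
  rw [rightOp_apply, flipOp_listTensor_nil, freeOp_listTensor hΩ (by simp), flipOp_listTensor_nil]

include hΩ in
-- A word can be given a vector of `E i` at its left end and one of `E k` at its right end, with `Ω
-- i` or `Ω k` filled in where no such letter stands. This fails only if `i = k` and the word is
-- empty or a single letter of that index, when both ends are the same place.
lemma exists_biTensor (i k : ι) (w : RedWord Ω) :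
    (∃ m ξ ζ, (i :: (m.map Sigma.fst ++ [k])).IsChain (· ≠ ·) ∧
      wordVec w = biTensor i k m ξ ζ) ∨
    i = k ∧ (w.1 = [] ∨ ∃ ξ, w.1 = [⟨i, ξ⟩]) := by
  have hb1 : ∀ (m : List (Letter Ω)) (ξ : E i), listTensor i m ξ = biTensor i k m ξ (Ω k) := by
    intro m ξ
    have h1 : biTensor i k m ξ (Ω k) = flipOp Ω (biTensor k i m.reverse (Ω k) ξ) := by
      rw [flipOp_biTensor, List.reverse_reverse]
    rw [h1, biTensor, listTensor_self hΩ, listTensor_self hΩ, map_add, map_smul, flipOp_listVec,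
      flipOp_listVec]
    simp [listTensor_apply]
  have hb2 : ∀ (m : List (Letter Ω)) (ξ : E i) (ζ : (ℂ ∙ Ω k)ᗮ),
      listTensor i (m ++ [⟨k, ζ⟩]) ξ = biTensor i k m ξ (ζ : E k) := by
    intro m ξ ζ
    have h1 : orthPart (Ω := Ω) k (ζ : E k) = ζ :=
      Submodule.orthogonalProjectionOnto_mem_subspace_eq_self ζ
    rw [biTensor, h1, Submodule.mem_orthogonal_singleton_iff_inner_right.1 ζ.2, zero_smul,
      add_zero]
  obtain ⟨ξ, l, hl, hw, hw'⟩ := exists_listTensor hΩ i w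
  rcases List.eq_nil_or_concat l with rfl | ⟨m, ⟨q, ζ⟩, rfl⟩
  · by_cases hik : i = k
    · refine Or.inr ⟨hik, ?_⟩
      rcases hw' with ⟨h, hw'⟩ | ⟨hw', -⟩
      · exact Or.inr ⟨_, hw'⟩
      · exact Or.inl hw'
    · refine Or.inl ⟨[], ξ, Ω k, by simpa using hik, ?_⟩
      rw [hw, hb1]
  · left
    rw [List.concat_eq_append] at hl hw
    by_cases hqk : q = k
    · subst hqk
      refine ⟨m, ξ, ζ, by simpa using hl, ?_⟩
      rw [hw, hb2]
    · refine ⟨m ++ [⟨q, ζ⟩], ξ, Ω k, ?_, ?_⟩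
      · rw [List.map_append] at hl ⊢
        rw [← List.cons_append, List.isChain_append]
        refine ⟨hl, by simp, ?_⟩
        simp [List.getLast?_cons, hqk]
      · rw [hw, hb1]

lemma freeOp_rightOp_biTensor {i k : ι} {m : List (Letter Ω)}
    (h : (i :: (m.map Sigma.fst ++ [k])).IsChain (· ≠ ·)) (b : E i →L[ℂ] E i) (y : E k →L[ℂ] E k)
    (ξ : E i) (ζ : E k) :
    freeOp hΩ i b (rightOp hΩ k y (biTensor i k m ξ ζ)) =
      rightOp hΩ k y (freeOp hΩ i b (biTensor i k m ξ ζ)) := by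
  rw [freeOp_biTensor hΩ h, rightOp_biTensor hΩ h, rightOp_biTensor hΩ h, freeOp_biTensor hΩ h]

/-- For distinct indices there are no exceptional words: the two operators always act on different
ends. -/
lemma freeOp_mul_rightOp_of_ne {i k : ι} (hik : i ≠ k) (b : E i →L[ℂ] E i) (y : E k →L[ℂ] E k) :
    rightOp hΩ k y * freeOp hΩ i b = freeOp hΩ i b * rightOp hΩ k y := by
  refine PDKernel.clm_ext fun w => ?_
  change rightOp hΩ k y (freeOp hΩ i b (wordVec w)) = freeOp hΩ i b (rightOp hΩ k y (wordVec w))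
  rcases exists_biTensor hΩ i k w with ⟨m, ξ, ζ, h, hw⟩ | ⟨h, -⟩
  · rw [hw, freeOp_rightOp_biTensor hΩ h]
  · exact absurd h hik

/-- The exceptional words span a copy of `E i`, on which the operators act as `b` and `y`; this is
the only place where they have to commute. -/
lemma freeOp_mul_rightOp_of_commute {i : ι} {b y : E i →L[ℂ] E i} (hby : y * b = b * y) :
    rightOp hΩ i y * freeOp hΩ i b = freeOp hΩ i b * rightOp hΩ i y := by
  refine PDKernel.clm_ext fun w => ?_
  change rightOp hΩ i y (freeOp hΩ i b (wordVec w)) = freeOp hΩ i b (rightOp hΩ i y (wordVec w))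
  have h0 : ∀ ξ, rightOp hΩ i y (freeOp hΩ i b (listTensor i [] ξ)) =
      freeOp hΩ i b (rightOp hΩ i y (listTensor i [] ξ)) := by
    intro ξ
    have h1 : y (b ξ) = b (y ξ) := congrArg (fun r => r ξ) hby
    rw [freeOp_listTensor hΩ (by simp), rightOp_listTensor_nil, rightOp_listTensor_nil,
      freeOp_listTensor hΩ (by simp), h1]
  rcases exists_biTensor hΩ i i w with ⟨m, ξ, ζ, h, hw⟩ | ⟨-, hw | ⟨ξ, hw⟩⟩
  · rw [hw, freeOp_rightOp_biTensor hΩ h]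
  · rw [← listVec_val, hw, ← listTensor_self hΩ i, h0]
  · rw [← listVec_val, hw, ← listTensor_orth, h0]

/-- A word ending with an index other than `k` is never exceptional, so no relation between `b` and
`y` is needed. -/
lemma freeOp_rightOp_wordVec {i k : ι} (b : E i →L[ℂ] E i) (y : E k →L[ℂ] E k) {w : RedWord Ω}
    {l : ι} (hw : ∃ p ∈ w.1.getLast?, p.1 = l) (hl : l ≠ k) :
    rightOp hΩ k y (freeOp hΩ i b (wordVec w)) = freeOp hΩ i b (rightOp hΩ k y (wordVec w)) := by
  rcases exists_biTensor hΩ i k w with ⟨m, ξ, ζ, h, hw'⟩ | ⟨h, h1 | ⟨ξ, h1⟩⟩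
  · rw [hw', freeOp_rightOp_biTensor hΩ h]
  · simp [h1] at hw
  · rw [h1] at hw
    simp only [List.getLast?_singleton, Option.mem_some_iff, exists_eq_left'] at hw
    exact absurd (hw.symm.trans h) hl

variable (Ω) in
/-- The closed span of the words which end with index `l`. -/
def endSpace (l : ι) : Submodule ℂ (FreeSpace Ω) :=
  (Submodule.span ℂ {v | ∃ w : RedWord Ω, (∃ p ∈ w.1.getLast?, p.1 = l) ∧
    v = wordVec w}).topologicalClosure

lemma listVec_concat_mem_endSpace {l : ι} (m : List (Letter Ω)) (ξ : (ℂ ∙ Ω l)ᗮ) :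
    listVec (m ++ [⟨l, ξ⟩]) ∈ endSpace Ω l := by
  by_cases h : ((m ++ [(⟨l, ξ⟩ : Letter Ω)]).map Sigma.fst).IsChain (· ≠ ·)
  · rw [listVec_of_isChain h]
    exact Submodule.le_topologicalClosure _ (Submodule.subset_span ⟨_, ⟨⟨l, ξ⟩, by simp, rfl⟩, rfl⟩)
  · rw [listVec, dif_neg h]
    exact zero_mem _

/-- Since `y` takes values orthogonal to `Ω k`, it always leaves a genuine last letter of index `k`.
-/
lemma rightOp_mem_endSpace {k : ι} {y : E k →L[ℂ] E k} (hy : ∀ ξ, ⟪Ω k, y ξ⟫_ℂ = 0)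
    (v : FreeSpace Ω) : rightOp hΩ k y v ∈ endSpace Ω k := by
  refine Submodule.map_mem_of_dense (Submodule.isClosed_topologicalClosure _) _
    (PDKernel.span_vec _) ?_ v
  rintro _ ⟨w, rfl⟩
  change rightOp hΩ k y (wordVec w) ∈ _
  have hc : (w.1.reverse.map Sigma.fst).IsChain (· ≠ ·) := by
    rw [List.map_reverse]
    exact isChain_ne_reverse.2 w.2
  obtain ⟨ξ, l, hl, hw, -⟩ := exists_listTensor hΩ k ⟨w.1.reverse, hc⟩
  have h1 := listTensor_orth k l
    ⟨y ξ, Submodule.mem_orthogonal_singleton_iff_inner_right.2 (hy ξ)⟩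
  rw [← listVec_val, rightOp_apply, flipOp_listVec, listVec_of_isChain hc, hw,
    freeOp_listTensor hΩ hl, h1, flipOp_listVec, List.reverse_cons]
  exact listVec_concat_mem_endSpace _ _

lemma rightOp_freeOp_of_mem_endSpace {i k l : ι} (hl : l ≠ k) (b : E i →L[ℂ] E i)
    (y : E k →L[ℂ] E k) {v : FreeSpace Ω} (hv : v ∈ endSpace Ω l) :
    rightOp hΩ k y (freeOp hΩ i b v) = freeOp hΩ i b (rightOp hΩ k y v) := by
  have h1 : endSpace Ω l ≤ LinearMap.ker
      (rightOp hΩ k y * freeOp hΩ i b - freeOp hΩ i b * rightOp hΩ k y).toLinearMap := by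
    refine Submodule.topologicalClosure_minimal _ (Submodule.span_le.2 ?_)
      (ContinuousLinearMap.isClosed_ker _)
    rintro _ ⟨w, hw, rfl⟩
    exact sub_eq_zero.2 (freeOp_rightOp_wordVec hΩ b y hw hl)
  exact sub_eq_zero.1 (h1 hv)

/-- Creation of a last letter. -/
lemma rightOp_create {k : ι} (ζ : (ℂ ∙ Ω k)ᗮ) {m : List (Letter Ω)}
    (h : (m.map Sigma.fst ++ [k]).IsChain (· ≠ ·)) :
    rightOp hΩ k ((innerSL ℂ (Ω k)).smulRight (ζ : E k)) (listVec m) =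
      listVec (m ++ [⟨k, ζ⟩]) := by
  have h1 : (k :: m.reverse.map Sigma.fst).IsChain (· ≠ ·) := by
    rw [← isChain_ne_reverse]
    simpa using h
  have h2 : ((innerSL ℂ (Ω k)).smulRight (ζ : E k)) (Ω k) = (ζ : E k) := by
    simp [inner_self_eq_norm_sq_to_K, hΩ]
  rw [rightOp_apply, flipOp_listVec, ← listTensor_self hΩ k, freeOp_listTensor hΩ h1, h2,
    listTensor_orth, flipOp_listVec, List.reverse_cons, List.reverse_reverse]

end Free

end

noncomputable section

/-! ## Free products of representations -/

section FreeRep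

open VonNeumannAlgebra

variable {ι : Type*} {A : ι → Type*} [∀ i, Semiring (A i)] [∀ i, Star (A i)] [∀ i, Algebra ℂ (A i)]
  {E : ι → Type*} [∀ i, NormedAddCommGroup (E i)] [∀ i, InnerProductSpace ℂ (E i)]
  [∀ i, CompleteSpace (E i)] {Ω : ∀ i, E i} (hΩ : ∀ i, ‖Ω i‖ = 1)
  (π : ∀ i, A i →⋆ₐ[ℂ] (E i →L[ℂ] E i)) {θ : ∀ i, A i →⋆ₐ[ℂ] A i}

/-- The left action of an element of one of the algebras. -/
def freeRep (p : Σ j, A j) : FreeSpace Ω →L[ℂ] FreeSpace Ω := freeOp hΩ p.1 (π p.1 p.2)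

variable (θ) in
/-- The action of an element on the free product after an endomorphism. -/
def freeRepMap (p : Σ j, A j) : FreeSpace Ω →L[ℂ] FreeSpace Ω :=
  freeRep hΩ π ⟨p.1, θ p.1 p.2⟩

lemma exists_star_freeRep (p : Σ j, A j) : ∃ p', freeRep hΩ π p' = star (freeRep hΩ π p) ∧
    freeRepMap hΩ π θ p' = star (freeRepMap hΩ π θ p) := by
  refine ⟨⟨p.1, star p.2⟩, ?_, ?_⟩
  · rw [freeRep, freeRep, star_freeOp, map_star]
  · rw [freeRepMap, freeRepMap, freeRep, freeRep, star_freeOp, map_star, map_star]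

lemma dense_freeRep_vacuum
    (hc : ∀ i, (Submodule.span ℂ (Set.range fun a => π i a (Ω i))).topologicalClosure = ⊤) :
    Dense {v | ∃ a ∈ generatedBy (Set.range (freeRep hΩ π)), v = a (vacuum Ω)} := by
  let D := cyclicSubspace (generatedBy (Set.range (freeRep hΩ π))) (vacuum Ω)
  have htop : D.topologicalClosure = ⊤ := by
    refine freeSpace_induction D.isClosed_topologicalClosure
      (D.le_topologicalClosure (self_mem_cyclicSubspace _ _)) ?_
    intro j l hl hD ξ
    refine Submodule.map_mem_of_dense D.isClosed_topologicalClosure (listTensor j l) (hc j) ?_ ξ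
    rintro _ ⟨x, rfl⟩
    change listTensor j l (π j x (Ω j)) ∈ _
    rw [← freeOp_listTensor hΩ hl, listTensor_self hΩ]
    exact map_mem_closure_cyclicSubspace
      (subset_generatedBy _ (Set.mem_range_self (f := freeRep hΩ π) ⟨j, x⟩)) hD
  exact Submodule.dense_iff_topologicalClosure_eq_top.2 htop

lemma exists_freeRep_intertwiner {V : ∀ i, E i →L[ℂ] E i} (hV : ∀ i, V i (Ω i) = Ω i)
    (hVi : ∀ i ξ η, ⟪V i ξ, V i η⟫_ℂ = ⟪ξ, η⟫_ℂ)
    (hVθ : ∀ i, V i ∈ intertwiners (fun a => π i a) (fun a => π i (θ i a))) :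
    ∃ W ∈ intertwiners (freeRep hΩ π) (freeRepMap hΩ π θ), star W * W = 1 ∧
      W (vacuum Ω) = vacuum Ω ∧ ∀ j ξ, W (listTensor j [] ξ) = listTensor j [] (V j ξ) := by
  obtain ⟨W, hW1, hWΩ, hWl, hW⟩ := exists_freeIsometry hΩ V hV hVi
  exact ⟨W, fun p => hW _ _ _ (hVθ p.1 p.2), hW1, hWΩ, hWl⟩

/-- If a word is in the range of an intertwiner with range in the words ending with the same index,
then all longer words are in the ranges of intertwiners. -/
lemma listVec_append_mem_interSpan (m : List (Letter Ω)) {l : ι} {R : FreeSpace Ω →L[ℂ] FreeSpace Ω}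
    (hR : R ∈ intertwiners (freeRep hΩ π) (freeRepMap hΩ π θ)) (hRl : ∀ v, R v ∈ endSpace Ω l)
    {w : List (Letter Ω)} {ξ : (ℂ ∙ Ω l)ᗮ} {v : FreeSpace Ω} (hv : R v = listVec (w ++ [⟨l, ξ⟩]))
    (hw : ((w ++ ⟨l, ξ⟩ :: m).map Sigma.fst).IsChain (· ≠ ·)) :
    listVec (w ++ ⟨l, ξ⟩ :: m) ∈ interSpan (freeRep hΩ π) (freeRepMap hΩ π θ) := by
  induction m generalizing l R w ξ v with
  | nil =>
    rw [← hv]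
    exact mem_interSpan hR v
  | cons p m ih =>
    obtain ⟨k, ζ⟩ := p
    -- The rank-one operator that sends `Ω k` to `ζ`. It need not commute with the images of `A k`,
    -- so its right action is not in the commutant. On words ending with `l ≠ k` it does commute
    -- with the left action, and `R` takes values there, so composing with it gives an intertwiner
    -- again.
    set y : E k →L[ℂ] E k := (innerSL ℂ (Ω k)).smulRight (ζ : E k) with hy
    have hy0 : ∀ η, ⟪Ω k, y η⟫_ℂ = 0 := by
      intro η
      rw [hy, ContinuousLinearMap.smulRight_apply, inner_smul_right,
        Submodule.mem_orthogonal_singleton_iff_inner_right.1 ζ.2, mul_zero]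
    have hw1 : w ++ ⟨l, ξ⟩ :: ⟨k, ζ⟩ :: m = (w ++ [⟨l, ξ⟩]) ++ ⟨k, ζ⟩ :: m := by simp
    have hw2 : ((w.map Sigma.fst ++ [l]) ++ [k] ++ m.map Sigma.fst).IsChain (· ≠ ·) := by
      simpa using hw
    have hw3 := (List.isChain_append.1 hw2).1
    have hlk : l ≠ k := (List.isChain_append.1 hw3).2.2 l (by simp) k (by simp)
    have hR' : rightOp hΩ k y * R ∈ intertwiners (freeRep hΩ π) (freeRepMap hΩ π θ) := by
      intro p
      rw [mul_assoc, hR p]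
      ext1 v
      exact rightOp_freeOp_of_mem_endSpace hΩ hlk _ y (hRl v)
    rw [hw1]
    refine ih hR' (fun v => rightOp_mem_endSpace hΩ hy0 _) (v := v) ?_ (hw1 ▸ hw)
    rw [mul_apply_eq_comp, hv]
    exact rightOp_create hΩ ζ (by simpa using hw3)

/-- If the ranges of the intertwiners span each of the spaces, then the ranges of the intertwiners
span the free product. -/
lemma freeRep_interSpan_eq_top
    (hc : ∀ i, (Submodule.span ℂ (Set.range fun a => π i a (Ω i))).topologicalClosure = ⊤)
    {V : ∀ i, E i →L[ℂ] E i} (hV : ∀ i, V i (Ω i) = Ω i)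
    (hVi : ∀ i ξ η, ⟪V i ξ, V i η⟫_ℂ = ⟪ξ, η⟫_ℂ)
    (hVθ : ∀ i, V i ∈ intertwiners (fun a => π i a) (fun a => π i (θ i a)))
    (htop : ∀ i, interSpan (fun a => π i a) (fun a => π i (θ i a)) = ⊤) :
    interSpan (freeRep hΩ π) (freeRepMap hΩ π θ) = ⊤ := by
  obtain ⟨W, hWJ, hW1, hWΩ, hWl⟩ := exists_freeRep_intertwiner hΩ π hV hVi hVθ
  set Q := interSpan (freeRep hΩ π) (freeRepMap hΩ π θ) with hQ
  have hQc : IsClosed (Q : Set (FreeSpace Ω)) := isClosed_interSpan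
  have hunit : vacuum Ω ∈ Q := by
    have h2 := mem_interSpan hWJ (vacuum Ω)
    rwa [hWΩ] at h2
  refine freeSpace_induction hQc hunit fun j l hl hlQ ξ => ?_
  have hisom : ∀ ξ, listTensor j l (V j ξ) ∈ Q := by
    intro ξ
    refine Submodule.map_mem_of_dense hQc (listTensor j l ∘L V j) (hc j) ?_ ξ
    rintro _ ⟨x, rfl⟩
    have h1 : V j (π j x (Ω j)) = π j (θ j x) (Ω j) :=
      (congrArg (fun r => r (Ω j)) (hVθ j x)).trans (congrArg (π j (θ j x)) (hV j))
    change listTensor j l (V j (π j x (Ω j))) ∈ Q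
    rw [h1, ← freeOp_listTensor hΩ hl, listTensor_self hΩ]
    exact apply_mem_interSpan (⟨j, x⟩ : Σ j, A j) hlQ
  refine Submodule.map_mem_of_dense hQc (listTensor j l) (htop j) ?_ ξ
  rintro _ ⟨R, hR, η, rfl⟩
  have hs := exists_star_pair (π j) (θ j)
  have hVV := star_apply_of_inner (hVi j)
  -- Removing the part of `R` in the range of `V j` makes the values orthogonal to `Ω j`, as `Ω j`
  -- lies in that range; the removed part of `R η` is covered by `hisom`.
  set u : E j →L[ℂ] E j := R - V j * star (V j) * R with hu
  have huJ : u ∈ intertwiners (fun a => π j a) (fun a => π j (θ j a)) := by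
    intro a
    have h1 := mul_mem_intertwiners (commute_mul_star hs (hVθ j) (hVθ j)) hR a
    rw [hu, sub_mul, mul_sub, h1, hR a]
  have hu0 : ∀ ξ, ⟪Ω j, u ξ⟫_ℂ = 0 := by
    intro ξ
    have h1 : ∀ ζ, ⟪Ω j, ζ⟫_ℂ = ⟪Ω j, star (V j) ζ⟫_ℂ := fun ζ => by
      rw [ContinuousLinearMap.star_eq_adjoint, ContinuousLinearMap.adjoint_inner_right, hV]
    rw [hu, sub_apply, inner_sub_right, mul_apply_eq_comp, mul_apply_eq_comp, h1, h1 (V j _), hVV,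
      sub_self]
  set y := u * star (V j) with hy
  have hyc : ∀ a, y * π j (θ j a) = π j (θ j a) * y := commute_mul_star hs huJ (hVθ j)
  have hyR : ∀ p, rightOp hΩ j y * freeRepMap hΩ π θ p = freeRepMap hΩ π θ p * rightOp hΩ j y := by
    rintro ⟨i, x⟩
    by_cases h : i = j
    · subst h
      exact freeOp_mul_rightOp_of_commute hΩ (hyc x)
    · exact freeOp_mul_rightOp_of_ne hΩ h _ _
  have hR0 := mul_mem_intertwiners hyR hWJ
  have h3 : R η = V j (star (V j) (R η)) + u η := by
    rw [hu, sub_apply, mul_apply_eq_comp, mul_apply_eq_comp, add_sub_cancel]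
  let ζ : (ℂ ∙ Ω j)ᗮ := ⟨u η, Submodule.mem_orthogonal_singleton_iff_inner_right.2 (hu0 η)⟩
  -- On a single letter the right action agrees with the left one, and `y (V j η) = u η`. The
  -- remaining letters `l` are then appended from the right; the left-hand route through `listTensor
  -- j l` is closed because the left action of `y` need not commute with the images.
  have h4 : (rightOp hΩ j y * W) (listTensor j [] η) = listVec [⟨j, ζ⟩] := by
    rw [mul_apply_eq_comp, hWl, rightOp_listTensor_nil, hy, mul_apply_eq_comp, hVV]
    exact listTensor_orth (Ω := Ω) j [] ζ
  have hR0l : ∀ v, (rightOp hΩ j y * W) v ∈ endSpace Ω j := fun v => by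
    rw [mul_apply_eq_comp]
    exact rightOp_mem_endSpace hΩ (fun ξ => hu0 (star (V j) ξ)) (W v)
  have h5 : listVec (⟨j, ζ⟩ :: l) ∈ Q :=
    listVec_append_mem_interSpan hΩ π (w := []) (ξ := ζ) l hR0 hR0l h4 hl
  rw [h3, map_add]
  refine add_mem (hisom _) ?_
  rw [← listTensor_orth] at h5
  exact h5

/-- The free product of endomorphisms on the free product of representations, and its properties
if the ranges of the intertwiners span. -/
theorem existsUnique_freeRep_hom
    {S N : VonNeumannAlgebra (FreeSpace Ω)} (hS : S = generatedBy (Set.range (freeRep hΩ π)))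
    (hN : N = generatedBy (Set.range (freeRepMap hΩ π θ))) {mk : ∀ j, A j → S}
    (hmk : ∀ j x, (mk j x : FreeSpace Ω →L[ℂ] FreeSpace Ω) = freeRep hΩ π ⟨j, x⟩)
    (hc : ∀ i, (Submodule.span ℂ (Set.range fun a => π i a (Ω i))).topologicalClosure = ⊤)
    {V : ∀ i, E i →L[ℂ] E i} (hV : ∀ i, V i (Ω i) = Ω i)
    (hVi : ∀ i ξ η, ⟪V i ξ, V i η⟫_ℂ = ⟪ξ, η⟫_ℂ)
    (hVθ : ∀ i, V i ∈ intertwiners (fun a => π i a) (fun a => π i (θ i a))) :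
    (∃ z : N, (N.vectorState (vacuum Ω) norm_vacuum).IsCentralSupport z ∧
      ∃! T : S →⋆ₙₐ[ℂ] S, IsNormalMap T ∧ (T 1 : FreeSpace Ω →L[ℂ] FreeSpace Ω) = z ∧
        ∀ (j : ι) (x : A j), (T (mk j x) : FreeSpace Ω →L[ℂ] FreeSpace Ω) = z * mk j (θ j x)) ∧
    ((∀ i, interSpan (fun a => π i a) (fun a => π i (θ i a)) = ⊤) →
      (N.vectorState (vacuum Ω) norm_vacuum).IsCentralSupport 1 ∧
      ∃ T : S →⋆ₐ[ℂ] S, Function.Injective T ∧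
        (IsNormalMap T ∧ ∀ (j : ι) (x : A j), T (mk j x) = mk j (θ j x)) ∧
        ∀ T' : S →⋆ₐ[ℂ] S,
          (IsNormalMap T' ∧ ∀ (j : ι) (x : A j), T' (mk j x) = mk j (θ j x)) → T' = T) := by
  subst hS hN
  have hmk' : ∀ j x, mk j x = ⟨freeRep hΩ π ⟨j, x⟩, subset_generatedBy _ ⟨⟨j, x⟩, rfl⟩⟩ :=
    fun j x => Subtype.ext (hmk j x)
  simp only [hmk']
  obtain ⟨W, hWJ, hW1, hWΩ, -⟩ := exists_freeRep_intertwiner hΩ π hV hVi hVθ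
  have hh : ∀ p, freeRepMap hΩ π θ p ∈ generatedBy (Set.range (freeRep hΩ π)) := fun p =>
    subset_generatedBy _ (Set.mem_range_self (⟨p.1, θ p.1 p.2⟩ : Σ j, A j))
  have hp : ∀ p, freeRep hΩ π p ∈ StarAlgebra.adjoin ℂ (freeRep hΩ π '' {_p | True}) := fun p =>
    StarAlgebra.subset_adjoin ℂ _ ⟨p, trivial, rfl⟩
  refine ⟨?_, fun htop => ?_⟩
  · obtain ⟨z, hz, T, ⟨h1, h2, h3⟩, h4⟩ := existsUnique_normal_hom (exists_star_freeRep hΩ π)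
      hh hWJ hW1 norm_vacuum hWΩ (dense_freeRep_vacuum hΩ π hc) hp
    exact ⟨z, hz, T, ⟨h1, h2, fun j x => h3 ⟨j, x⟩ trivial⟩,
      fun T' h => h4 T' ⟨h.1, h.2.1, fun p _ => h.2.2 p.1 p.2⟩⟩
  · obtain ⟨h1, T, h2, ⟨h3, h4⟩, h5⟩ := existsUnique_normal_hom_of_interSpan_eq_top
      (exists_star_freeRep hΩ π) hh hWJ hW1 norm_vacuum hWΩ (dense_freeRep_vacuum hΩ π hc) hp
      (freeRep_interSpan_eq_top hΩ π hc hV hVi hVθ htop)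
    exact ⟨h1, T, h2, ⟨h3, fun j x => h4 ⟨j, x⟩ trivial⟩,
      fun T' h => h5 T' ⟨h.1, fun p _ => h.2 p.1 p.2⟩⟩

end FreeRep

end

noncomputable section

/-! ## Tensor products and free products of endomorphisms that preserve the states -/

namespace VonNeumannAlgebra

lemma NormalState.span_rep_cyclic {H : Type*} [NormedAddCommGroup H] [InnerProductSpace ℂ H]
    [CompleteSpace H] {M : VonNeumannAlgebra H} (φ : M.NormalState) :
    (Submodule.span ℂ (Set.range fun a => φ.rep a φ.cyclic)).topologicalClosure = ⊤ := by
  rw [funext φ.rep_cyclic]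
  exact φ.span_hat

variable {ι : Type*} {H : ι → Type*} [∀ i, NormedAddCommGroup (H i)]
  [∀ i, InnerProductSpace ℂ (H i)] [∀ i, CompleteSpace (H i)]
  {M : ∀ i, VonNeumannAlgebra (H i)} (φ : ∀ i, (M i).NormalState)
  (θ : ∀ i, M i →⋆ₐ[ℂ] M i)
  (hφ : ∀ i (x : M i), (φ i).toPositiveLinearMap (θ i x) = (φ i).toPositiveLinearMap x)
include hφ

theorem existsUnique_tensor_hom :
    (∃ z : tensorRange φ θ, (tensorState φ (tensorRange φ θ)).IsCentralSupport z ∧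
      ∃! T : tensorProduct φ →⋆ₙₐ[ℂ] tensorProduct φ, IsNormalMap T ∧
        (T 1 : TensorL2 φ →L[ℂ] TensorL2 φ) = z ∧
        ∀ x : FinFamily M, (∀ i, IsSelfAdjoint (x.1 i)) →
          (T (tensorMk φ x) : TensorL2 φ →L[ℂ] TensorL2 φ) = z * tensorMk φ (x.map θ)) ∧
    ((∀ i, interSpan (fun a => (φ i).rep a) (fun a => (φ i).rep (θ i a)) = ⊤) →
      (tensorState φ (tensorRange φ θ)).IsCentralSupport 1 ∧
      ∃ T : tensorProduct φ →⋆ₐ[ℂ] tensorProduct φ, Function.Injective T ∧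
        (IsNormalMap T ∧ ∀ x : FinFamily M, (∀ i, IsSelfAdjoint (x.1 i)) →
          T (tensorMk φ x) = tensorMk φ (x.map θ)) ∧
        ∀ T' : tensorProduct φ →⋆ₐ[ℂ] tensorProduct φ,
          (IsNormalMap T' ∧ ∀ x : FinFamily M, (∀ i, IsSelfAdjoint (x.1 i)) →
            T' (tensorMk φ x) = tensorMk φ (x.map θ)) → T' = T) :=
  existsUnique_tensorRep_hom (θ := θ) (fun i => (φ i).norm_cyclic) (fun i => (φ i).rep)
    (fun i => (φ i).span_rep_cyclic)
    (S := tensorProduct φ) (N := tensorRange φ θ) rfl rfl (mk := tensorMk φ) (fun _ => rfl)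
    (fun i => (φ i).isom_cyclic (hφ i))
    (fun i => (φ i).inner_isom (hφ i)) (fun i => (φ i).isom_mem_intertwiners (hφ i))

theorem existsUnique_free_hom :
    (∃ z : freeRange φ θ, (freeState φ (freeRange φ θ)).IsCentralSupport z ∧
      ∃! T : freeProduct φ →⋆ₙₐ[ℂ] freeProduct φ, IsNormalMap T ∧
        (T 1 : FreeL2 φ →L[ℂ] FreeL2 φ) = z ∧
        ∀ (j : ι) (x : M j),
          (T (freeMk φ j x) : FreeL2 φ →L[ℂ] FreeL2 φ) = z * freeMk φ j (θ j x)) ∧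
    ((∀ i, interSpan (fun a => (φ i).rep a) (fun a => (φ i).rep (θ i a)) = ⊤) →
      (freeState φ (freeRange φ θ)).IsCentralSupport 1 ∧
      ∃ T : freeProduct φ →⋆ₐ[ℂ] freeProduct φ, Function.Injective T ∧
        (IsNormalMap T ∧ ∀ (j : ι) (x : M j), T (freeMk φ j x) = freeMk φ j (θ j x)) ∧
        ∀ T' : freeProduct φ →⋆ₐ[ℂ] freeProduct φ,
          (IsNormalMap T' ∧ ∀ (j : ι) (x : M j), T' (freeMk φ j x) = freeMk φ j (θ j x)) →
            T' = T) :=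
  existsUnique_freeRep_hom (θ := θ) (fun i => (φ i).norm_cyclic) (fun i => (φ i).rep)
    (S := freeProduct φ) (N := freeRange φ θ) rfl rfl (mk := freeMk φ) (fun _ _ => rfl)
    (fun i => (φ i).span_rep_cyclic) (fun i => (φ i).isom_cyclic (hφ i))
    (fun i => (φ i).inner_isom (hφ i)) (fun i => (φ i).isom_mem_intertwiners (hφ i))

end VonNeumannAlgebra

end

theorem mainTheorem11 {ι : Type*} {H : ι → Type*} [∀ i, NormedAddCommGroup (H i)]
    [∀ i, InnerProductSpace ℂ (H i)] [∀ i, CompleteSpace (H i)]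
    (M : ∀ i, VonNeumannAlgebra (H i)) (φ : ∀ i, (M i).NormalState)
    (θ : ∀ i, M i →⋆ₐ[ℂ] M i) (hθ : ∀ i, VonNeumannAlgebra.IsNormalMap (θ i))
    (hφ : ∀ i (x : M i), (φ i).toPositiveLinearMap (θ i x) = (φ i).toPositiveLinearMap x) :
    -- the tensor product
    (∃ z : VonNeumannAlgebra.tensorRange φ θ,
      (VonNeumannAlgebra.tensorState φ (VonNeumannAlgebra.tensorRange φ θ)).IsCentralSupport z ∧
      ∃! T : VonNeumannAlgebra.tensorProduct φ →⋆ₙₐ[ℂ] VonNeumannAlgebra.tensorProduct φ,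
        VonNeumannAlgebra.IsNormalMap T ∧
        (T 1 : VonNeumannAlgebra.TensorL2 φ →L[ℂ] VonNeumannAlgebra.TensorL2 φ) = z ∧
        ∀ x : VonNeumannAlgebra.FinFamily M, (∀ i, IsSelfAdjoint (x.1 i)) →
          (T (VonNeumannAlgebra.tensorMk φ x) :
            VonNeumannAlgebra.TensorL2 φ →L[ℂ] VonNeumannAlgebra.TensorL2 φ) =
          z * VonNeumannAlgebra.tensorMk φ (x.map θ)) ∧
    -- the free product
    (∃ z : VonNeumannAlgebra.freeRange φ θ,
      (VonNeumannAlgebra.freeState φ (VonNeumannAlgebra.freeRange φ θ)).IsCentralSupport z ∧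
      ∃! T : VonNeumannAlgebra.freeProduct φ →⋆ₙₐ[ℂ] VonNeumannAlgebra.freeProduct φ,
        VonNeumannAlgebra.IsNormalMap T ∧
        (T 1 : VonNeumannAlgebra.FreeL2 φ →L[ℂ] VonNeumannAlgebra.FreeL2 φ) = z ∧
        ∀ (j : ι) (x : M j),
          (T (VonNeumannAlgebra.freeMk φ j x) :
            VonNeumannAlgebra.FreeL2 φ →L[ℂ] VonNeumannAlgebra.FreeL2 φ) =
          z * VonNeumannAlgebra.freeMk φ j (θ j x)) ∧
    -- factors
    ((∀ i, (M i).IsFactor) →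
      (∀ i, Function.Injective (θ i)) ∧
      ((VonNeumannAlgebra.tensorState φ
          (VonNeumannAlgebra.tensorRange φ θ)).IsCentralSupport 1 ∧
        ∃ T : VonNeumannAlgebra.tensorProduct φ →⋆ₐ[ℂ] VonNeumannAlgebra.tensorProduct φ,
          Function.Injective T ∧
          (VonNeumannAlgebra.IsNormalMap T ∧
            ∀ x : VonNeumannAlgebra.FinFamily M, (∀ i, IsSelfAdjoint (x.1 i)) →
              T (VonNeumannAlgebra.tensorMk φ x) = VonNeumannAlgebra.tensorMk φ (x.map θ)) ∧
          ∀ T' : VonNeumannAlgebra.tensorProduct φ →⋆ₐ[ℂ] VonNeumannAlgebra.tensorProduct φ,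
            (VonNeumannAlgebra.IsNormalMap T' ∧
              ∀ x : VonNeumannAlgebra.FinFamily M, (∀ i, IsSelfAdjoint (x.1 i)) →
                T' (VonNeumannAlgebra.tensorMk φ x) =
                  VonNeumannAlgebra.tensorMk φ (x.map θ)) → T' = T) ∧
      ((VonNeumannAlgebra.freeState φ
          (VonNeumannAlgebra.freeRange φ θ)).IsCentralSupport 1 ∧
        ∃ T : VonNeumannAlgebra.freeProduct φ →⋆ₐ[ℂ] VonNeumannAlgebra.freeProduct φ,
          Function.Injective T ∧
          (VonNeumannAlgebra.IsNormalMap T ∧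
            ∀ (j : ι) (x : M j),
              T (VonNeumannAlgebra.freeMk φ j x) = VonNeumannAlgebra.freeMk φ j (θ j x)) ∧
          ∀ T' : VonNeumannAlgebra.freeProduct φ →⋆ₐ[ℂ] VonNeumannAlgebra.freeProduct φ,
            (VonNeumannAlgebra.IsNormalMap T' ∧
              ∀ (j : ι) (x : M j),
                T' (VonNeumannAlgebra.freeMk φ j x) = VonNeumannAlgebra.freeMk φ j (θ j x)) →
              T' = T)) := by
  have h1 := VonNeumannAlgebra.existsUnique_tensor_hom φ θ hφ
  have h2 := VonNeumannAlgebra.existsUnique_free_hom φ θ hφ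
  -- Totality of the intertwiner ranges on each single `L²`, which both products take as input.
  have h3 := fun (hM : ∀ i, (M i).IsFactor) i => (φ i).interSpan_eq_top (hM i) (hθ i)
  refine ⟨h1.1, h2.1, fun hM => ⟨fun i => ?_, h1.2 (h3 hM), h2.2 (h3 hM)⟩⟩
  have := (φ i).nontrivial
  exact (hM i).injective (hθ i)
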